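/- Let $d,n\in\mathbb N$ and let $\mathcal D$ be a dyadic grid in $\mathbb R^d$: a family of half-open cubes with side lengths $2^k$, $k\in\mathbb Z$, any two of which are nested or disjoint, such that for each $k$ the cubes of side length $2^k$ partition $\mathbb R^d$. Let $\mathcal S=\{0,1\}^d\setminus\{(1,\dots,1)\}$. For an interval $I$ with left and right halves $I_\ell,I_r$ put $h_I^1=|I|^{-1/2}\chi_I$, $h_I^0=|I|^{-1/2}(\chi_{I_\ell}-\chi_{I_r})$, and for a cube $I=I_1\times\dots\times I_d$ put $h_I^\varepsilon=\prod_i h_{I_i}^{\varepsilon_i}$. For a locally integrable $\Phi:\mathbb R^d\to M_n(\mathbb C)$ write $m_I\Phi=|I|^{-1}\int_I\Phi$ and $\Phi_I^\varepsilon=\int \Phi\,h_I^\varepsilon$; let $\|\cdot\|$ be the operator norm on $M_n(\mathbb C)$. A matrix $A_2$ weight is a measurable, a.e. positive definite $W:\mathbb R^d\to M_n(\mathbb C)$ with $$[W]_{A_2}=\sup_{I}\frac1{|I|}\int_I\frac1{|I|}\int_I\|W^{1/2}(x)W^{-1/2}(t)\|^2\,dt\,dx<\infty,$$ the supremum being over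 all cubes $I\subset\mathbb R^d$ with sides parallel to the axes. Let $W,U$ be matrix $A_2$ weights. $H^1_{W,U,\mathcal D}$ is the space of locally integrable $\Phi:\mathbb R^d\to M_n(\mathbb C)$ with $$\|\Phi\|_{H^1_{W,U,\mathcal D}}=\int_{\mathbb R^d}\Big(\sum_{\varepsilon\in\mathcal S}\sum_{I\in\mathcal D}\frac{\|W^{-1/2}(x)\,\Phi_I^\varepsilon\,(m_IU)^{1/2}\|^2}{|I|}\chi_I(x)\Big)^{1/2}dx<\infty ,$$ that is, $S_{W^{-1},\mathcal D}M_U\Phi\in L^1$; this is a seminorm, and $(H^1_{W,U,\mathcal D})^*$ denotes the space of bounded linear functionals. $\mathrm{BMO}^2_{W,U,\mathcal D}$ is the space of locally integrable $B:\mathbb R^d\to M_n(\mathbb C)$ for which there is $\delta>0$ with $$\sup_{I\in\mathcal D}\frac1{|I|}\int_I\big\|(m_IW^{1/2})(B(x)-m_IB)(m_IU^{1/2})^{-1}\big\|^{1+\delta}dx<\infty,$$ functions with the same Haar coefficients $B_I^\varepsilon$ ($I\in\mathcal D$, $\varepsilon\in\mathcal S$) being identified, and with $$\|B\|_{\mathrm{BMO}^2_{W,U,\mathcal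 D}}=\sup_{J\in\mathcal D}\Big(\frac1{|J|}\sum_{\varepsilon\in\mathcal S}\sum_{I\in\mathcal D,\,I\subseteq J}\|(m_IW)^{1/2}B_I^\varepsilon(m_IU)^{-1/2}\|^2\Big)^{1/2}.$$ **Theorem.** $\mathrm{BMO}^2_{W,U,\mathcal D}=(H^1_{W,U,\mathcal D})^*$ under the pairing $$\langle\Phi,B\rangle_{L^2}=\sum_{\varepsilon\in\mathcal S}\sum_{I\in\mathcal D}\operatorname{tr}\big(\Phi_I^\varepsilon(B_I^\varepsilon)^*\big).$$ More precisely, there is a constant $C>0$ depending only on $d$ and $n$ such that for all $\mathcal D$, $W$, $U$ as above: 1. If $B\in \mathrm{BMO}^2_{W,U,\mathcal D}$, then $\|B\|_{\mathrm{BMO}^2_{W,U,\mathcal D}}<\infty$, the series $\langle\Phi,B\rangle_{L^2}$ converges absolutely for every $\Phi\in H^1_{W,U,\mathcal D}$, and $\Phi\mapsto\langle\Phi,B\rangle_{L^2}$ is a linear functional on $H^1_{W,U,\mathcal D}$ with $$|\langle\Phi,B\rangle_{L^2}|\le C\,[W]_{A_2}^{1/2}\,\|B\|_{\mathrm{BMO}^2_{W,U,\mathcal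 D}}\|\Phi\|_{H^1_{W,U,\mathcal D}}.$$ 2. For every $\ell\in(H^1_{W,U,\mathcal D})^*$ there is $B\in\mathrm{BMO}^2_{W,U,\mathcal D}$ with $\ell(\Phi)=\langle\Phi,B\rangle_{L^2}$ for all $\Phi\in H^1_{W,U,\mathcal D}$, and $\|B\|_{\mathrm{BMO}^2_{W,U,\mathcal D}}\le C\,[W]_{A_2}^{1/2}\|\ell\|$. 3. If $B,B'\in\mathrm{BMO}^2_{W,U,\mathcal D}$ induce the same functional, then $B_I^\varepsilon=(B')_I^\varepsilon$ for all $I\in\mathcal D$, $\varepsilon\in\mathcal S$. 4. Every finite sum $\Phi=\sum A_I^\varepsilon h_I^\varepsilon$ with $A_I^\varepsilon\in M_n(\mathbb C)$, $I\in\mathcal D$, $\varepsilon\in\mathcal S$, belongs to $H^1_{W,U,\mathcal D}$, and for $B\in\mathrm{BMO}^2_{W,U,\mathcal D}$ the function $\operatorname{tr}(\Phi B^*)$ is integrable with $\langle\Phi,B\rangle_{L^2}=\int_{\mathbb R^d}\operatorname{tr}(\Phi(x)B(x)^*)\,dx$. -/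

import Mathlib

open MeasureTheory
open scoped ENNReal NNReal Matrix ComplexOrder MatrixOrder Matrix.Norms.L2Operator

noncomputable section

namespace MatrixHardy

/-- Points of `ℝ^d`, with Lebesgue measure `volume`. -/
abbrev Pt (d : ℕ) : Type := Fin d → ℝ

/-- Complex `n × n` matrices. The scoped instances opened above equip them with the operator norm
of `ℂⁿ` (Euclidean) and with the Loewner order. -/
abbrev Mat (n : ℕ) : Type := Matrix (Fin n) (Fin n) ℂ

/-! ### Cubes, dyadic grids, Haar functions -/

/-- A half-open cube `∏ i, [corner i, corner i + side)` in `ℝ^d`. -/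
@[ext] structure Cube (d : ℕ) where
  corner : Fin d → ℝ
  side : ℝ
  side_pos : 0 < side

/-- The set of points of a cube. -/
def Cube.pts {d : ℕ} (I : Cube d) : Set (Pt d) :=
  {x | ∀ i, x i ∈ Set.Ico (I.corner i) (I.corner i + I.side)}

/-- A dyadic grid: cubes of side lengths `2 ^ k`, `k ∈ ℤ`, those of each fixed side length
partition `ℝ^d`, and any two cubes of the grid are nested or disjoint. -/
structure DyadicGrid (d : ℕ) where
  cubes : Set (Cube d)
  side_eq : ∀ I ∈ cubes, ∃ k : ℤ, I.side = 2 ^ k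
  partition : ∀ (k : ℤ) (x : Pt d), ∃! I : Cube d, I ∈ cubes ∧ I.side = 2 ^ k ∧ x ∈ I.pts
  nested : ∀ I ∈ cubes, ∀ J ∈ cubes, I.pts ⊆ J.pts ∨ J.pts ⊆ I.pts ∨ Disjoint I.pts J.pts

/-- The signatures `{0,1}^d ∖ {(1, …, 1)}` of the cancellative Haar functions. -/
def Sig (d : ℕ) : Type := {e : Fin d → Fin 2 // e ≠ fun _ => 1}

/-- The one-dimensional Haar functions of the interval `[a, a + s)`: for `e = 1` the normalized
indicator of the interval, for `e = 0` the normalized indicator of the left half minus the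
normalized indicator of the right half. -/
def haarOne (a s : ℝ) (e : Fin 2) (t : ℝ) : ℝ :=
  (Real.sqrt s)⁻¹ *
    (if e = 1 then (Set.Ico a (a + s)).indicator 1 t
     else (Set.Ico a (a + s / 2)).indicator 1 t - (Set.Ico (a + s / 2) (a + s)).indicator 1 t)

/-- The Haar function `h_I ^ e` of a cube, as a tensor product. -/
def haar {d : ℕ} (I : Cube d) (e : Fin d → Fin 2) (x : Pt d) : ℝ :=
  ∏ i, haarOne (I.corner i) I.side (e i) (x i)

/-- The index set `D × ({0,1}^d ∖ {(1, …, 1)})` of the Haar system of a dyadic grid. -/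
abbrev HaarIdx {d : ℕ} (D : DyadicGrid d) : Type := D.cubes × Sig d

/-- The matrix `Φ_I ^ ε` of Haar coefficients of a matrix function. -/
def haarCoeff {d n : ℕ} (D : DyadicGrid d) (Φ : Pt d → Mat n) (p : HaarIdx D) : Mat n :=
  ∫ x, haar p.1.1 p.2.1 x • Φ x

/-- The average `m_I F` of a matrix function over a cube. -/
def avg {d n : ℕ} (I : Cube d) (F : Pt d → Mat n) : Mat n := ⨍ x in I.pts, F x

/-! ### Matrix `A₂` weights -/

/-- The matrix `A₂` characteristic: the supremum over all cubes `I` of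
`|I|⁻¹ ∫_I |I|⁻¹ ∫_I ‖W(x)^{1/2} W(t)^{-1/2}‖² dt dx`. -/
def a2Char {d n : ℕ} (W : Pt d → Mat n) : ℝ≥0∞ :=
  ⨆ I : Cube d, (volume I.pts)⁻¹ * ∫⁻ x in I.pts,
    (volume I.pts)⁻¹ * ∫⁻ t in I.pts, ‖CFC.sqrt (W x) * (CFC.sqrt (W t))⁻¹‖ₑ ^ 2

/-- A matrix `A₂` weight on `ℝ^d`: a measurable matrix function, positive definite almost
everywhere, with finite matrix `A₂` characteristic. -/
structure A2Weight (d n : ℕ) where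
  fn : Pt d → Mat n
  aestronglyMeasurable : AEStronglyMeasurable fn volume
  posDef : ∀ᵐ x, (fn x).PosDef
  a2Char_lt_top : a2Char fn < ∞

/-! ### The space `H¹_{W,U,D}` -/

/-- The square function `S_{V,D}`, in terms of the Haar coefficients `A_I ^ ε`:
`S(x)² = ∑_ε ∑_I ‖V(x)^{1/2} A_I ^ ε‖² |I|⁻¹ χ_I(x)`. -/
def sqFun {d n : ℕ} (D : DyadicGrid d) (V : Pt d → Mat n) (A : HaarIdx D → Mat n) (x : Pt d) :
    ℝ≥0∞ :=
  (∑' p : HaarIdx D,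
    p.1.1.pts.indicator (fun y => ‖CFC.sqrt (V y) * A p‖ₑ ^ 2 / volume p.1.1.pts) x) ^ (1 / 2 : ℝ)

/-- The Haar multiplier `M_U` acting on Haar coefficients: `A_I ^ ε ↦ A_I ^ ε (m_I U)^{1/2}`. -/
def haarMul {d n : ℕ} (D : DyadicGrid d) (U : Pt d → Mat n) (A : HaarIdx D → Mat n) :
    HaarIdx D → Mat n :=
  fun p => A p * CFC.sqrt (avg p.1.1 U)

/-- `‖Φ‖_{H¹} = ∫ S_{W⁻¹,D} (M_U Φ)`, possibly infinite. -/
def h1Norm {d n : ℕ} (D : DyadicGrid d) (W U : Pt d → Mat n) (Φ : Pt d → Mat n) : ℝ≥0∞ :=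
  ∫⁻ x, sqFun D (fun y => (W y)⁻¹) (haarMul D U (haarCoeff D Φ)) x

section Aux

variable {d n : ℕ}

lemma measurableSet_pts (I : Cube d) : MeasurableSet I.pts := by
  have : I.pts = Set.pi Set.univ (fun i => Set.Ico (I.corner i) (I.corner i + I.side)) := by
    ext x; simp [Cube.pts]
  rw [this]
  exact MeasurableSet.univ_pi fun i => measurableSet_Ico

lemma interior_pts_nonempty (I : Cube d) : (interior I.pts).Nonempty := by
  have h : Set.pi Set.univ (fun i => Set.Ioo (I.corner i) (I.corner i + I.side)) ⊆ I.pts :=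
    fun x hx i => Set.Ioo_subset_Ico_self (hx i trivial)
  refine ⟨fun i => I.corner i + I.side / 2, interior_maximal h
    (isOpen_set_pi Set.finite_univ fun i _ => isOpen_Ioo) fun i _ => ?_⟩
  have := I.side_pos
  constructor <;> simp <;> linarith

lemma DyadicGrid.countable (D : DyadicGrid d) : D.cubes.Countable := by
  have h : D.cubes ⊆ ⋃ k : ℤ, {I ∈ D.cubes | I.side = 2 ^ k} := fun I hI => by
    obtain ⟨k, hk⟩ := D.side_eq I hI
    exact Set.mem_iUnion.2 ⟨k, hI, hk⟩
  refine (Set.countable_iUnion fun k => ?_).mono h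
  refine Set.PairwiseDisjoint.countable_of_nonempty_interior (s := Cube.pts) ?_
    fun I _ => interior_pts_nonempty I
  intro I hI J hJ hne
  refine Set.disjoint_left.2 fun x hxI hxJ => hne ?_
  exact (D.partition k x).unique ⟨hI.1, hI.2, hxI⟩ ⟨hJ.1, hJ.2, hxJ⟩

instance (D : DyadicGrid d) : Countable D.cubes := D.countable.to_subtype

instance : Finite (Sig d) := by unfold Sig; infer_instance

instance (D : DyadicGrid d) : Countable (HaarIdx D) := inferInstance

lemma pts_subset_Icc (I : Cube d) :
    I.pts ⊆ Set.Icc I.corner (fun i => I.corner i + I.side) :=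
  fun _ hx => ⟨fun i => (hx i).1, fun i => (hx i).2.le⟩

lemma measurable_haarOne (a s : ℝ) (e : Fin 2) : Measurable (haarOne a s e) := by
  unfold haarOne
  refine Measurable.const_mul ?_ _
  split_ifs
  · exact measurable_one.indicator measurableSet_Ico
  · exact (measurable_one.indicator measurableSet_Ico).sub
      (measurable_one.indicator measurableSet_Ico)

lemma measurable_haar (I : Cube d) (e : Fin d → Fin 2) : Measurable (haar I e) := by
  unfold haar
  exact Finset.measurable_prod _ fun i _ =>
    (measurable_haarOne _ _ _).comp (measurable_pi_apply i)

lemma abs_haarOne_le (a s : ℝ) (e : Fin 2) (t : ℝ) :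
    |haarOne a s e t| ≤ (Real.sqrt s)⁻¹ * 2 := by
  unfold haarOne
  rw [abs_mul, abs_of_nonneg (inv_nonneg.2 (Real.sqrt_nonneg s))]
  refine mul_le_mul_of_nonneg_left ?_ (inv_nonneg.2 (Real.sqrt_nonneg s))
  split_ifs <;> simp only [Set.indicator_apply, Pi.one_apply] <;> split_ifs <;> norm_num

lemma haarOne_eq_zero {a s : ℝ} (hs : 0 < s) (e : Fin 2) {t : ℝ} (ht : t ∉ Set.Ico a (a + s)) :
    haarOne a s e t = 0 := by
  have h1 : t ∉ Set.Ico a (a + s / 2) := fun h => ht ⟨h.1, by linarith [h.2]⟩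
  have h2 : t ∉ Set.Ico (a + s / 2) (a + s) := fun h => ht ⟨by linarith [h.1], h.2⟩
  simp [haarOne, Set.indicator_of_notMem ht, Set.indicator_of_notMem h1,
    Set.indicator_of_notMem h2]

lemma haar_eq_zero (I : Cube d) (e : Fin d → Fin 2) {x : Pt d} (hx : x ∉ I.pts) :
    haar I e x = 0 := by
  simp only [Cube.pts, Set.mem_ofPred_eq, not_forall] at hx
  obtain ⟨i, hi⟩ := hx
  exact Finset.prod_eq_zero (Finset.mem_univ i) (haarOne_eq_zero I.side_pos _ hi)

lemma integrable_haar_smul (I : Cube d) (e : Fin d → Fin 2) {Φ : Pt d → Mat n}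
    (h : LocallyIntegrable Φ volume) : Integrable (fun x => haar I e x • Φ x) volume := by
  have hI : IntegrableOn Φ I.pts volume :=
    (h.integrableOn_isCompact isCompact_Icc).mono_set (pts_subset_Icc I)
  have h2 : IntegrableOn (fun x => haar I e x • Φ x) I.pts volume := by
    refine Integrable.bdd_smul hI (∏ _i : Fin d, (Real.sqrt I.side)⁻¹ * 2)
      (measurable_haar I e).aestronglyMeasurable (Filter.Eventually.of_forall fun x => ?_)
    rw [Real.norm_eq_abs, haar, Finset.abs_prod]
    exact Finset.prod_le_prod (fun i _ => abs_nonneg _) fun i _ => abs_haarOne_le _ _ _ _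
  refine (integrableOn_iff_integrable_of_support_subset fun x hx => ?_).1 h2
  by_contra hc
  exact hx (by simp [haar_eq_zero I e hc])

lemma haarCoeff_add (D : DyadicGrid d) {Φ Ψ : Pt d → Mat n} (hΦ : LocallyIntegrable Φ volume)
    (hΨ : LocallyIntegrable Ψ volume) :
    haarCoeff D (Φ + Ψ) = haarCoeff D Φ + haarCoeff D Ψ := by
  funext p
  simp only [haarCoeff, Pi.add_apply, smul_add]
  exact integral_add (integrable_haar_smul _ _ hΦ) (integrable_haar_smul _ _ hΨ)

lemma haarCoeff_smul (D : DyadicGrid d) (c : ℂ) (Φ : Pt d → Mat n) :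
    haarCoeff D (c • Φ) = c • haarCoeff D Φ := by
  funext p
  simp only [haarCoeff, Pi.smul_apply]
  rw [← integral_smul]
  exact integral_congr_ae (Filter.Eventually.of_forall fun x => smul_comm _ _ _)

lemma haarMul_add (D : DyadicGrid d) (U : Pt d → Mat n) (A B : HaarIdx D → Mat n) :
    haarMul D U (A + B) = haarMul D U A + haarMul D U B := by
  funext p; simp [haarMul, add_mul]

lemma haarMul_smul (D : DyadicGrid d) (U : Pt d → Mat n) (c : ℂ) (A : HaarIdx D → Mat n) :
    haarMul D U (c • A) = c • haarMul D U A := by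
  funext p; simp [haarMul]

/-- Minkowski's inequality in `ℓ²`. -/
lemma ell_two_add_le {ι : Type*} (a b c : ι → ℝ≥0∞) (h : ∀ i, c i ≤ a i + b i) :
    (∑' i, c i ^ 2) ^ (1 / 2 : ℝ) ≤
      (∑' i, a i ^ 2) ^ (1 / 2 : ℝ) + (∑' i, b i ^ 2) ^ (1 / 2 : ℝ) := by
  let _ : MeasurableSpace ι := ⊤
  have := ENNReal.lintegral_Lp_add_le (μ := Measure.count) (p := 2) (f := a) (g := b)
    (measurable_from_top).aemeasurable (measurable_from_top).aemeasurable (by norm_num)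
  simp only [lintegral_count, ENNReal.rpow_two, Pi.add_apply] at this
  refine le_trans ?_ this
  gcongr with i
  exact h i

lemma sqFun_eq (D : DyadicGrid d) (V : Pt d → Mat n) (A : HaarIdx D → Mat n) (x : Pt d) :
    sqFun D V A x = (∑' p : HaarIdx D, (p.1.1.pts.indicator
      (fun y => ‖CFC.sqrt (V y) * A p‖ₑ / volume p.1.1.pts ^ (1 / 2 : ℝ)) x) ^ 2) ^
        (1 / 2 : ℝ) := by
  unfold sqFun
  congr 1
  refine tsum_congr fun p => ?_
  by_cases hx : x ∈ p.1.1.pts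
  · rw [Set.indicator_of_mem hx, Set.indicator_of_mem hx, div_eq_mul_inv, div_eq_mul_inv,
      mul_pow, ← ENNReal.inv_pow, ← ENNReal.rpow_natCast (_ ^ (1 / 2 : ℝ)), ← ENNReal.rpow_mul]
    norm_num
  · simp [hx]

lemma sqFun_add_le (D : DyadicGrid d) (V : Pt d → Mat n) (A B : HaarIdx D → Mat n) (x : Pt d) :
    sqFun D V (A + B) x ≤ sqFun D V A x + sqFun D V B x := by
  simp only [sqFun_eq]
  refine ell_two_add_le _ _ _ fun p => ?_
  by_cases hx : x ∈ p.1.1.pts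
  · simp only [Set.indicator_of_mem hx, ← ENNReal.add_div, Pi.add_apply, mul_add]
    gcongr
    exact enorm_add_le _ _
  · simp [hx]

lemma sqFun_smul (D : DyadicGrid d) (V : Pt d → Mat n) (c : ℂ) (A : HaarIdx D → Mat n)
    (x : Pt d) : sqFun D V (c • A) x = ‖c‖ₑ * sqFun D V A x := by
  unfold sqFun
  have h : ∀ p : HaarIdx D, p.1.1.pts.indicator
      (fun y => ‖CFC.sqrt (V y) * (c • A) p‖ₑ ^ 2 / volume p.1.1.pts) x =
      ‖c‖ₑ ^ 2 * p.1.1.pts.indicator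
        (fun y => ‖CFC.sqrt (V y) * A p‖ₑ ^ 2 / volume p.1.1.pts) x := fun p => by
    by_cases hx : x ∈ p.1.1.pts
    · simp only [Set.indicator_of_mem hx, Pi.smul_apply, Matrix.mul_smul, enorm_smul, mul_pow,
        mul_div_assoc]
    · simp [hx]
  simp only [h]
  rw [ENNReal.tsum_mul_left, ENNReal.mul_rpow_of_nonneg _ _ (by norm_num),
    ← ENNReal.rpow_natCast, ← ENNReal.rpow_mul]
  norm_num

lemma sq_enorm_sqrt_mul {V : Mat n} (hV : V.PosSemidef) (A : Mat n) :
    ‖CFC.sqrt V * A‖ₑ ^ 2 = ‖Aᴴ * V * A‖ₑ := by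
  have h1 : (CFC.sqrt V)ᴴ = CFC.sqrt V := 
    (Matrix.nonneg_iff_posSemidef.1 (CFC.sqrt_nonneg V)).isHermitian
  have h2 : CFC.sqrt V * CFC.sqrt V = V := CFC.sqrt_mul_sqrt_self V hV.nonneg
  have h3 : Aᴴ * V * A = star (CFC.sqrt V * A) * (CFC.sqrt V * A) := by
    rw [Matrix.star_eq_conjTranspose, Matrix.conjTranspose_mul, h1]
    calc Aᴴ * V * A = Aᴴ * (CFC.sqrt V * CFC.sqrt V) * A := by rw [h2]
      _ = _ := by simp only [Matrix.mul_assoc]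
  rw [h3, sq, enorm_eq_nnnorm, enorm_eq_nnnorm, CStarRing.nnnorm_star_mul_self]
  push_cast
  rfl

lemma A2Weight.aestronglyMeasurable_inv (W : A2Weight d n) :
    AEStronglyMeasurable (fun x => (W.fn x)⁻¹) volume := by
  have hdet : AEStronglyMeasurable (fun x => (W.fn x).det) volume :=
    (Continuous.matrix_det continuous_id).comp_aestronglyMeasurable W.aestronglyMeasurable
  have hadj : AEStronglyMeasurable (fun x => (W.fn x).adjugate) volume :=
    (Continuous.matrix_adjugate continuous_id).comp_aestronglyMeasurable W.aestronglyMeasurable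
  have : (fun x => (W.fn x)⁻¹) = fun x => ((W.fn x).det)⁻¹ • (W.fn x).adjugate := by
    funext x; rw [Matrix.inv_def, Ring.inverse_eq_inv']
  rw [this]
  exact (hdet.aemeasurable.inv.aestronglyMeasurable).smul hadj

lemma aemeasurable_sqFun (D : DyadicGrid d) (W : A2Weight d n) (A : HaarIdx D → Mat n) :
    AEMeasurable (sqFun D (fun y => (W.fn y)⁻¹) A) volume := by
  unfold sqFun
  refine AEMeasurable.pow_const (AEMeasurable.tsum fun p => ?_) _
  refine AEMeasurable.indicator ?_ (measurableSet_pts _)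
  refine AEMeasurable.div_const ?_ _
  have h : AEMeasurable (fun y => ‖(A p)ᴴ * (W.fn y)⁻¹ * A p‖ₑ) volume :=
    AEStronglyMeasurable.enorm ((Continuous.comp_aestronglyMeasurable (g := fun V : Mat n =>
      (A p)ᴴ * V * A p) (by fun_prop) W.aestronglyMeasurable_inv))
  refine h.congr ?_
  filter_upwards [W.posDef] with y hy
  exact (sq_enorm_sqrt_mul hy.inv.posSemidef (A p)).symm

lemma h1Norm_add_le (D : DyadicGrid d) (W U : A2Weight d n) {Φ Ψ : Pt d → Mat n}
    (hΦ : LocallyIntegrable Φ volume) (hΨ : LocallyIntegrable Ψ volume) :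
    h1Norm D W.fn U.fn (Φ + Ψ) ≤ h1Norm D W.fn U.fn Φ + h1Norm D W.fn U.fn Ψ := by
  unfold h1Norm
  rw [haarCoeff_add D hΦ hΨ, haarMul_add, ← lintegral_add_left' (aemeasurable_sqFun D W _)]
  exact lintegral_mono fun x => sqFun_add_le D _ _ _ x

lemma h1Norm_smul (D : DyadicGrid d) (W U : A2Weight d n) (c : ℂ) (Φ : Pt d → Mat n) :
    h1Norm D W.fn U.fn (c • Φ) = ‖c‖ₑ * h1Norm D W.fn U.fn Φ := by
  unfold h1Norm
  simp only [haarCoeff_smul, haarMul_smul, sqFun_smul]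
  exact lintegral_const_mul'' _ (aemeasurable_sqFun D W _)

lemma h1Norm_zero (D : DyadicGrid d) (W U : A2Weight d n) :
    h1Norm D W.fn U.fn (0 : Pt d → Mat n) = 0 := by
  have := h1Norm_smul D W U 0 (0 : Pt d → Mat n)
  simpa using this

end Aux

/-- `H¹_{W,U,D}` as a linear subspace of the space of all matrix functions: the locally integrable
`Φ` with `S_{W⁻¹,D} (M_U Φ) ∈ L¹`. -/
def h1Submodule {d n : ℕ} (D : DyadicGrid d) (W U : A2Weight d n) :
    Submodule ℂ (Pt d → Mat n) where
  carrier := {Φ | LocallyIntegrable Φ volume ∧ h1Norm D W.fn U.fn Φ < ∞}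
  add_mem' := fun hΦ hΨ => ⟨hΦ.1.add hΨ.1,
    (h1Norm_add_le D W U hΦ.1 hΨ.1).trans_lt (ENNReal.add_lt_top.2 ⟨hΦ.2, hΨ.2⟩)⟩
  zero_mem' := ⟨locallyIntegrable_zero, by rw [h1Norm_zero]; exact ENNReal.zero_lt_top⟩
  smul_mem' := fun c Φ hΦ => ⟨hΦ.1.smul c, by
    rw [h1Norm_smul]; exact ENNReal.mul_lt_top enorm_lt_top hΦ.2⟩

/-- The space `H¹_{W,U,D}`, seminormed by `‖Φ‖ = ∫ S_{W⁻¹,D} (M_U Φ)`. -/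
def H1 {d n : ℕ} (D : DyadicGrid d) (W U : A2Weight d n) : Type := h1Submodule D W U

namespace H1

variable {d n : ℕ} {D : DyadicGrid d} {W U : A2Weight d n}

instance : AddCommGroup (H1 D W U) := inferInstanceAs (AddCommGroup (h1Submodule D W U))

instance : Module ℂ (H1 D W U) := inferInstanceAs (Module ℂ (h1Submodule D W U))

/-- The underlying matrix function. -/
def fn (Φ : H1 D W U) : Pt d → Mat n := Subtype.val (p := (· ∈ h1Submodule D W U)) Φ

instance : Norm (H1 D W U) := ⟨fun Φ => (h1Norm D W.fn U.fn Φ.fn).toReal⟩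

lemma seminormCore : SeminormedSpace.Core ℂ (H1 D W U) where
  norm_nonneg _ := ENNReal.toReal_nonneg
  norm_smul c Φ := by
    change (h1Norm D W.fn U.fn (c • Φ.fn)).toReal = ‖c‖ * (h1Norm D W.fn U.fn Φ.fn).toReal
    rw [h1Norm_smul, ENNReal.toReal_mul, toReal_enorm]
  norm_triangle Φ Ψ := by
    change (h1Norm D W.fn U.fn (Φ.fn + Ψ.fn)).toReal ≤
      (h1Norm D W.fn U.fn Φ.fn).toReal + (h1Norm D W.fn U.fn Ψ.fn).toReal
    rw [← ENNReal.toReal_add (a := h1Norm D W.fn U.fn Φ.fn) (b := h1Norm D W.fn U.fn Ψ.fn)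
      Φ.2.2.ne Ψ.2.2.ne]
    exact ENNReal.toReal_mono (ENNReal.add_lt_top.2 ⟨Φ.2.2, Ψ.2.2⟩).ne
      (h1Norm_add_le D W U Φ.2.1 Ψ.2.1)

instance : SeminormedAddCommGroup (H1 D W U) := SeminormedAddCommGroup.ofCore seminormCore

instance : NormedSpace ℂ (H1 D W U) := ⟨fun c Φ => (seminormCore.norm_smul c Φ).le⟩

end H1

/-! ### The space `BMO²_{W,U,D}` -/

/-- Membership in `BMO²_{W,U,D}`: `B` is locally integrable and for some `δ > 0` the averages over
the cubes `I` of the grid of `‖(m_I W^{1/2}) (B(x) - m_I B) (m_I U^{1/2})⁻¹‖^{1+δ}` are bounded. -/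
def MemBMO {d n : ℕ} (D : DyadicGrid d) (W U : Pt d → Mat n) (B : Pt d → Mat n) : Prop :=
  LocallyIntegrable B volume ∧ ∃ δ : ℝ, 0 < δ ∧
    ⨆ I ∈ D.cubes, (volume I.pts)⁻¹ * ∫⁻ x in I.pts,
      ‖avg I (fun y => CFC.sqrt (W y)) * (B x - avg I B) *
        (avg I (fun y => CFC.sqrt (U y)))⁻¹‖ₑ ^ (1 + δ) < ∞

/-- The norm of `BMO²_{W,U,D}`: `‖B‖² = sup_{J ∈ D} |J|⁻¹ ∑_ε ∑_{I ∈ D, I ⊆ J}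
‖(m_I W)^{1/2} B_I ^ ε (m_I U)^{-1/2}‖²`. -/
def bmoNorm {d n : ℕ} (D : DyadicGrid d) (W U : Pt d → Mat n) (B : Pt d → Mat n) : ℝ≥0∞ :=
  (⨆ J ∈ D.cubes, (volume J.pts)⁻¹ * ∑' p : {p : HaarIdx D // p.1.1.pts ⊆ J.pts},
    ‖CFC.sqrt (avg p.1.1.1 W) * haarCoeff D B p.1 * (CFC.sqrt (avg p.1.1.1 U))⁻¹‖ₑ ^ 2) ^
      (1 / 2 : ℝ)

/-! ### The pairing -/

/-- `ℓ(Φ) = ⟨Φ, B⟩_{L²} = ∑_ε ∑_I tr (Φ_I ^ ε (B_I ^ ε)*)` for all `Φ ∈ H¹_{W,U,D}`, the series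
being unconditionally (hence absolutely) convergent. -/
def Represents {d n : ℕ} (D : DyadicGrid d) (W U : A2Weight d n) (B : Pt d → Mat n)
    (l : StrongDual ℂ (H1 D W U)) : Prop :=
  ∀ Φ : H1 D W U,
    HasSum (fun p : HaarIdx D => (haarCoeff D Φ.fn p * (haarCoeff D B p).conjTranspose).trace)
      (l Φ)

/-- The finite Haar sum `∑_{(I, ε) ∈ F} A_I ^ ε h_I ^ ε`. -/
def haarPoly {d n : ℕ} (D : DyadicGrid d) (F : Finset (HaarIdx D)) (A : HaarIdx D → Mat n)
    (x : Pt d) : Mat n :=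
  ∑ p ∈ F, haar p.1.1 p.2.1 x • A p

end MatrixHardy

end

open MeasureTheory
open scoped ENNReal NNReal Matrix ComplexOrder MatrixOrder Matrix.Norms.L2Operator

noncomputable section

namespace MatrixHardy

/-! Put V_I = (m_I W)^{1/2} and R_I = (m_I U)^{1/2}. In terms of Haar coefficients, the dual of H¹
consists of the Carleson sequences: families Z with Σ_{I ⊆ J} ‖V_I Z_I R_I⁻¹‖² ≤ M |J| for every J
in the grid. The proof establishes this duality and then identifies such sequences with the Haar
coefficients of BMO² functions.

Duality. For every x in I, the pairing of A_I with Z_I is at most n ‖W(x)^{-1/2} A_I R_I‖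
‖W(x)^{1/2} Z_I R_I⁻¹‖. This bound is averaged over the at least half of I where the square function
S is at most its median m_I, and AM–GM with weight S splits it. The first part sums to at most ∫ S
because Σ a_I ≤ S², and the second is a Carleson sum weighted by medians, controlled by the
layer-cake formula (`sum_enorm_trace_le`). Conversely, finite Haar sums are dense in H¹
(`H1.tendsto_poly_haarCoeff`), so a functional is determined by its coefficients. Testing it on a
suitable Haar sum inside J gives the Carleson condition (`carleson_of_functional`); the factor
[W]^{1/2} comes from tr(m_I W · m_I W⁻¹) ≤ n [W].

From Carleson sequences to functions. For fixed X and Y the block at I of X Z Y is bounded by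
averages of the scalar weights tr(X W⁻¹ X*) and tr(Y* U Y), which are A₂ uniformly in X and Y. Stop
at the first cubes where the average ratios of the two weights to their values on J add up to more
than 4. Before stopping, orthogonality gives an L² bound. The stopping cubes fill at most half of J,
hence carry at most a fraction θ < 1 of either weight, and Hölder's inequality with exponents η, η,
δ makes the remainder a contraction for small δ. This is the weighted John–Nirenberg inequality
(`lintegral_haarSum_le`). Its bound contains a power of the Carleson mass, so tails vanish, the Haar
series converges in L^{1+δ} on each cube, and the local limits glue to one function
(`exists_memBMO_of_carleson`).

From functions to Carleson sequences (`carleson_of_memBMO`). BMO² gives a uniform L¹ oscillation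
bound in the normalization of the top cube J. A second stopping time keeps the averages of the
oscillation, of W and of U⁻¹ under control, and the energy identity `sum_hs_haarCoeff` telescopes
the coefficients down to the stopping cubes, whose total measure is at most |J|/2. -/

/-! ### The Hilbert–Schmidt norm -/

section HilbertSchmidt

variable {n : ℕ}

/-- The square of the Hilbert–Schmidt norm. -/
def hs (A : Mat n) : ℝ := ∑ i, ∑ j, ‖A i j‖ ^ 2

lemma hs_nonneg (A : Mat n) : 0 ≤ hs A :=
  Finset.sum_nonneg fun _ _ => Finset.sum_nonneg fun _ _ => sq_nonneg _

lemma hs_conjTranspose (A : Mat n) : hs Aᴴ = hs A := by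
  unfold hs
  rw [Finset.sum_comm]
  simp [Matrix.conjTranspose_apply]

lemma trace_conjTranspose_mul_self (A : Mat n) : (Aᴴ * A).trace = (hs A : ℂ) := by
  unfold hs
  rw [Finset.sum_comm]
  push_cast
  simp only [Matrix.trace, Matrix.diag, Matrix.mul_apply, Matrix.conjTranspose_apply]
  refine Finset.sum_congr rfl fun i _ => Finset.sum_congr rfl fun j _ => ?_
  rw [RCLike.star_def, ← Complex.normSq_eq_conj_mul_self, Complex.normSq_eq_norm_sq]
  push_cast; rfl

lemma sum_sq_mulVec_le (A : Mat n) (v : Fin n → ℂ) :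
    ∑ i, ‖(A *ᵥ v) i‖ ^ 2 ≤ ‖A‖ ^ 2 * ∑ i, ‖v i‖ ^ 2 := by
  have h := Matrix.l2_opNorm_mulVec A (WithLp.toLp 2 v)
  have h2 := pow_le_pow_left₀ (norm_nonneg _) h 2
  rw [mul_pow, EuclideanSpace.norm_sq_eq, EuclideanSpace.norm_sq_eq] at h2
  simpa using h2

lemma hs_mul_le (A B : Mat n) : hs (A * B) ≤ ‖A‖ ^ 2 * hs B := by
  unfold hs
  rw [Finset.sum_comm, Finset.sum_comm (f := fun i j => ‖B i j‖ ^ 2), Finset.mul_sum]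
  exact Finset.sum_le_sum fun j _ => sum_sq_mulVec_le A (fun i => B i j)

lemma hs_mul_le' (A B : Mat n) : hs (A * B) ≤ hs A * ‖B‖ ^ 2 := by
  have := hs_mul_le Bᴴ Aᴴ
  rwa [← Matrix.conjTranspose_mul, hs_conjTranspose, hs_conjTranspose,
    Matrix.l2_opNorm_conjTranspose, mul_comm] at this

lemma hs_one : hs (1 : Mat n) = n := by
  have := trace_conjTranspose_mul_self (1 : Mat n)
  simp at this
  exact_mod_cast this.symm

lemma hs_le (A : Mat n) : hs A ≤ n * ‖A‖ ^ 2 := by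
  have := hs_mul_le A 1
  rw [mul_one, hs_one] at this
  linarith

lemma sq_norm_le_hs (A : Mat n) : ‖A‖ ^ 2 ≤ hs A := by
  have h : ‖A‖ ≤ Real.sqrt (hs A) := by
    rw [Matrix.l2_opNorm_def]
    refine ContinuousLinearMap.opNorm_le_bound _ (Real.sqrt_nonneg _) fun x => ?_
    rw [EuclideanSpace.norm_eq, EuclideanSpace.norm_eq, ← Real.sqrt_mul (hs_nonneg A)]
    refine Real.sqrt_le_sqrt ?_
    unfold hs
    rw [Finset.sum_mul]
    refine Finset.sum_le_sum fun i _ => ?_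
    change ‖∑ j, A i j * x j‖ ^ 2 ≤ _
    calc ‖∑ j, A i j * x j‖ ^ 2 ≤ (∑ j, ‖A i j‖ * ‖x j‖) ^ 2 := by
          gcongr
          exact (norm_sum_le _ _).trans_eq (by simp)
      _ ≤ _ := Finset.sum_mul_sq_le_sq_mul_sq _ _ _
  calc ‖A‖ ^ 2 ≤ Real.sqrt (hs A) ^ 2 := by gcongr
    _ = hs A := Real.sq_sqrt (hs_nonneg A)

lemma norm_entry_le (A : Mat n) (i j : Fin n) : ‖A i j‖ ≤ ‖A‖ := by
  have h := sum_sq_mulVec_le A (Pi.single j 1)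
  have h1 : ∑ i, ‖(Pi.single j 1 : Fin n → ℂ) i‖ ^ 2 = 1 := by
    rw [Finset.sum_eq_single j] <;> simp +contextual
  rw [h1, mul_one] at h
  have h2 : ‖(A *ᵥ Pi.single j 1) i‖ ^ 2 ≤ ∑ i, ‖(A *ᵥ Pi.single j 1) i‖ ^ 2 :=
    Finset.single_le_sum (f := fun i => ‖(A *ᵥ Pi.single j 1) i‖ ^ 2)
      (fun i _ => sq_nonneg _) (Finset.mem_univ i)
  rw [Matrix.mulVec_single_one] at h2 h
  exact le_of_sq_le_sq (h2.trans h) (norm_nonneg _)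
where
  le_of_sq_le_sq {a b : ℝ} (h : a ^ 2 ≤ b ^ 2) (hb : 0 ≤ b) : a ≤ b := by nlinarith

lemma norm_trace_le (A : Mat n) : ‖A.trace‖ ≤ n * ‖A‖ := by
  calc ‖A.trace‖ ≤ ∑ i, ‖A i i‖ := norm_sum_le _ _
    _ ≤ ∑ _i : Fin n, ‖A‖ := Finset.sum_le_sum fun i _ => norm_entry_le A i i
    _ = n * ‖A‖ := by simp

lemma norm_det_le (A : Mat n) : ‖A.det‖ ≤ n.factorial * ‖A‖ ^ n := by
  have := Matrix.det_le (A := A) (abv := IsAbsoluteValue.toAbsoluteValue (norm : ℂ → ℝ))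
    (x := ‖A‖) (fun i j => norm_entry_le A i j)
  simpa using this

lemma norm_adjugate_le (A : Mat n) {c : ℝ} (hc : 1 ≤ c) (hA : ‖A‖ ≤ c) :
    ‖A.adjugate‖ ≤ n * (n.factorial * c ^ n) := by
  set e : ℝ := n.factorial * c ^ n
  have he : 0 ≤ e := by positivity
  have hent : ∀ i j, ‖A.adjugate i j‖ ≤ e := fun i j => by
    rw [Matrix.adjugate_apply]
    -- The updated matrix has entries of A together with 0 and 1, which is why c has to be at least
    -- 1.
    have := Matrix.det_le (A := A.updateRow j (Pi.single i 1))
      (abv := IsAbsoluteValue.toAbsoluteValue (norm : ℂ → ℝ)) (x := c) (fun k l => ?_)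
    · simpa using this
    · change ‖A.updateRow j (Pi.single i 1) k l‖ ≤ c
      rw [Matrix.updateRow_apply]
      split_ifs
      · rw [Pi.single_apply]; split_ifs <;> simp <;> linarith
      · exact (norm_entry_le A k l).trans hA
  have h1 : ‖A.adjugate‖ ^ 2 ≤ (n * e) ^ 2 := by
    refine (sq_norm_le_hs _).trans ?_
    calc hs A.adjugate ≤ ∑ _i : Fin n, ∑ _j : Fin n, e ^ 2 := by
          unfold hs
          gcongr with i _ j _
          exact hent i j
      _ = (n * e) ^ 2 := by simp; ring
  exact abs_le_of_sq_le_sq' h1 (by positivity) |>.2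

lemma hs_zero : hs (0 : Mat n) = 0 := by simp [hs]

lemma continuous_hs : Continuous (hs : Mat n → ℝ) := by
  unfold hs
  fun_prop

lemma hs_smul (c : ℂ) (A : Mat n) : hs (c • A) = ‖c‖ ^ 2 * hs A := by
  simp [hs, mul_pow, Finset.mul_sum]

lemma hs_real_smul (c : ℝ) (A : Mat n) : hs (c • A) = c ^ 2 * hs A := by
  have : c • A = (c : ℂ) • A := by ext; simp
  rw [this, hs_smul]; simp

end HilbertSchmidt

/-! ### Trace forms -/

section TraceForm

variable {n : ℕ}

/-- The real number `tr (X* V X)`, for Hermitian `V`. -/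
def trForm (V X : Mat n) : ℝ := (Xᴴ * V * X).trace.re

lemma sqrt_isHermitian (V : Mat n) : (CFC.sqrt V)ᴴ = CFC.sqrt V :=
  (Matrix.nonneg_iff_posSemidef.1 (CFC.sqrt_nonneg V)).isHermitian

lemma sqrt_mul_sqrt {V : Mat n} (hV : V.PosSemidef) : CFC.sqrt V * CFC.sqrt V = V :=
  CFC.sqrt_mul_sqrt_self V hV.nonneg

lemma sqrt_posDef {V : Mat n} (hV : V.PosDef) : (CFC.sqrt V).PosDef := by
  have h := Matrix.nonneg_iff_posSemidef.1 (CFC.sqrt_nonneg V)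
  rw [h.posDef_iff_isUnit, CFC.isUnit_sqrt_iff V hV.posSemidef.nonneg]
  exact hV.isUnit

lemma sqrt_mul_inv {V : Mat n} (hV : V.PosDef) : CFC.sqrt V * (CFC.sqrt V)⁻¹ = 1 :=
  Matrix.mul_nonsing_inv _ ((Matrix.isUnit_iff_isUnit_det _).1 (sqrt_posDef hV).isUnit)

lemma sqrt_inv_mul {V : Mat n} (hV : V.PosDef) : (CFC.sqrt V)⁻¹ * CFC.sqrt V = 1 :=
  Matrix.nonsing_inv_mul _ ((Matrix.isUnit_iff_isUnit_det _).1 (sqrt_posDef hV).isUnit)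

lemma trForm_eq_hs {V : Mat n} (hV : V.PosSemidef) (X : Mat n) :
    trForm V X = hs (CFC.sqrt V * X) := by
  have : Xᴴ * V * X = (CFC.sqrt V * X)ᴴ * (CFC.sqrt V * X) := by
    rw [Matrix.conjTranspose_mul, sqrt_isHermitian]
    calc Xᴴ * V * X = Xᴴ * (CFC.sqrt V * CFC.sqrt V) * X := by rw [sqrt_mul_sqrt hV]
      _ = _ := by simp only [Matrix.mul_assoc]
  rw [trForm, this, trace_conjTranspose_mul_self, Complex.ofReal_re]

lemma trForm_nonneg {V : Mat n} (hV : V.PosSemidef) (X : Mat n) : 0 ≤ trForm V X := by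
  rw [trForm_eq_hs hV]; exact hs_nonneg _

lemma sq_norm_sqrt_mul_le {V : Mat n} (hV : V.PosSemidef) (X : Mat n) :
    ‖CFC.sqrt V * X‖ ^ 2 ≤ trForm V X := by
  rw [trForm_eq_hs hV]; exact sq_norm_le_hs _

lemma trForm_inv_eq_hs {V : Mat n} (hV : V.PosDef) (X : Mat n) :
    trForm V⁻¹ X = hs ((CFC.sqrt V)⁻¹ * X) := by
  rw [trForm_eq_hs hV.inv.posSemidef, hV.posSemidef.inv_sqrt]

lemma trForm_le {V : Mat n} (hV : V.PosSemidef) (X Y : Mat n) :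
    trForm V (X * Y) ≤ trForm V X * ‖Y‖ ^ 2 := by
  rw [trForm_eq_hs hV, trForm_eq_hs hV, ← Matrix.mul_assoc]
  exact hs_mul_le' _ _

/-- Convexity of the inverse: `2 Re tr (F* X) ≤ tr (F* V F) + tr (X* V⁻¹ X)`. -/
lemma two_re_trace_le {V : Mat n} (hV : V.PosDef) (F X : Mat n) :
    2 * (Fᴴ * X).trace.re ≤ trForm V F + trForm V⁻¹ X := by
  set R := CFC.sqrt V
  have hR : Rᴴ = R := sqrt_isHermitian V
  have h1 : R * R⁻¹ = 1 := sqrt_mul_inv hV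
  have hRi : (R⁻¹)ᴴ = R⁻¹ := by rw [Matrix.conjTranspose_nonsing_inv, hR]
  -- The claim is the expansion of hs (R F − R⁻¹ X) ≥ 0: both cross terms have real part Re tr(F*
  -- X).
  have h2 : (((R * F - R⁻¹ * X)ᴴ * (R * F - R⁻¹ * X)).trace).re = hs (R * F - R⁻¹ * X) := by
    rw [trace_conjTranspose_mul_self, Complex.ofReal_re]
  have h3 : ((R * F)ᴴ * (R * F)).trace.re = trForm V F := by
    rw [trace_conjTranspose_mul_self, Complex.ofReal_re, trForm_eq_hs hV.posSemidef]
  have h4 : ((R⁻¹ * X)ᴴ * (R⁻¹ * X)).trace.re = trForm V⁻¹ X := by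
    rw [trace_conjTranspose_mul_self, Complex.ofReal_re, trForm_inv_eq_hs hV]
  have h5 : (R * F)ᴴ * (R⁻¹ * X) = Fᴴ * X := by
    rw [Matrix.conjTranspose_mul, hR]
    calc Fᴴ * R * (R⁻¹ * X) = Fᴴ * (R * R⁻¹) * X := by simp only [Matrix.mul_assoc]
      _ = _ := by rw [h1, Matrix.mul_one]
  have h6 : ((R⁻¹ * X)ᴴ * (R * F)).trace.re = (Fᴴ * X).trace.re := by
    rw [← h5, ← Matrix.conjTranspose_conjTranspose (R * F), ← Matrix.conjTranspose_mul,
      Matrix.trace_conjTranspose, Matrix.conjTranspose_conjTranspose]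
    simp
  have := hs_nonneg (R * F - R⁻¹ * X)
  rw [← h2, Matrix.conjTranspose_sub, Matrix.sub_mul, Matrix.mul_sub, Matrix.mul_sub] at this
  simp only [Matrix.trace_sub, Complex.sub_re] at this
  rw [h3, h4, h5, h6] at this
  linarith

lemma trForm_smul_left (c : ℝ) (V X : Mat n) : trForm (c • V) X = c * trForm V X := by
  simp [trForm]

lemma trForm_add_left (V V' X : Mat n) : trForm (V + V') X = trForm V X + trForm V' X := by
  simp [trForm, Matrix.mul_add, Matrix.add_mul]

/-- `V ↦ tr (X* V X)` as a continuous real linear functional. -/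
def trFormCLM (X : Mat n) : Mat n →L[ℝ] ℝ :=
  LinearMap.toContinuousLinearMap
    { toFun := fun V => trForm V X
      map_add' := fun V V' => trForm_add_left V V' X
      map_smul' := fun c V => trForm_smul_left c V X }

@[simp] lemma trFormCLM_apply (X V : Mat n) : trFormCLM X V = trForm V X := rfl

/-- The inverse of a matrix of norm at most `c`, in terms of its determinant. -/
lemma norm_inv_le (P : Mat n) {c : ℝ} (hc : 1 ≤ c) (hP : ‖P‖ ≤ c) :
    ‖P⁻¹‖ ≤ ‖P.det‖⁻¹ * (n * (n.factorial * c ^ n)) := by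
  rw [Matrix.inv_def, norm_smul, Ring.inverse_eq_inv', norm_inv]
  gcongr
  exact norm_adjugate_le P hc hP

end TraceForm

/-! ### Averages over cubes -/

section Averages

variable {d n : ℕ}

lemma volume_pts (I : Cube d) : volume I.pts = ENNReal.ofReal I.side ^ d := by
  have : I.pts = Set.pi Set.univ (fun i => Set.Ico (I.corner i) (I.corner i + I.side)) := by
    ext x; simp [Cube.pts]
  rw [this, volume_pi_pi]
  simp

lemma volume_pts_ne_zero (I : Cube d) : volume I.pts ≠ 0 := by
  rw [volume_pts]
  exact pow_ne_zero _ (by simpa using I.side_pos)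

lemma volume_pts_ne_top (I : Cube d) : volume I.pts ≠ ∞ := by
  rw [volume_pts]; exact ENNReal.pow_ne_top ENNReal.ofReal_ne_top

lemma volumeReal_pts_pos (I : Cube d) : 0 < volume.real I.pts :=
  ENNReal.toReal_pos (volume_pts_ne_zero I) (volume_pts_ne_top I)

lemma ofReal_volumeReal_pts (I : Cube d) : ENNReal.ofReal (volume.real I.pts) = volume I.pts :=
  ENNReal.ofReal_toReal (volume_pts_ne_top I)

lemma avg_eq (I : Cube d) (F : Pt d → Mat n) :
    avg I F = (volume.real I.pts)⁻¹ • ∫ x in I.pts, F x := by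
  rw [avg, setAverage_eq]

lemma volumeReal_smul_avg (I : Cube d) (F : Pt d → Mat n) :
    volume.real I.pts • avg I F = ∫ x in I.pts, F x := by
  rw [avg_eq, smul_smul, mul_inv_cancel₀ (volumeReal_pts_pos I).ne', one_smul]

/-- Cauchy–Schwarz. -/
lemma sq_lintegral_le {α : Type*} [MeasurableSpace α] (μ : Measure α) {f : α → ℝ≥0∞}
    (hf : AEMeasurable f μ) : (∫⁻ x, f x ∂μ) ^ 2 ≤ μ Set.univ * ∫⁻ x, f x ^ 2 ∂μ := by
  have h := ENNReal.lintegral_mul_le_Lp_mul_Lq μ (p := 2) (q := 2)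
    (Real.holderConjugate_iff.2 ⟨by norm_num, by norm_num⟩) (f := fun _ => 1) (g := f)
    aemeasurable_const hf
  simp only [Pi.mul_apply, one_mul, one_pow, lintegral_const, ENNReal.rpow_two] at h
  calc (∫⁻ x, f x ∂μ) ^ 2
      ≤ (μ Set.univ ^ (1 / 2 : ℝ) * (∫⁻ x, f x ^ 2 ∂μ) ^ (1 / 2 : ℝ)) ^ 2 := by gcongr
    _ = _ := by
      rw [mul_pow, ← ENNReal.rpow_natCast, ← ENNReal.rpow_mul, ← ENNReal.rpow_natCast,
        ← ENNReal.rpow_mul]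
      norm_num

lemma volume_mul_enorm_avg_le (I : Cube d) (F : Pt d → Mat n) :
    volume I.pts * ‖avg I F‖ₑ ≤ ∫⁻ x in I.pts, ‖F x‖ₑ := by
  have h : volume I.pts * ‖avg I F‖ₑ = ‖∫ x in I.pts, F x‖ₑ := by
    rw [← volumeReal_smul_avg, enorm_smul, Real.enorm_of_nonneg (volumeReal_pts_pos I).le,
      ofReal_volumeReal_pts]
  rw [h]
  exact enorm_integral_le_lintegral_enorm _

lemma volume_mul_sq_enorm_avg_le (I : Cube d) {F : Pt d → Mat n}
    (hF : AEStronglyMeasurable F (volume.restrict I.pts)) :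
    volume I.pts * ‖avg I F‖ₑ ^ 2 ≤ ∫⁻ x in I.pts, ‖F x‖ₑ ^ 2 := by
  have h := (pow_le_pow_left' (volume_mul_enorm_avg_le I F) 2).trans
    (sq_lintegral_le _ hF.enorm)
  rw [Measure.restrict_apply_univ, mul_pow, sq (volume I.pts), mul_assoc] at h
  exact (ENNReal.mul_le_mul_iff_right (volume_pts_ne_zero I) (volume_pts_ne_top I)).1 h

lemma avg_mul_right (I : Cube d) (A : Mat n) {F : Pt d → Mat n} (hF : IntegrableOn F I.pts) :
    avg I (fun x => F x * A) = avg I F * A := by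
  rw [avg_eq, avg_eq, Matrix.smul_mul]
  congr 1
  exact ContinuousLinearMap.integral_comp_comm ((LinearMap.mulRight ℝ A).toContinuousLinearMap) hF

lemma volume_mul_trForm_avg (I : Cube d) {V : Pt d → Mat n} (hV : IntegrableOn V I.pts)
    (X : Mat n) : volume.real I.pts * trForm (avg I V) X = ∫ x in I.pts, trForm (V x) X := by
  rw [← trForm_smul_left, volumeReal_smul_avg]
  exact (ContinuousLinearMap.integral_comp_comm (trFormCLM X) hV).symm

lemma integrableOn_trForm (I : Cube d) {V : Pt d → Mat n} (hV : IntegrableOn V I.pts)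
    (X : Mat n) : IntegrableOn (fun x => trForm (V x) X) I.pts :=
  (trFormCLM X).integrable_comp hV

lemma lintegral_trForm (I : Cube d) {V : Pt d → Mat n} (hV : IntegrableOn V I.pts)
    (hp : ∀ᵐ x, (V x).PosSemidef) (X : Mat n) :
    ∫⁻ x in I.pts, ENNReal.ofReal (trForm (V x) X) =
      volume I.pts * ENNReal.ofReal (trForm (avg I V) X) := by
  rw [← ofReal_integral_eq_lintegral_ofReal (integrableOn_trForm I hV X)
    ((ae_restrict_of_ae hp).mono fun x hx => trForm_nonneg hx X), ← volume_mul_trForm_avg I hV,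
    ENNReal.ofReal_mul (volumeReal_pts_pos I).le, ofReal_volumeReal_pts]

lemma avg_isHermitian (I : Cube d) {V : Pt d → Mat n} (hV : IntegrableOn V I.pts)
    (hp : ∀ᵐ x, (V x).IsHermitian) : (avg I V).IsHermitian := by
  let L : Mat n →L[ℝ] Mat n := LinearMap.toContinuousLinearMap
    { toFun := fun A => Aᴴ
      map_add' := fun A B => Matrix.conjTranspose_add A B
      map_smul' := fun c A => by simp }
  have h : L (∫ x in I.pts, V x) = ∫ x in I.pts, V x := by
    rw [← L.integral_comp_comm hV]
    exact integral_congr_ae ((ae_restrict_of_ae hp).mono fun x hx => hx)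
  rw [Matrix.IsHermitian, avg_eq, Matrix.conjTranspose_smul]
  rw [show (∫ x in I.pts, V x)ᴴ = ∫ x in I.pts, V x from h]
  simp

/-- Tested on a fixed vector, this says that an a.e. positive function has positive integral over a
set of positive measure; the imaginary part vanishes by hermiticity. -/
lemma avg_posDef (I : Cube d) {V : Pt d → Mat n} (hV : IntegrableOn V I.pts)
    (hp : ∀ᵐ x, (V x).PosDef) : (avg I V).PosDef := by
  have hH := avg_isHermitian I hV (hp.mono fun x hx => hx.isHermitian)
  refine Matrix.PosDef.of_dotProduct_mulVec_pos hH fun v hv => ?_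
  let L : Mat n →L[ℝ] ℂ := LinearMap.toContinuousLinearMap
    { toFun := fun A => star v ⬝ᵥ (A *ᵥ v)
      map_add' := fun A B => by simp [Matrix.add_mulVec]
      map_smul' := fun c A => by simp [Matrix.smul_mulVec] }
  have h1 : volume.real I.pts • L (avg I V) = ∫ x in I.pts, L (V x) := by
    rw [← map_smul, volumeReal_smul_avg, L.integral_comp_comm hV]
  have hLi : IntegrableOn (fun x => L (V x)) I.pts := L.integrable_comp hV
  have h2 : 0 < ∫ x in I.pts, (L (V x)).re := by
    have hpos : ∀ᵐ x ∂volume.restrict I.pts, 0 < (L (V x)).re :=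
      (ae_restrict_of_ae hp).mono fun x hx => by
        have := hx.dotProduct_mulVec_pos hv
        exact (Complex.pos_iff.1 this).1
    rw [integral_pos_iff_support_of_nonneg_ae (hpos.mono fun x hx => hx.le) hLi.re]
    have : (volume.restrict I.pts) (Function.support fun x => (L (V x)).re) =
        (volume.restrict I.pts) Set.univ :=
      measure_congr (by
        filter_upwards [hpos] with x hx
        exact propext ⟨fun _ => trivial, fun _ => hx.ne'⟩)
    rw [this, Measure.restrict_apply_univ]
    exact (volume_pts_ne_zero I).bot_lt
  have h3 : (L (avg I V)).im = 0 := by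
    have := Matrix.IsHermitian.im_star_dotProduct_mulVec_self hH v
    exact this
  have h4 : 0 < (L (avg I V)).re := by
    have h5 : volume.real I.pts * (L (avg I V)).re = ∫ x in I.pts, (L (V x)).re := by
      have h6 := congrArg Complex.re h1
      rw [Complex.smul_re, smul_eq_mul] at h6
      rw [h6]
      exact (integral_re hLi).symm
    rw [← h5] at h2
    exact pos_of_mul_pos_right h2 (volumeReal_pts_pos I).le
  exact Complex.pos_iff.2 ⟨h4, h3.symm⟩

/-- The matrix Jensen inequality for the inverse, tested on trace forms. -/
lemma volume_mul_trForm_inv_avg_le (I : Cube d) {V : Pt d → Mat n} (hV : IntegrableOn V I.pts)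
    (hp : ∀ᵐ x, (V x).PosDef) (hVi : IntegrableOn (fun x => (V x)⁻¹) I.pts) (X : Mat n) :
    trForm (avg I V)⁻¹ X ≤ trForm (avg I fun x => (V x)⁻¹) X := by
  have hM := avg_posDef I hV hp
  set M := avg I V
  -- This F maximizes 2 Re tr(F* X) − tr(F* M F), with maximum tr(X* M⁻¹ X).
  set F := M⁻¹ * X
  have h1 : ∫ _x in I.pts, 2 * (Fᴴ * X).trace.re ≤
      ∫ x in I.pts, (trForm (V x) F + trForm (V x)⁻¹ X) := by
    refine integral_mono_ae ?_ ((integrableOn_trForm I hV F).add (integrableOn_trForm I hVi X)) ?_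
    · exact integrableOn_const (volume_pts_ne_top I)
    · exact (ae_restrict_of_ae hp).mono fun x hx => two_re_trace_le hx F X
  rw [integral_add (integrableOn_trForm I hV F) (integrableOn_trForm I hVi X),
    ← volume_mul_trForm_avg I hV, ← volume_mul_trForm_avg I hVi, setIntegral_const, smul_eq_mul,
    ← mul_add] at h1
  have h2 := le_of_mul_le_mul_left h1 (volumeReal_pts_pos I)
  have hu : M * M⁻¹ = 1 :=
    Matrix.mul_nonsing_inv _ ((Matrix.isUnit_iff_isUnit_det _).1 hM.isUnit)
  have h3 : (Fᴴ * X).trace.re = trForm M⁻¹ X := by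
    rw [trForm]
    simp only [F, Matrix.conjTranspose_mul, Matrix.conjTranspose_nonsing_inv]
    rw [hM.isHermitian.eq]
  have h4 : trForm M F = trForm M⁻¹ X := by
    rw [trForm, trForm]
    simp only [F, Matrix.conjTranspose_mul, Matrix.conjTranspose_nonsing_inv]
    rw [hM.isHermitian.eq]
    congr 2
    calc Xᴴ * M⁻¹ * M * (M⁻¹ * X) = Xᴴ * M⁻¹ * (M * M⁻¹) * X := by
          simp only [Matrix.mul_assoc]
      _ = _ := by rw [hu, Matrix.mul_one]
  rw [h3, h4] at h2
  linarith

/-- Both sides are Re tr(A B). The symmetry lets either factor play the role of the averaged weight.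
-/
lemma trForm_sqrt_comm {A B : Mat n} (hA : A.PosSemidef) (hB : B.PosSemidef) :
    trForm A (CFC.sqrt B) = trForm B (CFC.sqrt A) := by
  rw [trForm, trForm, sqrt_isHermitian, sqrt_isHermitian, Matrix.mul_assoc, Matrix.trace_mul_comm,
    Matrix.mul_assoc, sqrt_mul_sqrt hB, Matrix.mul_assoc, Matrix.trace_mul_comm (CFC.sqrt A),
    Matrix.mul_assoc, sqrt_mul_sqrt hA, Matrix.trace_mul_comm]

/-- The square root is continuous on nonnegative matrices only. Composing it with `CFC.abs` gives a
globally continuous map that agrees with it almost everywhere along V. -/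
lemma _root_.MeasureTheory.AEStronglyMeasurable.matrix_sqrt {α : Type*} [MeasurableSpace α]
    {μ : Measure α} {V : α → Mat n} (hV : AEStronglyMeasurable V μ)
    (hp : ∀ᵐ x ∂μ, (V x).PosSemidef) : AEStronglyMeasurable (fun x => CFC.sqrt (V x)) μ := by
  have hc : Continuous fun A : Mat n => CFC.sqrt (CFC.abs A) :=
    CFC.continuousOn_sqrt.comp_continuous CFC.continuous_abs fun A => CFC.abs_nonneg A
  refine (hc.comp_aestronglyMeasurable hV).congr ?_
  filter_upwards [hp] with x hx
  simp only [CFC.abs_of_nonneg (V x) hx.nonneg]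

lemma norm_le_trForm_one {V : Mat n} (hV : V.PosSemidef) : ‖V‖ ≤ trForm V 1 := by
  have h : ‖V‖ = ‖CFC.sqrt V‖ ^ 2 := by
    rw [sq, ← Matrix.l2_opNorm_conjTranspose_mul_self, sqrt_isHermitian, sqrt_mul_sqrt hV]
  rw [h]
  simpa using sq_norm_sqrt_mul_le hV 1

end Averages

/-! ### Scalar weights derived from a matrix `A₂` weight -/

section A2

variable {d n : ℕ}

lemma lintegral_a2_le (W : A2Weight d n) (I : Cube d) :
    ∫⁻ x in I.pts, ∫⁻ t in I.pts, ‖CFC.sqrt (W.fn x) * (CFC.sqrt (W.fn t))⁻¹‖ₑ ^ 2 ≤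
      a2Char W.fn * volume I.pts ^ 2 := by
  have h := le_iSup (fun I : Cube d => (volume I.pts)⁻¹ * ∫⁻ x in I.pts,
    (volume I.pts)⁻¹ * ∫⁻ t in I.pts, ‖CFC.sqrt (W.fn x) * (CFC.sqrt (W.fn t))⁻¹‖ₑ ^ 2) I
  have h0 := volume_pts_ne_zero I
  have h1 := volume_pts_ne_top I
  rw [lintegral_const_mul' _ _ (ENNReal.inv_ne_top.2 h0), ← mul_assoc, ← sq, ← ENNReal.inv_pow,
    mul_comm, ← div_eq_mul_inv,
    ENNReal.div_le_iff (pow_ne_zero _ h0) (ENNReal.pow_ne_top h1)] at h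
  exact h

/-- Since √V X = (√V √V'⁻¹)(√V' X), the integrand of the matrix A₂ condition dominates the ratio of
the two scalar weights simultaneously for all X. -/
lemma sqrt_ratio_bound {V V' : Mat n} (hV : V.PosDef) (hV' : V'.PosDef) (X : Mat n) :
    ENNReal.ofReal (trForm V X) * (ENNReal.ofReal (trForm V' X))⁻¹ ≤
      ‖CFC.sqrt V * (CFC.sqrt V')⁻¹‖ₑ ^ 2 := by
  rw [← div_eq_mul_inv]
  refine ENNReal.div_le_of_le_mul ?_
  rw [trForm_eq_hs hV.posSemidef, trForm_eq_hs hV'.posSemidef]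
  have : CFC.sqrt V * X = CFC.sqrt V * (CFC.sqrt V')⁻¹ * (CFC.sqrt V' * X) := by
    rw [Matrix.mul_assoc, ← Matrix.mul_assoc (CFC.sqrt V')⁻¹, sqrt_inv_mul hV', Matrix.one_mul]
  rw [this, ← ofReal_norm, ← ENNReal.ofReal_pow (norm_nonneg _),
    ← ENNReal.ofReal_mul (by positivity)]
  exact ENNReal.ofReal_le_ofReal (hs_mul_le _ _)

/-- Taking adjoints exchanges the two points and replaces W by W⁻¹, so W⁻¹ satisfies the A₂
condition with the same constant. -/
lemma enorm_sqrt_mul_inv_symm (V V' : Mat n) (hV : V.PosDef) (hV' : V'.PosDef) :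
    ‖CFC.sqrt V'⁻¹ * (CFC.sqrt V⁻¹)⁻¹‖ₑ = ‖CFC.sqrt V * (CFC.sqrt V')⁻¹‖ₑ := by
  rw [← hV'.posSemidef.inv_sqrt, ← hV.posSemidef.inv_sqrt, Matrix.nonsing_inv_nonsing_inv]
  · rw [← ofReal_norm, ← ofReal_norm, ← Matrix.l2_opNorm_conjTranspose,
      Matrix.conjTranspose_mul, Matrix.conjTranspose_nonsing_inv, sqrt_isHermitian,
      sqrt_isHermitian]
  · exact (Matrix.isUnit_iff_isUnit_det _).1 (sqrt_posDef hV).isUnit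

lemma aemeasurable_trForm {α : Type*} [MeasurableSpace α] {μ : Measure α} {V : α → Mat n}
    (hV : AEStronglyMeasurable V μ) (X : Mat n) :
    AEMeasurable (fun x => ENNReal.ofReal (trForm (V x) X)) μ :=
  ((trFormCLM X).continuous.comp_aestronglyMeasurable hV).aemeasurable.ennreal_ofReal

/-- Every scalar weight tr(X* W X) is A₂ with constant at most [W], independently of X:
`sqrt_ratio_bound` is integrated in both variables. -/
lemma W_scalar_a2 (W : A2Weight d n) (I : Cube d) (X : Mat n) :
    (∫⁻ x in I.pts, ENNReal.ofReal (trForm (W.fn x) X)) *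
      (∫⁻ x in I.pts, (ENNReal.ofReal (trForm (W.fn x) X))⁻¹) ≤
        a2Char W.fn * volume I.pts ^ 2 := by
  refine le_trans ?_ (lintegral_a2_le W I)
  have hm := aemeasurable_trForm (W.aestronglyMeasurable.restrict (s := I.pts)) X
  rw [← lintegral_mul_const'' _ hm]
  refine lintegral_mono_ae ((ae_restrict_of_ae W.posDef).mono fun x hx => ?_)
  have hmi : AEMeasurable (fun x => (ENNReal.ofReal (trForm (W.fn x) X))⁻¹)
    (volume.restrict I.pts) := hm.inv
  rw [← lintegral_const_mul'' _ hmi]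
  exact lintegral_mono_ae ((ae_restrict_of_ae W.posDef).mono fun t ht => sqrt_ratio_bound hx ht X)

lemma W_inv_scalar_a2 (W : A2Weight d n) (I : Cube d) (X : Mat n) :
    (∫⁻ x in I.pts, ENNReal.ofReal (trForm (W.fn x)⁻¹ X)) *
      (∫⁻ x in I.pts, (ENNReal.ofReal (trForm (W.fn x)⁻¹ X))⁻¹) ≤
        a2Char W.fn * volume I.pts ^ 2 := by
  refine le_trans ?_ (lintegral_a2_le W I)
  have hm := aemeasurable_trForm (W.aestronglyMeasurable_inv.restrict (s := I.pts)) X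
  have hmi : AEMeasurable (fun x => (ENNReal.ofReal (trForm (W.fn x)⁻¹ X))⁻¹)
    (volume.restrict I.pts) := hm.inv
  rw [mul_comm, ← lintegral_mul_const'' _ hmi]
  refine lintegral_mono_ae ((ae_restrict_of_ae W.posDef).mono fun x hx => ?_)
  rw [← lintegral_const_mul'' _ hm]
  refine lintegral_mono_ae ((ae_restrict_of_ae W.posDef).mono fun t ht => ?_)
  rw [mul_comm, ← enorm_sqrt_mul_inv_symm _ _ hx ht]
  exact sqrt_ratio_bound ht.inv hx.inv X

/-- As w is finite a.e., its reciprocal has nonzero integral, so the bound on the product forces ∫ w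
to be finite. This yields the local integrability of W and W⁻¹, which is not part of the definition
of a weight. -/
lemma lintegral_lt_top_of_mul_inv {α : Type*} [MeasurableSpace α] {μ : Measure α} (hμ : μ ≠ 0)
    {w : α → ℝ≥0∞} (hw : AEMeasurable w μ) (hfin : ∀ᵐ x ∂μ, w x ≠ ∞) {K : ℝ≥0∞} (hK : K ≠ ∞)
    (h : (∫⁻ x, w x ∂μ) * (∫⁻ x, (w x)⁻¹ ∂μ) ≤ K) : ∫⁻ x, w x ∂μ < ∞ := by
  have h0 : ∫⁻ x, (w x)⁻¹ ∂μ ≠ 0 := by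
    have hwi : AEMeasurable (fun x => (w x)⁻¹) μ := hw.inv
    rw [Ne, lintegral_eq_zero_iff' hwi]
    intro hz
    have : ∀ᵐ _x ∂μ, False := by
      filter_upwards [hz, hfin] with x hx hx'
      exact hx' (ENNReal.inv_eq_zero.1 hx)
    rw [Filter.eventually_false_iff_eq_bot, ae_eq_bot] at this
    exact hμ this
  by_contra hc
  rw [not_lt, top_le_iff] at hc
  rw [hc, ENNReal.top_mul h0, top_le_iff] at h
  exact hK h

lemma restrict_pts_ne_zero (I : Cube d) : volume.restrict I.pts ≠ 0 := by
  rw [Ne, Measure.restrict_eq_zero]; exact volume_pts_ne_zero I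

lemma integrableOn_of_trForm {V : Pt d → Mat n} {I : Cube d}
    (hm : AEStronglyMeasurable V (volume.restrict I.pts)) (hp : ∀ᵐ x, (V x).PosSemidef)
    (h : ∫⁻ x in I.pts, ENNReal.ofReal (trForm (V x) 1) < ∞) : IntegrableOn V I.pts := by
  refine ⟨hm, lt_of_le_of_lt (lintegral_mono_ae ?_) h⟩
  filter_upwards [ae_restrict_of_ae hp] with x hx
  rw [← ofReal_norm]
  exact ENNReal.ofReal_le_ofReal (norm_le_trForm_one hx)

lemma A2Weight.posSemidef (W : A2Weight d n) : ∀ᵐ x, (W.fn x).PosSemidef :=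
  W.posDef.mono fun _ h => h.posSemidef

lemma A2Weight.inv_posDef (W : A2Weight d n) : ∀ᵐ x, ((W.fn x)⁻¹).PosDef :=
  W.posDef.mono fun _ h => h.inv

lemma A2Weight.inv_posSemidef (W : A2Weight d n) : ∀ᵐ x, ((W.fn x)⁻¹).PosSemidef :=
  W.posDef.mono fun _ h => h.inv.posSemidef

lemma a2Char_mul_ne_top (W : A2Weight d n) (I : Cube d) :
    a2Char W.fn * volume I.pts ^ 2 ≠ ∞ :=
  ENNReal.mul_ne_top W.a2Char_lt_top.ne (ENNReal.pow_ne_top (volume_pts_ne_top I))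

lemma A2Weight.integrableOn (W : A2Weight d n) (I : Cube d) : IntegrableOn W.fn I.pts := by
  refine integrableOn_of_trForm W.aestronglyMeasurable.restrict W.posSemidef ?_
  exact lintegral_lt_top_of_mul_inv (restrict_pts_ne_zero I)
    (aemeasurable_trForm W.aestronglyMeasurable.restrict 1)
    (Filter.Eventually.of_forall fun _ => ENNReal.ofReal_ne_top) (a2Char_mul_ne_top W I)
    (W_scalar_a2 W I 1)

lemma A2Weight.integrableOn_inv (W : A2Weight d n) (I : Cube d) :
    IntegrableOn (fun x => (W.fn x)⁻¹) I.pts := by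
  refine integrableOn_of_trForm W.aestronglyMeasurable_inv.restrict W.inv_posSemidef ?_
  exact lintegral_lt_top_of_mul_inv (restrict_pts_ne_zero I)
    (aemeasurable_trForm W.aestronglyMeasurable_inv.restrict 1)
    (Filter.Eventually.of_forall fun _ => ENNReal.ofReal_ne_top) (a2Char_mul_ne_top W I)
    (W_inv_scalar_a2 W I 1)

lemma integrableOn_sqrt {V : Pt d → Mat n} {I : Cube d} (hV : IntegrableOn V I.pts)
    (hp : ∀ᵐ x, (V x).PosSemidef) : IntegrableOn (fun x => CFC.sqrt (V x)) I.pts := by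
  have hp' := ae_restrict_of_ae (s := I.pts) hp
  have : IsFiniteMeasure (volume.restrict I.pts) :=
    ⟨by rw [Measure.restrict_apply_univ]; exact (volume_pts_ne_top I).lt_top⟩
  refine Integrable.mono' (g := fun x => 1 + ‖V x‖) ((integrable_const 1).add hV.norm)
    (hV.1.matrix_sqrt hp') (hp'.mono fun x hx => ?_)
  have h : ‖V x‖ = ‖CFC.sqrt (V x)‖ ^ 2 := by
    rw [sq, ← Matrix.l2_opNorm_conjTranspose_mul_self, sqrt_isHermitian, sqrt_mul_sqrt hx]
  rw [h]
  nlinarith [sq_nonneg (‖CFC.sqrt (V x)‖ - 1), norm_nonneg (CFC.sqrt (V x))]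

lemma A2Weight.integrableOn_sqrt (W : A2Weight d n) (I : Cube d) :
    IntegrableOn (fun x => CFC.sqrt (W.fn x)) I.pts :=
  MatrixHardy.integrableOn_sqrt (W.integrableOn I) W.posSemidef

lemma A2Weight.avg_posDef (W : A2Weight d n) (I : Cube d) : (avg I W.fn).PosDef :=
  MatrixHardy.avg_posDef I (W.integrableOn I) W.posDef

lemma A2Weight.avg_inv_posDef (W : A2Weight d n) (I : Cube d) :
    (avg I fun x => (W.fn x)⁻¹).PosDef :=
  MatrixHardy.avg_posDef I (W.integrableOn_inv I) W.inv_posDef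

lemma A2Weight.avg_sqrt_posDef (W : A2Weight d n) (I : Cube d) :
    (avg I fun x => CFC.sqrt (W.fn x)).PosDef :=
  MatrixHardy.avg_posDef I (W.integrableOn_sqrt I) (W.posDef.mono fun _ h => sqrt_posDef h)

/-- `tr (m_I W · m_I W⁻¹) ≤ n [W]_{A₂}`. -/
lemma trForm_avg_inv_sqrt_le (W : A2Weight d n) (I : Cube d) :
    ENNReal.ofReal (trForm (avg I fun x => (W.fn x)⁻¹) (CFC.sqrt (avg I W.fn))) ≤
      n * a2Char W.fn := by
  set M' := avg I fun x => (W.fn x)⁻¹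
  have hM' : M'.PosDef := W.avg_inv_posDef I
  rw [trForm_sqrt_comm hM'.posSemidef (W.avg_posDef I).posSemidef]
  have h1 : volume I.pts * ENNReal.ofReal (trForm (avg I W.fn) (CFC.sqrt M')) =
      ∫⁻ x in I.pts, ENNReal.ofReal (trForm (W.fn x) (CFC.sqrt M')) :=
    (lintegral_trForm I (W.integrableOn I) W.posSemidef _).symm
  -- Multiplied by |I|², the left side is the double integral of tr(W(x) W(t)⁻¹), the squared
  -- Hilbert–Schmidt norm of √W(x) √W(t)⁻¹. That is at most n times the squared operator norm.
  have h2 : volume I.pts * (volume I.pts * ENNReal.ofReal (trForm (avg I W.fn) (CFC.sqrt M'))) ≤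
      volume I.pts * (volume I.pts * (n * a2Char W.fn)) := by
    calc _ = ∫⁻ x in I.pts, volume I.pts * ENNReal.ofReal (trForm (W.fn x) (CFC.sqrt M')) := by
          rw [h1, lintegral_const_mul' _ _ (volume_pts_ne_top I)]
      _ ≤ ∫⁻ x in I.pts, n * ∫⁻ t in I.pts,
            ‖CFC.sqrt (W.fn x) * (CFC.sqrt (W.fn t))⁻¹‖ₑ ^ 2 := by
          refine lintegral_mono_ae ((ae_restrict_of_ae W.posDef).mono fun x hx => ?_)
          rw [trForm_sqrt_comm hx.posSemidef hM'.posSemidef,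
            ← lintegral_trForm I (W.integrableOn_inv I) W.inv_posSemidef,
            ← lintegral_const_mul' _ _ (ENNReal.natCast_ne_top n)]
          refine lintegral_mono_ae ((ae_restrict_of_ae W.posDef).mono fun t ht => ?_)
          rw [trForm_inv_eq_hs ht, ← hs_conjTranspose, Matrix.conjTranspose_mul,
            Matrix.conjTranspose_nonsing_inv, sqrt_isHermitian, sqrt_isHermitian,
            ← ofReal_norm, ← ENNReal.ofReal_pow (norm_nonneg _), ← ENNReal.ofReal_natCast,
            ← ENNReal.ofReal_mul (by positivity)]
          exact ENNReal.ofReal_le_ofReal (hs_le _)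
      _ ≤ n * (a2Char W.fn * volume I.pts ^ 2) := by
          rw [lintegral_const_mul' _ _ (ENNReal.natCast_ne_top n)]
          gcongr
          exact lintegral_a2_le W I
      _ = _ := by ring
  have := volume_pts_ne_zero I
  have := volume_pts_ne_top I
  rwa [ENNReal.mul_le_mul_iff_right ‹_› ‹_›, ENNReal.mul_le_mul_iff_right ‹_› ‹_›] at h2

lemma trForm_inv_sqrt {M : Mat n} (hM : M.PosDef) : trForm M⁻¹ (CFC.sqrt M) = n := by
  rw [trForm_inv_eq_hs hM, sqrt_inv_mul hM, hs_one]

lemma trForm_sqrt_inv {M : Mat n} (hM : M.PosDef) : trForm M (CFC.sqrt M)⁻¹ = n := by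
  rw [trForm_eq_hs hM.posSemidef, sqrt_mul_inv hM, hs_one]

/-- The inverse Jensen inequality for an `A₂` weight. -/
lemma A2Weight.trForm_inv_avg_le (W : A2Weight d n) (I : Cube d) (X : Mat n) :
    trForm (avg I W.fn)⁻¹ X ≤ trForm (avg I fun x => (W.fn x)⁻¹) X :=
  volume_mul_trForm_inv_avg_le I (W.integrableOn I) W.posDef (W.integrableOn_inv I) X

/-- With M = m_I W, one has n = tr(M⁻¹ M) ≤ tr(m_I W⁻¹ · M) ≤ n [W] by Jensen's inequality. Any cube
I would serve; dividing by n requires n ≠ 0. -/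
lemma one_le_a2Char [NeZero n] (W : A2Weight d n) : 1 ≤ a2Char W.fn := by
  let I : Cube d := ⟨0, 1, one_pos⟩
  have h := (W.trForm_inv_avg_le I (CFC.sqrt (avg I W.fn)))
  rw [trForm_inv_sqrt (W.avg_posDef I)] at h
  have h2 := (ENNReal.ofReal_le_ofReal h).trans (trForm_avg_inv_sqrt_le W I)
  rw [ENNReal.ofReal_natCast] at h2
  have h3 : (n : ℝ≥0∞) * 1 ≤ n * a2Char W.fn := by simpa using h2
  exact (ENNReal.mul_le_mul_iff_right (by simp [NeZero.ne n]) (ENNReal.natCast_ne_top n)).1 h3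

end A2

/-! ### Comparison of reducing matrices -/

section Reducing

variable {d n : ℕ}

/-- Cauchy–Schwarz moves the square inside the average, and the squared operator norm is then
bounded by a trace, which is linear in V. -/
lemma sq_norm_avg_sqrt_mul_le (I : Cube d) {V : Pt d → Mat n} (hV : IntegrableOn V I.pts)
    (hp : ∀ᵐ x, (V x).PosDef) (X : Mat n) :
    ‖avg I (fun x => CFC.sqrt (V x)) * X‖ ^ 2 ≤ trForm (avg I V) X := by
  have hps : ∀ᵐ x, (V x).PosSemidef := hp.mono fun _ h => h.posSemidef
  have hS := integrableOn_sqrt hV hps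
  have h := volume_mul_sq_enorm_avg_le I (F := fun x => CFC.sqrt (V x) * X)
    ((continuous_id.matrix_mul continuous_const).comp_aestronglyMeasurable hS.1)
  rw [avg_mul_right I X hS] at h
  have h2 : ∫⁻ x in I.pts, ‖CFC.sqrt (V x) * X‖ₑ ^ 2 ≤
      ∫⁻ x in I.pts, ENNReal.ofReal (trForm (V x) X) := by
    refine lintegral_mono_ae ((ae_restrict_of_ae hps).mono fun x hx => ?_)
    rw [← ofReal_norm, ← ENNReal.ofReal_pow (norm_nonneg _)]
    exact ENNReal.ofReal_le_ofReal (sq_norm_sqrt_mul_le hx X)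
  rw [lintegral_trForm I hV hps] at h2
  have h3 := (ENNReal.mul_le_mul_iff_right (volume_pts_ne_zero I) (volume_pts_ne_top I)).1
    (h.trans h2)
  rw [← ofReal_norm, ← ENNReal.ofReal_pow (norm_nonneg _)] at h3
  exact (ENNReal.ofReal_le_ofReal_iff
    (trForm_nonneg (avg_posDef I hV hp).posSemidef _)).1 h3

/-- `‖m_I (W^{1/2}) (m_I W)^{-1/2}‖² ≤ n`. -/
lemma A2Weight.sq_norm_avg_sqrt_mul_inv_le (W : A2Weight d n) (I : Cube d) :
    ‖avg I (fun x => CFC.sqrt (W.fn x)) * (CFC.sqrt (avg I W.fn))⁻¹‖ ^ 2 ≤ n := by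
  have := sq_norm_avg_sqrt_mul_le I (W.integrableOn I) W.posDef (CFC.sqrt (avg I W.fn))⁻¹
  rwa [trForm_sqrt_inv (W.avg_posDef I)] at this

lemma trForm_avg_inv_sqrt_le_toReal (W : A2Weight d n) (I : Cube d) :
    trForm (avg I fun x => (W.fn x)⁻¹) (CFC.sqrt (avg I W.fn)) ≤ n * (a2Char W.fn).toReal := by
  have h := trForm_avg_inv_sqrt_le W I
  have hne : (n : ℝ≥0∞) * a2Char W.fn ≠ ∞ :=
    ENNReal.mul_ne_top (ENNReal.natCast_ne_top n) W.a2Char_lt_top.ne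
  rw [ENNReal.ofReal_le_iff_le_toReal hne, ENNReal.toReal_mul, ENNReal.toReal_natCast] at h
  exact h

lemma le_of_pow_two_le {a b : ℝ} (hb : 0 ≤ b) (h : a ^ 2 ≤ b ^ 2) : a ≤ b :=
  abs_le_of_sq_le_sq' h hb |>.2

/-- Jensen's inequality for the inverse, applied to √W, bounds the Hilbert–Schmidt norm of V^{-1/2}
N^{-1/2} by √n, hence also its determinant. This is the lower bound for det V used to invert V
below. -/
lemma inv_norm_det_avg_sqrt_le (W : A2Weight d n) (I : Cube d) :
    ‖(avg I fun x => CFC.sqrt (W.fn x)).det‖⁻¹ ≤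
      (n.factorial * Real.sqrt n ^ n) ^ 2 * ‖(avg I fun x => CFC.sqrt (W.fn x)⁻¹).det‖ := by
  set V := avg I fun x => CFC.sqrt (W.fn x)
  set N := avg I fun x => CFC.sqrt (W.fn x)⁻¹
  have hV : V.PosDef := W.avg_sqrt_posDef I
  have hsi : (fun x => (CFC.sqrt (W.fn x))⁻¹) =ᵐ[volume] fun x => CFC.sqrt (W.fn x)⁻¹ :=
    W.posSemidef.mono fun x hx => hx.inv_sqrt
  have hiN : IntegrableOn (fun x => CFC.sqrt (W.fn x)⁻¹) I.pts :=
    MatrixHardy.integrableOn_sqrt (W.integrableOn_inv I) W.inv_posSemidef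
  have hN : N.PosDef := MatrixHardy.avg_posDef I hiN (W.inv_posDef.mono fun _ h => sqrt_posDef h)
  have hNe : (avg I fun x => (CFC.sqrt (W.fn x))⁻¹) = N := by
    rw [avg_eq, show N = _ from avg_eq I _]; congr 1; exact integral_congr_ae (ae_restrict_of_ae hsi)
  have h := volume_mul_trForm_inv_avg_le I (W.integrableOn_sqrt I)
    (W.posDef.mono fun _ h => sqrt_posDef h)
    (hiN.congr (Filter.EventuallyEq.symm (ae_restrict_of_ae hsi))) (CFC.sqrt N)⁻¹
  rw [hNe, trForm_sqrt_inv hN, trForm_inv_eq_hs hV] at h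
  have h2 : ‖(CFC.sqrt V)⁻¹ * (CFC.sqrt N)⁻¹‖ ≤ Real.sqrt n := by
    refine le_of_pow_two_le (Real.sqrt_nonneg _) ?_
    rw [Real.sq_sqrt (Nat.cast_nonneg n)]
    exact (sq_norm_le_hs _).trans h
  have h3 : ‖((CFC.sqrt V)⁻¹ * (CFC.sqrt N)⁻¹).det‖ ≤ n.factorial * Real.sqrt n ^ n :=
    (norm_det_le _).trans (by gcongr)
  have h4 := pow_le_pow_left₀ (norm_nonneg _) h3 2
  have h5 : ‖((CFC.sqrt V)⁻¹ * (CFC.sqrt N)⁻¹).det‖ ^ 2 = ‖V.det‖⁻¹ * ‖N.det‖⁻¹ := by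
    rw [Matrix.det_mul, Matrix.det_nonsing_inv, Matrix.det_nonsing_inv, Ring.inverse_eq_inv',
      norm_mul, norm_inv, norm_inv, mul_pow, inv_pow, inv_pow, ← norm_pow,
      ← norm_pow, ← Matrix.det_pow, ← Matrix.det_pow, sq, sq, sqrt_mul_sqrt hV.posSemidef,
      sqrt_mul_sqrt hN.posSemidef]
  rw [h5] at h4
  have h6 : 0 < ‖N.det‖ := norm_pos_iff.2 hN.det_pos.ne'
  calc ‖V.det‖⁻¹ = ‖V.det‖⁻¹ * ‖N.det‖⁻¹ * ‖N.det‖ := by field_simp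
    _ ≤ _ := by gcongr

/-- `(m_I W)^{1/2} (m_I W^{1/2})⁻¹` is bounded, uniformly in the cube `I`. -/
lemma A2Weight.exists_norm_sqrt_avg_mul_inv_le (W : A2Weight d n) :
    ∃ C : ℝ, 0 < C ∧ ∀ I : Cube d,
      ‖CFC.sqrt (avg I W.fn) * (avg I fun x => CFC.sqrt (W.fn x))⁻¹‖ ≤ C := by
  set a := (a2Char W.fn).toReal
  set c := max 1 (Real.sqrt n)
  -- The matrix in question is the inverse of P = V R⁻¹. Since ‖P‖ ≤ c, the adjugate formula reduces
  -- its norm to |det P|⁻¹ = |det V|⁻¹ |det R|. This is at most a constant times |det (N R)|, and ‖N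
  -- R‖² ≤ n a. The final 1 only makes the constant positive.
  refine ⟨((n.factorial * Real.sqrt n ^ n) ^ 2 * (n.factorial * Real.sqrt (n * a) ^ n)) *
    (n * (n.factorial * c ^ n)) + 1, by positivity, fun I => ?_⟩
  set V := avg I fun x => CFC.sqrt (W.fn x)
  set N := avg I fun x => CFC.sqrt (W.fn x)⁻¹
  set R := CFC.sqrt (avg I W.fn)
  have hM := W.avg_posDef I
  have hdR : IsUnit R.det := (Matrix.isUnit_iff_isUnit_det _).1 (sqrt_posDef hM).isUnit
  have hP : ‖V * R⁻¹‖ ≤ c := by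
    refine le_trans (le_of_pow_two_le (Real.sqrt_nonneg _) ?_) (le_max_right _ _)
    rw [Real.sq_sqrt (Nat.cast_nonneg n)]
    exact W.sq_norm_avg_sqrt_mul_inv_le I
  have hNR : ‖N * R‖ ≤ Real.sqrt (n * a) := by
    refine Real.le_sqrt_of_sq_le ?_
    refine le_trans ?_ (trForm_avg_inv_sqrt_le_toReal W I)
    exact sq_norm_avg_sqrt_mul_le I (W.integrableOn_inv I) W.inv_posDef R
  have h1 := norm_inv_le (V * R⁻¹) (le_max_left _ _) hP
  rw [Matrix.mul_inv_rev, Matrix.nonsing_inv_nonsing_inv _ hdR] at h1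
  have h2 : ‖(V * R⁻¹).det‖⁻¹ = ‖V.det‖⁻¹ * ‖R.det‖ := by
    rw [Matrix.det_mul, Matrix.det_nonsing_inv, Ring.inverse_eq_inv', norm_mul, norm_inv, mul_inv,
      inv_inv]
  have h3 : ‖N.det‖ * ‖R.det‖ ≤ n.factorial * Real.sqrt (n * a) ^ n := by
    rw [← norm_mul, ← Matrix.det_mul]
    exact (norm_det_le _).trans (by gcongr)
  have h4 : ‖V.det‖⁻¹ * ‖R.det‖ ≤
      (n.factorial * Real.sqrt n ^ n) ^ 2 * (n.factorial * Real.sqrt (n * a) ^ n) := by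
    calc ‖V.det‖⁻¹ * ‖R.det‖ ≤ ((n.factorial * Real.sqrt n ^ n) ^ 2 * ‖N.det‖) * ‖R.det‖ := by
          gcongr; exact inv_norm_det_avg_sqrt_le W I
      _ ≤ _ := by rw [mul_assoc]; gcongr
  rw [h2] at h1
  refine h1.trans (le_trans (mul_le_mul_of_nonneg_right h4 (by positivity)) ?_)
  linarith

/-- The quantitative absolute continuity of a scalar `A₂` weight. -/
lemma setLIntegral_le_of_a2 {w : Pt d → ℝ≥0∞} (hw : AEMeasurable w volume)
    (h0 : ∀ᵐ x, w x ≠ 0) (htop : ∀ᵐ x, w x ≠ ∞) {K : ℝ≥0∞} (hK0 : K ≠ 0) (hK : K ≠ ∞)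
    {I : Cube d} (h : (∫⁻ x in I.pts, w x) * (∫⁻ x in I.pts, (w x)⁻¹) ≤ K * volume I.pts ^ 2)
    {E : Set (Pt d)} (hE : MeasurableSet E) (hEI : E ⊆ I.pts)
    (hvol : 2 * volume E ≤ volume I.pts) :
    ∫⁻ x in E, w x ≤ (1 - (4 * K)⁻¹) * ∫⁻ x in I.pts, w x := by
  -- The complement G has at least half the measure of I. Cauchy–Schwarz |G|² ≤ w(G) w⁻¹(G) and the
  -- A₂ bound then give w(I) ≤ 4K w(G), the 4 being the square of the 2 in |I| ≤ 2|G|.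
  set G := I.pts \ E
  have hG : MeasurableSet G := (measurableSet_pts I).diff hE
  have hI0 := volume_pts_ne_zero I
  have hI1 := volume_pts_ne_top I
  have hwfin : ∫⁻ x in I.pts, w x ≠ ∞ :=
    (lintegral_lt_top_of_mul_inv (restrict_pts_ne_zero I) hw.restrict
      (ae_restrict_of_ae htop) (ENNReal.mul_ne_top hK (ENNReal.pow_ne_top hI1)) h).ne
  have hsplit : (∫⁻ x in E, w x) + ∫⁻ x in G, w x = ∫⁻ x in I.pts, w x := by
    have := lintegral_inter_add_sdiff (μ := volume) w I.pts hE
    rwa [Set.inter_eq_right.2 hEI] at this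
  have hvsplit : volume E + volume G = volume I.pts := by
    rw [← measure_inter_add_sdiff I.pts hE, Set.inter_eq_right.2 hEI]
  have hEtop : volume E ≠ ∞ := ((measure_mono hEI).trans_lt hI1.lt_top).ne
  have hvG : volume I.pts ≤ 2 * volume G := by
    have : volume E + volume E ≤ volume E + volume G := by rw [hvsplit, ← two_mul]; exact hvol
    have h2 : volume E ≤ volume G := (ENNReal.add_le_add_iff_left hEtop).1 this
    rw [← hvsplit, two_mul]; gcongr
  have hcs : volume G ^ 2 ≤ (∫⁻ x in G, w x) * ∫⁻ x in G, (w x)⁻¹ := by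
    have hwi : AEMeasurable (fun x => (w x)⁻¹) (volume.restrict G) := hw.restrict.inv
    have h2 := ENNReal.lintegral_mul_le_Lp_mul_Lq (volume.restrict G) (p := 2) (q := 2)
      (Real.holderConjugate_iff.2 ⟨by norm_num, by norm_num⟩) (f := fun x => w x ^ (1 / 2 : ℝ))
      (g := fun x => (w x)⁻¹ ^ (1 / 2 : ℝ)) (hw.restrict.pow_const _) (hwi.pow_const _)
    have h3 : ∫⁻ x in G, ((fun x => w x ^ (1 / 2 : ℝ)) * fun x => (w x)⁻¹ ^ (1 / 2 : ℝ)) x =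
        volume G := by
      rw [← setLIntegral_one]
      refine lintegral_congr_ae ?_
      filter_upwards [ae_restrict_of_ae h0, ae_restrict_of_ae htop] with x hx hx'
      rw [Pi.mul_apply, ← ENNReal.mul_rpow_of_nonneg _ _ (by norm_num),
        ENNReal.mul_inv_cancel hx hx', ENNReal.one_rpow]
    rw [h3] at h2
    simp only [← ENNReal.rpow_mul] at h2
    norm_num at h2
    have h4 := pow_le_pow_left' h2 2
    rw [mul_pow, ← ENNReal.rpow_natCast (_ ^ (1 / 2 : ℝ)),
      ← ENNReal.rpow_natCast (_ ^ (1 / 2 : ℝ)), ← ENNReal.rpow_mul, ← ENNReal.rpow_mul] at h4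
    norm_num at h4
    exact h4
  have key : ∫⁻ x in I.pts, w x ≤ 4 * K * ∫⁻ x in G, w x := by
    have hmul : volume I.pts ^ 2 * ∫⁻ x in I.pts, w x ≤
        volume I.pts ^ 2 * (4 * K * ∫⁻ x in G, w x) := by
      calc volume I.pts ^ 2 * ∫⁻ x in I.pts, w x
          ≤ (2 * volume G) ^ 2 * ∫⁻ x in I.pts, w x := by gcongr
        _ = 4 * (volume G ^ 2 * ∫⁻ x in I.pts, w x) := by ring
        _ ≤ 4 * ((∫⁻ x in G, w x) * (∫⁻ x in G, (w x)⁻¹) * ∫⁻ x in I.pts, w x) := by gcongr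
        _ ≤ 4 * ((∫⁻ x in G, w x) * (∫⁻ x in I.pts, (w x)⁻¹) * ∫⁻ x in I.pts, w x) := by
            have : ∫⁻ x in G, (w x)⁻¹ ≤ ∫⁻ x in I.pts, (w x)⁻¹ :=
              lintegral_mono_set Set.sdiff_subset
            gcongr
        _ = 4 * (∫⁻ x in G, w x) * ((∫⁻ x in I.pts, w x) * ∫⁻ x in I.pts, (w x)⁻¹) := by ring
        _ ≤ 4 * (∫⁻ x in G, w x) * (K * volume I.pts ^ 2) := by gcongr
        _ = _ := by ring
    exact (ENNReal.mul_le_mul_iff_right (pow_ne_zero _ hI0) (ENNReal.pow_ne_top hI1)).1 hmul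
  have h4K : (4 * K : ℝ≥0∞) ≠ 0 := mul_ne_zero (by norm_num) hK0
  have h4K' : (4 * K : ℝ≥0∞) ≠ ∞ := ENNReal.mul_ne_top (by norm_num) hK
  have hGtop : ∫⁻ x in G, w x ≠ ∞ :=
    ((lintegral_mono_set Set.sdiff_subset).trans_lt hwfin.lt_top).ne
  have key2 : (4 * K)⁻¹ * ∫⁻ x in I.pts, w x ≤ ∫⁻ x in G, w x := by
    rw [mul_comm, ← div_eq_mul_inv]
    exact ENNReal.div_le_of_le_mul' key
  rw [ENNReal.sub_mul (fun _ _ => hwfin), one_mul]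
  refine ENNReal.le_sub_of_add_le_right (ne_top_of_le_ne_top hGtop key2) ?_
  calc _ ≤ (∫⁻ x in E, w x) + ∫⁻ x in G, w x := by gcongr
    _ = _ := hsplit

end Reducing

/-! ### Geometry of dyadic grids -/

section Grid

variable {d : ℕ}

lemma Cube.corner_mem (I : Cube d) : I.corner ∈ I.pts :=
  fun i => ⟨le_rfl, by linarith [I.side_pos]⟩

lemma Cube.corner_le_of_subset {I J : Cube d} (h : I.pts ⊆ J.pts) (i : Fin d) :
    J.corner i ≤ I.corner i := (h I.corner_mem i).1

lemma Cube.add_side_le_of_subset {I J : Cube d} (h : I.pts ⊆ J.pts) (i : Fin d) :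
    I.corner i + I.side ≤ J.corner i + J.side := by
  refine le_of_forall_lt fun y hy => ?_
  rcases lt_or_ge y (I.corner i) with hy' | hy'
  · exact hy'.trans (h I.corner_mem i).2
  · have : Function.update I.corner i y ∈ I.pts := fun j => by
      by_cases hj : j = i
      · subst hj; simpa using ⟨hy', hy⟩
      · simpa [hj] using I.corner_mem j
    simpa using (h this i).2

/-- In dimension zero every cube is the same single point whatever its side; in positive dimension
one coordinate suffices to compare sides. -/
lemma Cube.side_le_of_subset [NeZero d] {I J : Cube d} (h : I.pts ⊆ J.pts) : I.side ≤ J.side := by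
  have h1 := Cube.corner_le_of_subset h 0
  have h2 := Cube.add_side_le_of_subset h 0
  linarith

/-- The dyadic subcubes of half the side length. -/
def Cube.child (I : Cube d) (b : Fin d → Bool) : Cube d where
  corner i := I.corner i + if b i then I.side / 2 else 0
  side := I.side / 2
  side_pos := half_pos I.side_pos

/-- The label of the dyadic subcube to which a point belongs. -/
def Cube.bit (I : Cube d) (x : Pt d) : Fin d → Bool :=
  fun i => decide (I.corner i + I.side / 2 ≤ x i)

lemma Cube.mem_child_iff (I : Cube d) (b : Fin d → Bool) (x : Pt d) :
    x ∈ (I.child b).pts ↔ x ∈ I.pts ∧ I.bit x = b := by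
  have hs := I.side_pos
  simp only [Cube.pts, Cube.child, Cube.bit, Set.mem_ofPred_eq, Set.mem_Ico, funext_iff,
    ← forall_and]
  refine forall_congr' fun i => ?_
  cases b i
  · simp only [Bool.false_eq_true, if_false, decide_eq_false_iff_not, not_le]
    constructor
    · intro h; refine ⟨⟨?_, ?_⟩, ?_⟩ <;> linarith [h.1, h.2]
    · intro h; refine ⟨?_, ?_⟩ <;> linarith [h.1.1, h.1.2, h.2]
  · simp only [if_true, decide_eq_true_eq]
    constructor
    · intro h; refine ⟨⟨?_, ?_⟩, ?_⟩ <;> linarith [h.1, h.2]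
    · intro h; refine ⟨?_, ?_⟩ <;> linarith [h.1.1, h.1.2, h.2]

lemma Cube.child_subset (I : Cube d) (b : Fin d → Bool) : (I.child b).pts ⊆ I.pts :=
  fun x hx => ((I.mem_child_iff b x).1 hx).1

lemma Cube.iUnion_child (I : Cube d) : ⋃ b, (I.child b).pts = I.pts := by
  ext x
  simp only [Set.mem_iUnion, Cube.mem_child_iff]
  exact ⟨fun ⟨_, h⟩ => h.1, fun h => ⟨_, h, rfl⟩⟩

lemma Cube.disjoint_child (I : Cube d) :
    Pairwise (Function.onFun Disjoint fun b => (I.child b).pts) := by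
  intro b b' hb
  refine Set.disjoint_left.2 fun x hx hx' => hb ?_
  rw [Cube.mem_child_iff] at hx hx'
  exact hx.2.symm.trans hx'.2

lemma Cube.volume_child (I : Cube d) (b : Fin d → Bool) :
    2 ^ d * volume (I.child b).pts = volume I.pts := by
  rw [volume_pts, volume_pts, ← mul_pow]
  congr 1
  change 2 * ENNReal.ofReal (I.side / 2) = _
  rw [show (2 : ℝ≥0∞) = ENNReal.ofReal 2 by simp, ← ENNReal.ofReal_mul (by norm_num)]
  congr 1; ring

lemma Cube.volumeReal_child (I : Cube d) (b : Fin d → Bool) :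
    2 ^ d * volume.real (I.child b).pts = volume.real I.pts := by
  have := congrArg ENNReal.toReal (I.volume_child b)
  simpa [Measure.real] using this

lemma Cube.sum_lintegral_child (I : Cube d) (f : Pt d → ℝ≥0∞) :
    ∑ b, ∫⁻ x in (I.child b).pts, f x = ∫⁻ x in I.pts, f x := by
  rw [← I.iUnion_child, lintegral_iUnion (fun b => measurableSet_pts _) I.disjoint_child,
    tsum_fintype]

lemma Cube.sum_volume_child (I : Cube d) : ∑ b, volume (I.child b).pts = volume I.pts := by
  simpa using I.sum_lintegral_child 1

lemma Cube.sum_integral_child {E : Type*} [NormedAddCommGroup E] [NormedSpace ℝ E] (I : Cube d)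
    {f : Pt d → E} (hf : IntegrableOn f I.pts) :
    ∑ b, ∫ x in (I.child b).pts, f x = ∫ x in I.pts, f x := by
  rw [← I.iUnion_child, integral_iUnion_fintype (fun b => measurableSet_pts _) I.disjoint_child
    fun b => hf.mono_set (I.child_subset b)]

variable (D : DyadicGrid d)

namespace DyadicGrid

variable {D}

lemma eq_of_side_eq {I J : Cube d} (hI : I ∈ D.cubes) (hJ : J ∈ D.cubes) (h : I.side = J.side)
    {x : Pt d} (hx : x ∈ I.pts) (hx' : x ∈ J.pts) : I = J := by
  obtain ⟨k, hk⟩ := D.side_eq I hI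
  exact (D.partition k x).unique ⟨hI, hk, hx⟩ ⟨hJ, h ▸ hk, hx'⟩

lemma subset_of_side_le [NeZero d] {I J : Cube d} (hI : I ∈ D.cubes) (hJ : J ∈ D.cubes)
    (h : I.side ≤ J.side) {x : Pt d} (hx : x ∈ I.pts) (hx' : x ∈ J.pts) : I.pts ⊆ J.pts := by
  rcases h.lt_or_eq with h | h
  · rcases D.nested I hI J hJ with h1 | h1 | h1
    · exact h1
    · exact absurd (Cube.side_le_of_subset h1) (not_le.2 h)
    · exact (Set.disjoint_left.1 h1 hx hx').elim
  · rw [eq_of_side_eq hI hJ h hx hx']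

lemma eq_of_subset_of_side_eq {I J : Cube d} (hI : I ∈ D.cubes) (hJ : J ∈ D.cubes)
    (h : I.side = J.side) (hs : I.pts ⊆ J.pts) : I = J :=
  eq_of_side_eq hI hJ h I.corner_mem (hs I.corner_mem)

/-- A cube of the grid, of half the side length of `I` and contained in `I`, has its corner at a
vertex or a midpoint in every coordinate. -/
lemma corner_eq_or [NeZero d] {I C : Cube d} (hI : I ∈ D.cubes) (hC : C ∈ D.cubes)
    (hs : C.side = I.side / 2) (hCI : C.pts ⊆ I.pts) (i : Fin d) :
    C.corner i ≤ I.corner i ∨ I.corner i + I.side / 2 ≤ C.corner i := by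
  by_contra! hc
  -- Slide the corner of C to the lower face of I. The grid cube C' of the same size through this
  -- point stays in I, so it starts on that face; it then contains the corner of C and must equal C,
  -- a contradiction.
  set y : Pt d := Function.update C.corner i (I.corner i)
  have hyI : y ∈ I.pts := fun j => by
    by_cases hj : j = i
    · subst hj; simpa [y] using I.side_pos
    · simpa [y, hj] using hCI C.corner_mem j
  obtain ⟨k, hk⟩ := D.side_eq C hC
  obtain ⟨C', ⟨hC'D, hC'k, hyC'⟩, -⟩ := D.partition k y
  have hs' : C'.side = I.side / 2 := by rw [hC'k, ← hk, hs]
  have hC'I : C'.pts ⊆ I.pts :=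
    subset_of_side_le hC'D hI (by rw [hs']; linarith [I.side_pos]) hyC' hyI
  have hc' : C'.corner i = I.corner i := by
    refine le_antisymm ?_ (Cube.corner_le_of_subset hC'I i)
    simpa [y] using (hyC' i).1
  have hmem : C.corner ∈ C'.pts := fun j => by
    by_cases hj : j = i
    · subst hj; rw [hc', hs']; exact ⟨hc.1.le, hc.2⟩
    · simpa [y, hj] using hyC' j
  have := eq_of_side_eq hC hC'D (hs.trans hs'.symm) C.corner_mem hmem
  rw [← this] at hc'
  linarith [hc.1]

/-- The grid axioms do not say that cubes are bisected. The grid cube of half the side through the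
corner of the child lies in I, and `corner_eq_or` leaves no position for it other than that of the
child. -/
lemma child_mem [NeZero d] {I : Cube d} (hI : I ∈ D.cubes) (b : Fin d → Bool) :
    I.child b ∈ D.cubes := by
  obtain ⟨k, hk⟩ := D.side_eq I hI
  obtain ⟨C, ⟨hC, hCk, hx⟩, -⟩ := D.partition (k - 1) (I.child b).corner
  have hs : C.side = I.side / 2 := by
    rw [hCk, hk, zpow_sub_one₀ (by norm_num)]; ring
  have hCI : C.pts ⊆ I.pts := subset_of_side_le hC hI (by rw [hs]; linarith [I.side_pos]) hx
    (I.child_subset b (I.child b).corner_mem)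
  convert hC
  ext i
  · have h1 := hx i
    have h2 := corner_eq_or hI hC hs hCI i
    have h3 := Cube.corner_le_of_subset hCI i
    have h4 := Cube.add_side_le_of_subset hCI i
    have := I.side_pos
    rw [hs, Set.mem_Ico] at h1
    rw [hs] at h4
    simp only [Cube.child] at h1 ⊢
    rcases h2 with h2 | h2 <;> split_ifs at h1 ⊢ <;> linarith [h1.1, h1.2]
  · exact hs.symm

lemma side_le_half {I J : Cube d} (hI : I ∈ D.cubes) (hJ : J ∈ D.cubes) (h : I.side < J.side) :
    I.side ≤ J.side / 2 := by
  obtain ⟨k, hk⟩ := D.side_eq I hI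
  obtain ⟨l, hl⟩ := D.side_eq J hJ
  rw [hk, hl] at h ⊢
  have hkl : k < l := (zpow_lt_zpow_iff_right₀ (by norm_num)).1 h
  have : (2 : ℝ) ^ l / 2 = 2 ^ (l - 1) := by rw [zpow_sub_one₀ (by norm_num)]; ring
  rw [this]
  exact zpow_le_zpow_right₀ (by norm_num) (by omega)

lemma exists_subset_child [NeZero d] {I J : Cube d} (hI : I ∈ D.cubes) (hJ : J ∈ D.cubes)
    (h : J.side < I.side) (hs : J.pts ⊆ I.pts) : ∃ b, J.pts ⊆ (I.child b).pts :=
  ⟨I.bit J.corner, subset_of_side_le hJ (child_mem hI _) (side_le_half hJ hI h) J.corner_mem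
    ((I.mem_child_iff _ _).2 ⟨hs J.corner_mem, rfl⟩)⟩

lemma exists_parent [NeZero d] {I : Cube d} (hI : I ∈ D.cubes) :
    ∃ J ∈ D.cubes, ∃ b, I = J.child b := by
  obtain ⟨k, hk⟩ := D.side_eq I hI
  obtain ⟨J, ⟨hJ, hJk, hx⟩, -⟩ := D.partition (k + 1) I.corner
  have hs : I.side = J.side / 2 := by
    rw [hk, hJk, zpow_add_one₀ (by norm_num)]; ring
  have hlt : I.side < J.side := by rw [hs]; linarith [J.side_pos]
  obtain ⟨b, hb⟩ := exists_subset_child hJ hI hlt (subset_of_side_le hI hJ hlt.le I.corner_mem hx)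
  exact ⟨J, hJ, b, eq_of_subset_of_side_eq hI (child_mem hJ b) hs hb⟩

/-- The cubes of the grid inside `I` other than `I` are those inside a unique subcube of `I`. -/
lemma eq_or_subset_child [NeZero d] {I J : Cube d} (hI : I ∈ D.cubes) (hJ : J ∈ D.cubes)
    (hs : J.pts ⊆ I.pts) : J = I ∨ ∃ b, J.pts ⊆ (I.child b).pts := by
  rcases (Cube.side_le_of_subset hs).lt_or_eq with h | h
  · exact Or.inr (exists_subset_child hI hJ h hs)
  · exact Or.inl (eq_of_subset_of_side_eq hJ hI h hs)

lemma not_subset_child [NeZero d] (I : Cube d) (b : Fin d → Bool) :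
    ¬ I.pts ⊆ (I.child b).pts := fun h => by
  have := Cube.side_le_of_subset h
  change I.side ≤ I.side / 2 at this
  linarith [I.side_pos]

/-- The subcubes of a cube of the grid, as cubes of the grid. -/
def child [NeZero d] (I : D.cubes) (b : Fin d → Bool) : D.cubes := ⟨I.1.child b, child_mem I.2 b⟩

end DyadicGrid

end Grid

/-! ### Haar functions -/

section Haar

variable {d n : ℕ}

noncomputable instance : Fintype (Sig d) := Fintype.ofFinite _

/-- The sign of the Haar function with signature `e` on the subcube with label `b`. -/
def sgn (e : Fin d → Fin 2) (b : Fin d → Bool) : ℝ :=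
  ∏ i, if e i = 1 then 1 else if b i then -1 else 1

lemma abs_sgn (e : Fin d → Fin 2) (b : Fin d → Bool) : |sgn e b| = 1 := by
  rw [sgn, Finset.abs_prod]
  exact Finset.prod_eq_one fun i _ => by split_ifs <;> simp

lemma sgn_one (b : Fin d → Bool) : sgn (fun _ => 1) b = 1 := by simp [sgn]

/-- The sum factors over the coordinates, and a coordinate where b and b' differ contributes 1 − 1 =
0. The primed version below is the dual orthogonality relation. -/
lemma sum_sgn_mul_sgn (b b' : Fin d → Bool) :
    ∑ e, sgn e b * sgn e b' = if b = b' then 2 ^ d else 0 := by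
  simp only [sgn, ← Finset.prod_mul_distrib]
  have := Finset.prod_univ_sum (R := ℝ) (fun _ : Fin d => (Finset.univ : Finset (Fin 2)))
    (fun i j => (if j = 1 then 1 else if b i then -1 else 1) *
      (if j = 1 then 1 else if b' i then -1 else 1))
  rw [Fintype.piFinset_univ] at this
  rw [← this]
  split_ifs with h
  · subst h
    rw [Finset.prod_congr rfl (g := fun _ => (2 : ℝ))]
    · simp
    · intro i _
      rw [Fin.sum_univ_two]
      cases b i <;> norm_num
  · obtain ⟨i, hi⟩ := Function.ne_iff.1 h
    refine Finset.prod_eq_zero (Finset.mem_univ i) ?_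
    rw [Fin.sum_univ_two]
    cases h1 : b i <;> cases h2 : b' i <;> simp_all

lemma sum_sgn_mul_sgn' (e e' : Fin d → Fin 2) :
    ∑ b, sgn e b * sgn e' b = if e = e' then 2 ^ d else 0 := by
  simp only [sgn, ← Finset.prod_mul_distrib]
  have := Finset.prod_univ_sum (R := ℝ) (fun _ : Fin d => (Finset.univ : Finset Bool))
    (fun i j => (if e i = 1 then 1 else if j then -1 else 1) *
      (if e' i = 1 then 1 else if j then -1 else 1))
  rw [Fintype.piFinset_univ] at this
  rw [← this]
  split_ifs with h
  · subst h
    rw [Finset.prod_congr rfl (g := fun _ => (2 : ℝ))]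
    · simp
    · intro i _
      rw [Fintype.sum_bool]
      split_ifs <;> norm_num
  · obtain ⟨i, hi⟩ := Function.ne_iff.1 h
    refine Finset.prod_eq_zero (Finset.mem_univ i) ?_
    rw [Fintype.sum_bool]
    have : (e i = 1 ∧ e' i = 0) ∨ (e i = 0 ∧ e' i = 1) := by omega
    rcases this with h | h <;> simp [h]

lemma sum_sgn (e : Sig d) : ∑ b, sgn e.1 b = 0 := by
  have := sum_sgn_mul_sgn' e.1 fun _ => 1
  rw [if_neg e.2] at this
  simpa [sgn_one] using this

lemma sum_univ_eq_sum_sig_add {M : Type*} [AddCommMonoid M] (f : (Fin d → Fin 2) → M) :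
    ∑ e, f e = ∑ e : Sig d, f e.1 + f fun _ => 1 := by
  classical
  rw [← Finset.sum_erase_add _ _ (Finset.mem_univ fun _ => 1)]
  congr 1
  exact Finset.sum_subtype (p := fun e : Fin d → Fin 2 => e ≠ fun _ => 1) _ (by simp) f

/-- Parseval's identity for the characters of `(ℤ/2)^d`. -/
lemma sum_sq_norm_sum_sgn {E : Type*} [NormedAddCommGroup E] [InnerProductSpace ℝ E]
    (z : (Fin d → Bool) → E) :
    ∑ e, ‖∑ b, sgn e b • z b‖ ^ 2 = 2 ^ d * ∑ b, ‖z b‖ ^ 2 := by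
  have h1 : ∀ e, ‖∑ b, sgn e b • z b‖ ^ 2 =
      ∑ b, ∑ b', sgn e b * sgn e b' * inner ℝ (z b) (z b') := by
    intro e
    rw [← real_inner_self_eq_norm_sq, sum_inner]
    refine Finset.sum_congr rfl fun b _ => ?_
    rw [inner_sum]
    refine Finset.sum_congr rfl fun b' _ => ?_
    rw [real_inner_smul_left, real_inner_smul_right, mul_assoc]
  simp only [h1]
  rw [Finset.sum_comm, Finset.mul_sum]
  refine Finset.sum_congr rfl fun b _ => ?_
  rw [Finset.sum_comm]
  simp only [← Finset.sum_mul, sum_sgn_mul_sgn]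
  simp

/-- Parseval's identity for the characters of `(ℤ/2)^d`, Hilbert–Schmidt valued. -/
lemma sum_hs_sum_sgn (v : (Fin d → Bool) → Mat n) :
    ∑ e : Sig d, hs (∑ b, sgn e.1 b • v b) + hs (∑ b, v b) = 2 ^ d * ∑ b, hs (v b) := by
  have hscal : ∀ z : (Fin d → Bool) → ℂ,
      ∑ e, ‖∑ b, sgn e b • z b‖ ^ 2 = 2 ^ d * ∑ b, ‖z b‖ ^ 2 :=
    fun z => sum_sq_norm_sum_sgn z
  have h2 : ∑ e, hs (∑ b, sgn e b • v b) = 2 ^ d * ∑ b, hs (v b) := by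
    unfold hs
    rw [Finset.sum_comm, Finset.sum_comm (γ := Fin d → Bool), Finset.mul_sum]
    refine Finset.sum_congr rfl fun i _ => ?_
    rw [Finset.sum_comm, Finset.sum_comm (γ := Fin d → Bool), Finset.mul_sum]
    refine Finset.sum_congr rfl fun j _ => ?_
    rw [← hscal]
    simp [Matrix.sum_apply]
  rw [sum_univ_eq_sum_sig_add] at h2
  simpa [sgn_one] using h2

/-- The absolute value of a Haar function on its cube. -/
def haarScale (I : Cube d) : ℝ := (Real.sqrt I.side)⁻¹ ^ d

lemma volumeReal_pts (I : Cube d) : volume.real I.pts = I.side ^ d := by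
  rw [Measure.real, volume_pts, ENNReal.toReal_pow, ENNReal.toReal_ofReal I.side_pos.le]

lemma haarScale_pos (I : Cube d) : 0 < haarScale I := by
  have := I.side_pos
  unfold haarScale; positivity

lemma haarScale_sq (I : Cube d) : haarScale I ^ 2 = (volume.real I.pts)⁻¹ := by
  rw [haarScale, volumeReal_pts, ← pow_mul, mul_comm, pow_mul, inv_pow,
    Real.sq_sqrt I.side_pos.le, inv_pow]

lemma haar_eq (I : Cube d) (e : Fin d → Fin 2) {x : Pt d} (hx : x ∈ I.pts) :
    haar I e x = haarScale I * sgn e (I.bit x) := by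
  rw [haar, haarScale, sgn, ← Fin.prod_const, ← Finset.prod_mul_distrib]
  refine Finset.prod_congr rfl fun i _ => ?_
  unfold haarOne
  congr 1
  split_ifs with h h'
  · rw [Set.indicator_of_mem (hx i)]; rfl
  · have h' := of_decide_eq_true h'
    rw [Set.indicator_of_notMem, Set.indicator_of_mem]
    · simp
    · exact ⟨h', (hx i).2⟩
    · exact fun hh => absurd hh.2 (not_lt.2 h')
  · have h' : ¬ _ := fun hh => h' (decide_eq_true hh)
    rw [Set.indicator_of_mem, Set.indicator_of_notMem]
    · simp
    · exact fun hh => h' hh.1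
    · exact ⟨(hx i).1, not_le.1 h'⟩

lemma haar_eq_of_mem_child (I : Cube d) (e : Fin d → Fin 2) (b : Fin d → Bool) {x : Pt d}
    (hx : x ∈ (I.child b).pts) : haar I e x = haarScale I * sgn e b := by
  rw [Cube.mem_child_iff] at hx
  rw [haar_eq I e hx.1, hx.2]

lemma abs_haar_le (I : Cube d) (e : Fin d → Fin 2) (x : Pt d) : |haar I e x| ≤ haarScale I := by
  by_cases hx : x ∈ I.pts
  · rw [haar_eq I e hx, abs_mul, abs_sgn, mul_one, abs_of_pos (haarScale_pos I)]
  · rw [haar_eq_zero I e hx, abs_zero]; exact (haarScale_pos I).le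

lemma integral_haar_smul {E : Type*} [NormedAddCommGroup E] [NormedSpace ℝ E] (I : Cube d)
    (e : Fin d → Fin 2) {F : Pt d → E} (hF : IntegrableOn F I.pts) :
    ∫ x, haar I e x • F x = haarScale I • ∑ b, sgn e b • ∫ x in (I.child b).pts, F x := by
  have h1 : ∫ x, haar I e x • F x = ∫ x in I.pts, haar I e x • F x := by
    rw [setIntegral_eq_integral_of_forall_compl_eq_zero]
    intro x hx; rw [haar_eq_zero I e hx, zero_smul]
  have h2 : IntegrableOn (fun x => haar I e x • F x) I.pts := by
    refine Integrable.bdd_smul hF (haarScale I) (measurable_haar I e).aestronglyMeasurable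
      (Filter.Eventually.of_forall fun x => abs_haar_le I e x)
  rw [h1, ← I.sum_integral_child h2, Finset.smul_sum]
  refine Finset.sum_congr rfl fun b _ => ?_
  rw [smul_smul, ← integral_smul]
  refine setIntegral_congr_fun (measurableSet_pts _) fun x hx => ?_
  rw [haar_eq_of_mem_child I e b hx]

lemma haarCoeff_eq {D : DyadicGrid d} (F : Pt d → Mat n) (p : HaarIdx D)
    (hF : IntegrableOn F p.1.1.pts) :
    haarCoeff D F p =
      haarScale p.1.1 • ∑ b, sgn p.2.1 b • ∫ x in (p.1.1.child b).pts, F x :=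
  integral_haar_smul _ _ hF

/-- The energy identity: the Haar coefficients at `I` measure the increase of the energy of the
averages when passing from `I` to its subcubes. -/
lemma sum_hs_haarCoeff {D : DyadicGrid d} (F : Pt d → Mat n) (I : D.cubes)
    (hF : IntegrableOn F I.1.pts) :
    ∑ e : Sig d, hs (haarCoeff D F (I, e)) +
        (volume.real I.1.pts)⁻¹ * hs (∫ x in I.1.pts, F x) =
      ∑ b, (volume.real (I.1.child b).pts)⁻¹ * hs (∫ x in (I.1.child b).pts, F x) := by
  have h := sum_hs_sum_sgn fun b => ∫ x in (I.1.child b).pts, F x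
  have hv : ∀ b, (volume.real (I.1.child b).pts)⁻¹ = (volume.real I.1.pts)⁻¹ * 2 ^ d := fun b => by
    rw [← I.1.volumeReal_child b, mul_inv]; field_simp
  simp only [hv]
  rw [← Finset.mul_sum, mul_assoc, ← h, mul_add, I.1.sum_integral_child hF, Finset.mul_sum]
  congr 1
  refine Finset.sum_congr rfl fun e _ => ?_
  rw [haarCoeff_eq F (I, e) hF, hs_real_smul, haarScale_sq]

lemma integral_haar_const (I : Cube d) (e : Sig d) : ∫ x, haar I e.1 x = 0 := by
  have h := integral_haar_smul (E := ℝ) I e.1 (F := fun _ => 1)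
    (integrableOn_const (volume_pts_ne_top I))
  simp only [smul_eq_mul, mul_one, setIntegral_const] at h
  have hv : ∀ b, volume.real (I.child b).pts = volume.real I.pts / 2 ^ d := fun b => by
    rw [← I.volumeReal_child b]; field_simp
  simp only [hv] at h
  rw [h, ← Finset.sum_mul, sum_sgn]
  simp

lemma integral_haar_mul_haar_self (I : Cube d) (e e' : Fin d → Fin 2) :
    ∫ x, haar I e x * haar I e' x = if e = e' then 1 else 0 := by
  have hm : IntegrableOn (haar I e') I.pts :=
    Measure.integrableOn_of_bounded (volume_pts_ne_top I)
      (measurable_haar I e').aestronglyMeasurable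
      (Filter.Eventually.of_forall fun x => abs_haar_le I e' x)
  have h := integral_haar_smul (E := ℝ) I e hm
  simp only [smul_eq_mul] at h
  have hv : ∀ b, volume.real (I.child b).pts = volume.real I.pts / 2 ^ d := fun b => by
    rw [← I.volumeReal_child b]; field_simp
  have hi : ∀ b, ∫ x in (I.child b).pts, haar I e' x =
      volume.real I.pts / 2 ^ d * (haarScale I * sgn e' b) := fun b => by
    rw [setIntegral_congr_fun (measurableSet_pts _)
      fun x hx => haar_eq_of_mem_child I e' b hx, setIntegral_const, hv, smul_eq_mul]
  simp only [hi] at h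
  have h2 : haarScale I * ∑ b, sgn e b * (volume.real I.pts / 2 ^ d * (haarScale I * sgn e' b)) =
      haarScale I ^ 2 * volume.real I.pts / 2 ^ d * ∑ b, sgn e b * sgn e' b := by
    rw [Finset.mul_sum, Finset.mul_sum]
    exact Finset.sum_congr rfl fun b _ => by ring
  rw [h, h2, sum_sgn_mul_sgn', haarScale_sq, inv_mul_cancel₀ (volumeReal_pts_pos I).ne']
  split_ifs <;> simp

/-- Haar functions of a dyadic grid are orthonormal. -/
lemma integral_haar_mul_haar [NeZero d] {D : DyadicGrid d} (p q : HaarIdx D) :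
    ∫ x, haar p.1.1 p.2.1 x * haar q.1.1 q.2.1 x = open Classical in if p = q then 1 else 0 := by
  classical
  obtain ⟨I, e⟩ := p
  obtain ⟨J, e'⟩ := q
  by_cases hIJ : I = J
  · subst hIJ
    simp only [integral_haar_mul_haar_self, Prod.mk.injEq, true_and]
    exact if_congr Subtype.ext_iff.symm rfl rfl
  -- The Haar function of the larger cube is constant on the smaller one, where the other function
  -- has mean zero.
  have key : ∀ (I J : D.cubes) (e e' : Sig d), I ≠ J → I.1.side ≤ J.1.side →
      ∫ x, haar I.1 e.1 x * haar J.1 e'.1 x = 0 := by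
    intro I J e e' hne hs
    by_cases hd : ∃ x, x ∈ I.1.pts ∧ x ∈ J.1.pts
    · obtain ⟨x, hx, hx'⟩ := hd
      have hsub := DyadicGrid.subset_of_side_le I.2 J.2 hs hx hx'
      obtain ⟨b, hb⟩ := (DyadicGrid.eq_or_subset_child J.2 I.2 hsub).resolve_left
        fun h => hne (Subtype.ext h)
      have : ∀ x, haar I.1 e.1 x * haar J.1 e'.1 x =
          haar I.1 e.1 x * (haarScale J.1 * sgn e'.1 b) := fun x => by
        by_cases hx : x ∈ I.1.pts
        · rw [haar_eq_of_mem_child _ _ _ (hb hx)]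
        · rw [haar_eq_zero _ _ hx, zero_mul, zero_mul]
      simp only [this]
      rw [integral_mul_const, integral_haar_const, zero_mul]
    · push Not at hd
      have : ∀ x, haar I.1 e.1 x * haar J.1 e'.1 x = 0 := fun x => by
        by_cases hx : x ∈ I.1.pts
        · rw [haar_eq_zero _ _ (hd x hx), mul_zero]
        · rw [haar_eq_zero _ _ hx, zero_mul]
      simp [this]
  rw [if_neg fun h => hIJ (Prod.ext_iff.1 h).1]
  rcases le_total I.1.side J.1.side with h | h
  · exact key I J e e' hIJ h
  · simp only [mul_comm (haar I.1 e.1 _)]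
    exact key J I e' e (Ne.symm hIJ) h

lemma integrable_haar (I : Cube d) (e : Fin d → Fin 2) : Integrable (haar I e) := by
  have hm : IntegrableOn (haar I e) I.pts :=
    Measure.integrableOn_of_bounded (volume_pts_ne_top I)
      (measurable_haar I e).aestronglyMeasurable
      (Filter.Eventually.of_forall fun x => abs_haar_le I e x)
  refine (integrableOn_iff_integrable_of_support_subset fun x hx => ?_).1 hm
  by_contra hc
  exact hx (haar_eq_zero I e hc)

lemma integrable_haar_mul_haar (I J : Cube d) (e e' : Fin d → Fin 2) :
    Integrable (fun x => haar I e x * haar J e' x) :=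
  (integrable_haar J e').bdd_mul (measurable_haar I e).aestronglyMeasurable
    (c := haarScale I) (Filter.Eventually.of_forall fun x => abs_haar_le I e x)

lemma integrable_haarPoly (D : DyadicGrid d) (F : Finset (HaarIdx D)) (A : HaarIdx D → Mat n) :
    Integrable (haarPoly D F A) :=
  integrable_finsetSum _ fun p _ => (integrable_haar p.1.1 p.2.1).smul_const (A p)

lemma haarCoeff_haarPoly [NeZero d] (D : DyadicGrid d) (F : Finset (HaarIdx D))
    (A : HaarIdx D → Mat n) (p : HaarIdx D) :
    haarCoeff D (haarPoly D F A) p = open Classical in if p ∈ F then A p else 0 := by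
  classical
  unfold haarCoeff haarPoly
  simp only [Finset.smul_sum, smul_smul]
  rw [integral_finsetSum _ fun q _ => (integrable_haar_mul_haar _ _ _ _).smul_const (A q)]
  simp only [integral_smul_const, integral_haar_mul_haar, ite_smul, one_smul, zero_smul]
  rw [Finset.sum_ite_eq F p A]

end Haar

/-! ### Carleson sequences and the duality inequality -/

section Duality

variable {d n : ℕ}

/-- Summation of a Carleson sequence over finitely many cubes that meet `Ω` in at least half of
their measure. -/
lemma sum_le_of_carleson [NeZero d] {D : DyadicGrid d} {b : HaarIdx D → ℝ≥0∞} {M : ℝ≥0∞}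
    (hb : ∀ J ∈ D.cubes, ∑' p : {p : HaarIdx D // p.1.1.pts ⊆ J.pts}, b p.1 ≤ M * volume J.pts)
    (F : Finset (HaarIdx D)) {Ω : Set (Pt d)} (hΩ : MeasurableSet Ω)
    (h : ∀ p ∈ F, volume p.1.1.pts ≤ 2 * volume (p.1.1.pts ∩ Ω)) :
    ∑ p ∈ F, b p ≤ 2 * M * volume Ω := by
  classical
  induction F using Finset.strongInduction generalizing Ω with
  | H F ih =>
    rcases F.eq_empty_or_nonempty with rfl | hne
    · simp
    -- Remove a largest cube J with everything inside it, and replace Ω by Ω \ J. The remaining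
    -- cubes are disjoint from J, so they keep their share of Ω; the removed ones cost M |J| ≤ 2M |J
    -- ∩ Ω|.
    obtain ⟨q, hqF, hq⟩ := F.exists_max_image (fun p => p.1.1.side) hne
    set J := q.1.1
    set F' := F.filter fun p => ¬ p.1.1.pts ⊆ J.pts
    have hsub : F' ⊂ F := by
      refine Finset.filter_ssubset.2 ⟨q, hqF, ?_⟩
      simp [J]
    have h1 := ih F' hsub (Ω := Ω \ J.pts) (hΩ.diff (measurableSet_pts J)) fun p hp => by
      rw [Finset.mem_filter] at hp
      refine (h p hp.1).trans_eq ?_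
      congr 2
      ext x
      simp only [Set.mem_inter_iff, Set.mem_sdiff]
      refine ⟨fun hx => ⟨hx.1, hx.2, fun hJ => hp.2 ?_⟩, fun hx => ⟨hx.1, hx.2.1⟩⟩
      exact DyadicGrid.subset_of_side_le p.1.2 q.1.2 (hq p hp.1) hx.1 hJ
    have h2 : ∑ p ∈ F.filter (fun p => p.1.1.pts ⊆ J.pts), b p ≤ M * volume J.pts := by
      refine le_trans ?_ (hb J q.1.2)
      rw [← Finset.sum_subtype_of_mem (p := fun p : HaarIdx D => p.1.1.pts ⊆ J.pts) b
        fun p hp => (Finset.mem_filter.1 hp).2]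
      exact ENNReal.sum_le_tsum _
    rw [← Finset.sum_filter_add_sum_filter_not F fun p => p.1.1.pts ⊆ J.pts]
    calc _ ≤ M * volume J.pts + 2 * M * volume (Ω \ J.pts) := add_le_add h2 h1
      _ ≤ M * (2 * volume (J.pts ∩ Ω)) + 2 * M * volume (Ω \ J.pts) := by
          gcongr; exact h q hqF
      _ = 2 * M * (volume (Ω ∩ J.pts) + volume (Ω \ J.pts)) := by
          rw [Set.inter_comm]; ring
      _ = _ := by rw [measure_inter_add_sdiff Ω (measurableSet_pts J)]

/-- An upper median of a function on a set of finite measure. -/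
lemma exists_median {α : Type*} [MeasurableSpace α] {μ : Measure α} {I : Set α} {S : α → ℝ≥0∞}
    (hfin : μ I ≠ ∞) (hS : Measurable S) :
    ∃ m : ℝ≥0∞, (∀ l < m, μ I ≤ 2 * μ (I ∩ {x | l < S x})) ∧
      μ I ≤ 2 * μ (I ∩ {x | S x ≤ m}) := by
  -- The median is the supremum of the levels exceeded on at least half of I. Above it the
  -- superlevel sets have at most half the measure, and continuity from below along levels
  -- decreasing to m gives the same for {m < S}.
  set T : Set ℝ≥0∞ := {l | μ I ≤ 2 * μ (I ∩ {x | l < S x})}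
  refine ⟨sSup T, fun l hl => ?_, ?_⟩
  · obtain ⟨l', hl', hll'⟩ := lt_sSup_iff.1 hl
    refine le_trans (show _ ≤ _ from hl') ?_
    gcongr
  · set m := sSup T
    have hle : 2 * μ (I ∩ {x | m < S x}) ≤ μ I := by
      rcases eq_or_ne m ⊤ with hm | hm
      · simp [hm]
      obtain ⟨u, hu, hum, hut⟩ := exists_seq_strictAnti_tendsto' (lt_top_iff_ne_top.2 hm)
      have hU : I ∩ {x | m < S x} = ⋃ k, I ∩ {x | u k < S x} := by
        rw [← Set.inter_iUnion]
        congr 1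
        ext x
        simp only [Set.mem_ofPred_eq, Set.mem_iUnion]
        refine ⟨fun h => ?_, fun ⟨k, hk⟩ => (hum k).1.trans hk⟩
        exact (hut.eventually (gt_mem_nhds h)).exists
      rw [hU, (show Monotone fun k => I ∩ {x | u k < S x} from fun k l hkl =>
        Set.inter_subset_inter_right _ fun x hx => (hu.antitone hkl).trans_lt hx).measure_iUnion,
        ENNReal.mul_iSup]
      refine iSup_le fun k => ?_
      have hk : u k ∉ T := fun hT => absurd (le_sSup hT) (not_le.2 (hum k).1)
      exact (not_le.1 hk).le
    have hsplit : μ (I ∩ {x | S x ≤ m}) + μ (I ∩ {x | m < S x}) = μ I := by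
      have := measure_inter_add_sdiff (μ := μ) I (measurableSet_le hS (measurable_const (a := m)))
      rw [← this]
      congr 2
      ext x; simp
    have hf : μ (I ∩ {x | m < S x}) ≠ ∞ :=
      ((measure_mono Set.inter_subset_left).trans_lt hfin.lt_top).ne
    have : μ (I ∩ {x | m < S x}) ≤ μ (I ∩ {x | S x ≤ m}) := by
      rw [← hsplit, two_mul] at hle
      exact (ENNReal.add_le_add_iff_right hf).1 hle
    rw [← hsplit, two_mul]
    gcongr

/-- A weighted sum over a Carleson sequence whose weights are medians of a function `S`. -/
lemma sum_median_mul_le_of_carleson [NeZero d] {D : DyadicGrid d} {b : HaarIdx D → ℝ≥0∞}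
    {M : ℝ≥0∞}
    (hb : ∀ J ∈ D.cubes, ∑' p : {p : HaarIdx D // p.1.1.pts ⊆ J.pts}, b p.1 ≤ M * volume J.pts)
    (F : Finset (HaarIdx D)) {S : Pt d → ℝ≥0∞} (hS : Measurable S) (hfin : ∀ᵐ x, S x < ∞)
    {m : HaarIdx D → ℝ≥0∞}
    (hm : ∀ p, ∀ l < m p, volume p.1.1.pts ≤ 2 * volume (p.1.1.pts ∩ {x | l < S x})) :
    ∑ p ∈ F, m p * b p ≤ 2 * M * ∫⁻ x, S x := by
  classical
  have hms : ∀ p, MeasurableSet {t : ℝ | ENNReal.ofReal t < m p} := fun p =>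
    measurableSet_lt ENNReal.measurable_ofReal measurable_const
  -- Layer-cake: m_p is the length of {t > 0 : t < m_p}. At each level t the cubes with m_p > t meet
  -- {S > t} in at least half of their measure, so `sum_le_of_carleson` applies with that set as Ω.
  have h1 : ∀ p, m p * b p ≤ ∫⁻ t in Set.Ioi (0 : ℝ),
      {t : ℝ | ENNReal.ofReal t < m p}.indicator (fun _ => b p) t := by
    intro p
    rw [lintegral_indicator_const (hms p), Measure.restrict_apply (hms p), mul_comm]
    gcongr
    refine le_of_forall_lt fun l hl => ?_
    obtain ⟨l', hll', hl'm⟩ := exists_between hl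
    have hsub : Set.Ioo (0 : ℝ) l'.toReal ⊆ {t | ENNReal.ofReal t < m p} ∩ Set.Ioi 0 :=
      fun t ht => ⟨lt_of_le_of_lt (ENNReal.ofReal_le_of_le_toReal ht.2.le) hl'm, ht.1⟩
    refine lt_of_lt_of_le ?_ (measure_mono hsub)
    rw [Real.volume_Ioo, sub_zero, ENNReal.ofReal_toReal hl'm.ne_top]
    exact hll'
  have hl : ∫⁻ x, S x = ∫⁻ t in Set.Ioi (0 : ℝ), volume {x | ENNReal.ofReal t < S x} := by
    have h2 := lintegral_eq_lintegral_meas_lt (volume : Measure (Pt d))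
      (f := fun x => (S x).toReal) (Filter.Eventually.of_forall fun x => ENNReal.toReal_nonneg)
      hS.ennreal_toReal.aemeasurable
    rw [← lintegral_congr_ae (f := fun x => ENNReal.ofReal (S x).toReal)
      (hfin.mono fun x hx => ENNReal.ofReal_toReal hx.ne), h2]
    refine setLIntegral_congr_fun measurableSet_Ioi fun t ht => measure_congr ?_
    filter_upwards [hfin] with x hx
    exact propext (ENNReal.ofReal_lt_iff_lt_toReal (le_of_lt ht) hx.ne).symm
  calc ∑ p ∈ F, m p * b p
      ≤ ∑ p ∈ F, ∫⁻ t in Set.Ioi (0 : ℝ),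
          {t : ℝ | ENNReal.ofReal t < m p}.indicator (fun _ => b p) t :=
        Finset.sum_le_sum fun p _ => h1 p
    _ = ∫⁻ t in Set.Ioi (0 : ℝ), ∑ p ∈ F,
          {t : ℝ | ENNReal.ofReal t < m p}.indicator (fun _ => b p) t :=
        (lintegral_finsetSum _ fun p _ => measurable_const.indicator (hms p)).symm
    _ ≤ ∫⁻ t in Set.Ioi (0 : ℝ), 2 * M * volume {x | ENNReal.ofReal t < S x} := by
        refine lintegral_mono fun t => ?_
        simp only [Set.indicator_apply, Set.mem_ofPred_eq]
        rw [← Finset.sum_filter]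
        refine sum_le_of_carleson hb _ (measurableSet_lt measurable_const hS) fun p hp => ?_
        exact hm p _ (Finset.mem_filter.1 hp).2
    _ = 2 * M * ∫⁻ x, S x := by
        rw [hl, lintegral_const_mul]
        refine Antitone.measurable fun s t hst => measure_mono fun x hx => ?_
        exact (ENNReal.ofReal_le_ofReal hst).trans_lt hx

/-- The normalized coefficients `(m_I W)^{1/2} A_I (m_I U)^{-1/2}`. -/
def redCoeff (D : DyadicGrid d) (W U : Pt d → Mat n) (A : HaarIdx D → Mat n) (p : HaarIdx D) :
    Mat n :=
  CFC.sqrt (avg p.1.1 W) * A p * (CFC.sqrt (avg p.1.1 U))⁻¹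

lemma enorm_sq (A : Mat n) : ‖A‖ₑ ^ 2 = ENNReal.ofReal (‖A‖ ^ 2) := by
  rw [← ofReal_norm, ENNReal.ofReal_pow (norm_nonneg _)]

lemma enorm_sq_sqrt_mul_le {V : Mat n} (hV : V.PosSemidef) (X : Mat n) :
    ‖CFC.sqrt V * X‖ₑ ^ 2 ≤ ENNReal.ofReal (trForm V X) := by
  rw [enorm_sq]; exact ENNReal.ofReal_le_ofReal (sq_norm_sqrt_mul_le hV X)

lemma A2Weight.lintegral_sq_enorm_sqrt_mul_le (W : A2Weight d n) (I : Cube d) (X : Mat n) :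
    ∫⁻ x in I.pts, ‖CFC.sqrt (W.fn x) * X‖ₑ ^ 2 ≤
      volume I.pts * (n * ‖CFC.sqrt (avg I W.fn) * X‖ₑ ^ 2) := by
  calc _ ≤ ∫⁻ x in I.pts, ENNReal.ofReal (trForm (W.fn x) X) :=
        lintegral_mono_ae ((ae_restrict_of_ae W.posSemidef).mono
          fun x hx => enorm_sq_sqrt_mul_le hx X)
    _ = volume I.pts * ENNReal.ofReal (trForm (avg I W.fn) X) :=
        lintegral_trForm I (W.integrableOn I) W.posSemidef X
    _ ≤ _ := by
        gcongr
        rw [trForm_eq_hs (W.avg_posDef I).posSemidef, enorm_sq, ← ENNReal.ofReal_natCast,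
          ← ENNReal.ofReal_mul (Nat.cast_nonneg n)]
        exact ENNReal.ofReal_le_ofReal (hs_le _)

/-- Weighted AM–GM without the factor 1/2, proved by asking which of b S and c a is larger. It
splits the pairing into a square function term and a Carleson term. -/
lemma mul_le_add_div_mul {a b c S : ℝ≥0∞} (hc : c ≠ 0) (hc' : c ≠ ∞) (hS : a ^ 2 ≠ 0 → S ≠ 0)
    (hS' : S ≠ ∞) : a * b ≤ c * (a ^ 2 / S) + c⁻¹ * (b ^ 2 * S) := by
  rcases eq_or_ne a 0 with rfl | ha
  · simp
  have hS0 := hS (pow_ne_zero _ ha)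
  rcases le_total (b * S) (c * a) with h | h
  · refine le_trans ?_ le_self_add
    have hb : b ≤ c * a / S := (ENNReal.le_div_iff_mul_le (Or.inl hS0) (Or.inl hS')).2 h
    calc a * b ≤ a * (c * a / S) := by gcongr
      _ = _ := by simp only [div_eq_mul_inv]; ring
  · refine le_trans ?_ le_add_self
    have ha : a ≤ c⁻¹ * (b * S) := by
      rw [mul_comm, ← div_eq_mul_inv]
      exact (ENNReal.le_div_iff_mul_le (Or.inl hc) (Or.inl hc')).2 (by rwa [mul_comm])
    calc a * b ≤ c⁻¹ * (b * S) * b := by gcongr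
      _ = _ := by ring

/-- Insert √V⁻¹ √V and R Q = 1 into the trace. The left side does not involve V, so the bound may be
averaged over V = W(x) with x in any part of the cube. -/
lemma enorm_trace_mul_conjTranspose_le {V R Q : Mat n} (hV : V.PosDef) (hRQ : R * Q = 1)
    (hQ : Qᴴ = Q) (A Z : Mat n) :
    ‖(A * Zᴴ).trace‖ₑ ≤ n * (‖CFC.sqrt V⁻¹ * (A * R)‖ₑ * ‖CFC.sqrt V * (Z * Q)‖ₑ) := by
  have h : (A * Zᴴ).trace = (CFC.sqrt V⁻¹ * (A * R) * (CFC.sqrt V * (Z * Q))ᴴ).trace := by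
    rw [Matrix.conjTranspose_mul, Matrix.conjTranspose_mul, hQ, sqrt_isHermitian,
      ← hV.posSemidef.inv_sqrt]
    have : (CFC.sqrt V)⁻¹ * (A * R) * (Q * Zᴴ * CFC.sqrt V) =
        (CFC.sqrt V)⁻¹ * (A * (R * Q) * Zᴴ * CFC.sqrt V) := by simp only [Matrix.mul_assoc]
    rw [this, hRQ, Matrix.mul_one, Matrix.trace_mul_comm (CFC.sqrt V)⁻¹, Matrix.mul_assoc (A * Zᴴ),
      sqrt_mul_inv hV, Matrix.mul_one]
  rw [h]
  have h1 := norm_trace_le (CFC.sqrt V⁻¹ * (A * R) * (CFC.sqrt V * (Z * Q))ᴴ)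
  have h2 : ‖CFC.sqrt V⁻¹ * (A * R) * (CFC.sqrt V * (Z * Q))ᴴ‖ ≤
      ‖CFC.sqrt V⁻¹ * (A * R)‖ * ‖CFC.sqrt V * (Z * Q)‖ :=
    (norm_mul_le _ _).trans_eq (by rw [Matrix.l2_opNorm_conjTranspose])
  rw [← ofReal_norm, ← ofReal_norm, ← ofReal_norm, ← ENNReal.ofReal_natCast,
    ← ENNReal.ofReal_mul (norm_nonneg _), ← ENNReal.ofReal_mul (Nat.cast_nonneg n)]
  exact ENNReal.ofReal_le_ofReal (h1.trans (by gcongr))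

/-- The duality inequality between square functions and Carleson sequences. -/
lemma sum_enorm_trace_le [NeZero d] (D : DyadicGrid d) (W U : A2Weight d n)
    (A Z : HaarIdx D → Mat n) {c : ℝ≥0∞} (hc : c ≠ 0) (hc' : c ≠ ∞)
    (hZ : ∀ J ∈ D.cubes, ∑' p : {p : HaarIdx D // p.1.1.pts ⊆ J.pts},
      ‖redCoeff D W.fn U.fn Z p.1‖ₑ ^ 2 ≤ c ^ 2 * volume J.pts)
    (F : Finset (HaarIdx D)) :
    ∑ p ∈ F, ‖(A p * (Z p)ᴴ).trace‖ₑ ≤ 2 * n * (1 + 2 * n) * c *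
      ∫⁻ x, sqFun D (fun y => (W.fn y)⁻¹) (haarMul D U.fn A) x := by
  classical
  set S := sqFun D (fun y => (W.fn y)⁻¹) (haarMul D U.fn A)
  rcases Nat.eq_zero_or_pos n with rfl | hn
  · simp [Matrix.trace]
  have hn0 : (n : ℝ≥0∞) ≠ 0 := by simp; omega
  by_cases htop : ∫⁻ x, S x = ∞
  · rw [htop, ENNReal.mul_top]
    · exact le_top
    · exact mul_ne_zero (mul_ne_zero (mul_ne_zero two_ne_zero hn0) (by simp)) hc
  have hSm : AEMeasurable S volume := aemeasurable_sqFun D W _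
  set S' := hSm.mk S
  have hS'm : Measurable S' := hSm.measurable_mk
  have hSS' : S =ᵐ[volume] S' := hSm.ae_eq_mk
  have hSfin : ∀ᵐ x, S' x < ∞ := by
    filter_upwards [ae_lt_top' hSm htop, hSS'] with x hx hx'
    rwa [← hx']
  -- The weight S is replaced on each cube by its median: it is large enough to dominate S on half
  -- of the cube, and small enough to be seen by the layer-cake argument.
  have hmed := fun p : HaarIdx D =>
    exists_median (volume_pts_ne_top p.1.1) hS'm (μ := volume)
  choose m hm1 hm2 using hmed
  set a : HaarIdx D → Pt d → ℝ≥0∞ := fun p x =>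
    p.1.1.pts.indicator (fun y => ‖CFC.sqrt (W.fn y)⁻¹ * haarMul D U.fn A p‖ₑ ^ 2 /
      volume p.1.1.pts) x
  have hSsq : ∀ x, S x ^ 2 = ∑' p, a p x := fun x => by
    simp only [S, sqFun]
    rw [← ENNReal.rpow_natCast, ← ENNReal.rpow_mul]
    norm_num [a]
  have ham : ∀ p, AEMeasurable (a p) volume := fun p => by
    refine AEMeasurable.indicator (AEMeasurable.div_const ?_ _) (measurableSet_pts _)
    refine AEMeasurable.pow_const (AEStronglyMeasurable.enorm ?_) _
    exact (continuous_id.matrix_mul continuous_const).comp_aestronglyMeasurable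
      (W.aestronglyMeasurable_inv.matrix_sqrt W.inv_posSemidef)
  have hmain : ∀ p, ‖(A p * (Z p)ᴴ).trace‖ₑ ≤
      2 * n * (c * ∫⁻ x, a p x / S' x) +
        2 * n * (c⁻¹ * (n * (m p * ‖redCoeff D W.fn U.fn Z p‖ₑ ^ 2))) := by
    intro p
    set I := p.1.1
    set Q := (CFC.sqrt (avg I U.fn))⁻¹
    have hRQ : CFC.sqrt (avg I U.fn) * Q = 1 := sqrt_mul_inv (U.avg_posDef I)
    have hQ : Qᴴ = Q := by rw [Matrix.conjTranspose_nonsing_inv, sqrt_isHermitian]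
    -- The pointwise bound is averaged over E only. The factor 2 comes from |I| ≤ 2|E|, one n from
    -- the trace bound, and the extra n from the L² bound for W^{1/2} Z Q on I.
    set E := I.pts ∩ {x | S' x ≤ m p}
    have hE : MeasurableSet E :=
      (measurableSet_pts I).inter (measurableSet_le hS'm measurable_const)
    have hI0 := volume_pts_ne_zero I
    have hI1 := volume_pts_ne_top I
    have hpt : ∀ᵐ x ∂volume.restrict E, ‖(A p * (Z p)ᴴ).trace‖ₑ ≤
        n * (volume I.pts * (c * (a p x / S' x)) +
          c⁻¹ * m p * ‖CFC.sqrt (W.fn x) * (Z p * Q)‖ₑ ^ 2) := by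
      filter_upwards [ae_restrict_of_ae W.posDef, ae_restrict_of_ae hSS', ae_restrict_of_ae hSfin,
        ae_restrict_mem hE] with x hW hSx hfx hxE
      refine (enorm_trace_mul_conjTranspose_le hW hRQ hQ (A p) (Z p)).trans ?_
      gcongr
      have hax : a p x = ‖CFC.sqrt (W.fn x)⁻¹ * (A p * CFC.sqrt (avg I U.fn))‖ₑ ^ 2 /
          volume I.pts := by
        simp only [a]
        rw [Set.indicator_of_mem hxE.1]; rfl
      have hav : volume I.pts * a p x =
          ‖CFC.sqrt (W.fn x)⁻¹ * (A p * CFC.sqrt (avg I U.fn))‖ₑ ^ 2 := by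
        rw [hax, ENNReal.mul_div_cancel hI0 hI1]
      refine (mul_le_add_div_mul hc hc' (S := S' x) ?_ hfx.ne).trans ?_
      · intro hne hz
        rw [← hSx] at hz
        have h0 : ∑' p, a p x = 0 := by rw [← hSsq, hz]; simp
        rw [← hav, ENNReal.tsum_eq_zero.1 h0 p, mul_zero] at hne
        exact hne rfl
      · refine add_le_add (le_of_eq ?_) ?_
        · rw [← hav]; simp only [div_eq_mul_inv]; ring
        · rw [mul_assoc, mul_comm (m p)]
          gcongr
          exact hxE.2
    have h1 : volume I.pts * ‖(A p * (Z p)ᴴ).trace‖ₑ ≤ volume I.pts *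
        (2 * n * (c * ∫⁻ x, a p x / S' x) +
        2 * n * (c⁻¹ * (n * (m p * ‖redCoeff D W.fn U.fn Z p‖ₑ ^ 2)))) := by
      calc volume I.pts * ‖(A p * (Z p)ᴴ).trace‖ₑ
          ≤ 2 * volume E * ‖(A p * (Z p)ᴴ).trace‖ₑ := by gcongr; exact hm2 p
        _ = 2 * ∫⁻ _x in E, ‖(A p * (Z p)ᴴ).trace‖ₑ := by
            rw [setLIntegral_const]; ring
        _ ≤ 2 * ∫⁻ x in E, n * (volume I.pts * (c * (a p x / S' x)) +
              c⁻¹ * m p * ‖CFC.sqrt (W.fn x) * (Z p * Q)‖ₑ ^ 2) := by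
            gcongr 2 * ?_
            exact lintegral_mono_ae hpt
        _ = 2 * (n * ((∫⁻ x in E, volume I.pts * (c * (a p x / S' x))) +
              ∫⁻ x in E, c⁻¹ * m p * ‖CFC.sqrt (W.fn x) * (Z p * Q)‖ₑ ^ 2)) := by
            rw [lintegral_const_mul' _ _ (ENNReal.natCast_ne_top n), lintegral_add_left']
            exact (((ham p).div hS'm.aemeasurable).const_mul _).const_mul _ |>.restrict
        _ ≤ 2 * (n * (volume I.pts * (c * ∫⁻ x, a p x / S' x) +
              c⁻¹ * m p * (volume I.pts * (n * ‖redCoeff D W.fn U.fn Z p‖ₑ ^ 2)))) := by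
            gcongr
            · rw [lintegral_const_mul' _ _ hI1, lintegral_const_mul' _ _ hc']
              gcongr
              exact Measure.restrict_le_self
            · rw [lintegral_const_mul'' _ ?_]
              · gcongr
                refine (lintegral_mono_set Set.inter_subset_left).trans
                  ((W.lintegral_sq_enorm_sqrt_mul_le I _).trans_eq ?_)
                rw [redCoeff, Matrix.mul_assoc]
              · refine AEMeasurable.pow_const (AEStronglyMeasurable.enorm ?_) _
                exact (continuous_id.matrix_mul continuous_const).comp_aestronglyMeasurable
                  (W.aestronglyMeasurable.matrix_sqrt W.posSemidef) |>.restrict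
        _ = _ := by ring
    exact (ENNReal.mul_le_mul_iff_right hI0 hI1).1 h1
  -- The terms a_p add up to at most S², so dividing by S leaves S.
  have hA : ∑ p ∈ F, ∫⁻ x, a p x / S' x ≤ ∫⁻ x, S x := by
    have hd : ∀ p, AEMeasurable (fun x => a p x / S' x) volume :=
      fun p => (ham p).div hS'm.aemeasurable
    rw [← lintegral_finsetSum' _ fun p _ => hd p]
    refine lintegral_mono_ae ?_
    filter_upwards [hSS'] with x hx
    simp only [div_eq_mul_inv]
    rw [← Finset.sum_mul, ← hx]
    calc (∑ p ∈ F, a p x) * (S x)⁻¹ ≤ S x ^ 2 * (S x)⁻¹ := by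
          rw [hSsq]; gcongr; exact ENNReal.sum_le_tsum F
      _ = S x * (S x * (S x)⁻¹) := by ring
      _ ≤ S x * 1 := by gcongr; exact ENNReal.mul_inv_le_one _
      _ = S x := mul_one _
  have hB : ∑ p ∈ F, m p * ‖redCoeff D W.fn U.fn Z p‖ₑ ^ 2 ≤ 2 * c ^ 2 * ∫⁻ x, S x := by
    rw [lintegral_congr_ae hSS']
    exact sum_median_mul_le_of_carleson hZ F hS'm hSfin hm1
  calc ∑ p ∈ F, ‖(A p * (Z p)ᴴ).trace‖ₑ
      ≤ ∑ p ∈ F, (2 * n * (c * ∫⁻ x, a p x / S' x) +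
        2 * n * (c⁻¹ * (n * (m p * ‖redCoeff D W.fn U.fn Z p‖ₑ ^ 2)))) :=
        Finset.sum_le_sum fun p _ => hmain p
    _ = 2 * n * (c * ∑ p ∈ F, ∫⁻ x, a p x / S' x) +
        2 * n * (c⁻¹ * (n * ∑ p ∈ F, m p * ‖redCoeff D W.fn U.fn Z p‖ₑ ^ 2)) := by
        rw [Finset.sum_add_distrib]; simp only [Finset.mul_sum]
    _ ≤ 2 * n * (c * ∫⁻ x, S x) + 2 * n * (c⁻¹ * (n * (2 * c ^ 2 * ∫⁻ x, S x))) := by gcongr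
    _ = 2 * n * (c * ∫⁻ x, S x) + 2 * n * (n * (2 * ((c⁻¹ * c) * c) * ∫⁻ x, S x)) := by ring
    _ = _ := by rw [ENNReal.inv_mul_cancel hc hc']; ring

end Duality

/-! ### Finite Haar sums in `H¹` -/

section HaarSums

variable {d n : ℕ} {D : DyadicGrid d} {W U : A2Weight d n}

lemma sq_sqFun (V : Pt d → Mat n) (A : HaarIdx D → Mat n) (x : Pt d) :
    sqFun D V A x ^ 2 = ∑' p : HaarIdx D, p.1.1.pts.indicator
      (fun y => ‖CFC.sqrt (V y) * A p‖ₑ ^ 2 / volume p.1.1.pts) x := by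
  unfold sqFun
  rw [← ENNReal.rpow_natCast, ← ENNReal.rpow_mul]
  norm_num

lemma aemeasurable_enorm_sqrt_inv_mul (W : A2Weight d n) (X : Mat n) :
    AEMeasurable (fun y => ‖CFC.sqrt (W.fn y)⁻¹ * X‖ₑ) volume :=
  AEStronglyMeasurable.enorm ((continuous_id.matrix_mul continuous_const).comp_aestronglyMeasurable
    (W.aestronglyMeasurable_inv.matrix_sqrt W.inv_posSemidef))

/-- The `H¹` norm of a finite Haar sum localized in a cube `J`. -/
lemma sq_h1Norm_haarPoly_le [NeZero d] (J : Cube d) (F : Finset (HaarIdx D))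
    (hF : ∀ p ∈ F, p.1.1.pts ⊆ J.pts) (A : HaarIdx D → Mat n) :
    h1Norm D W.fn U.fn (haarPoly D F A) ^ 2 ≤ volume J.pts * ∑ p ∈ F, (volume p.1.1.pts)⁻¹ *
      ∫⁻ x in p.1.1.pts, ‖CFC.sqrt (W.fn x)⁻¹ * haarMul D U.fn A p‖ₑ ^ 2 := by
  classical
  set A' := haarMul D U.fn (haarCoeff D (haarPoly D F A))
  set S := sqFun D (fun y => (W.fn y)⁻¹) A'
  have hA' : ∀ p, A' p = if p ∈ F then haarMul D U.fn A p else 0 := fun p => by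
    simp only [A', haarMul, haarCoeff_haarPoly, ite_mul, zero_mul]
  have hS2 : ∀ x, S x ^ 2 = ∑ p ∈ F, p.1.1.pts.indicator
      (fun y => ‖CFC.sqrt (W.fn y)⁻¹ * haarMul D U.fn A p‖ₑ ^ 2 / volume p.1.1.pts) x := by
    intro x
    rw [sq_sqFun, tsum_eq_sum (s := F)]
    · refine Finset.sum_congr rfl fun p hp => ?_
      rw [hA', if_pos hp]
    · intro p hp
      rw [hA', if_neg hp]
      simp
  have hsupp : ∀ x, x ∉ J.pts → S x = 0 := fun x hx => by
    have : S x ^ 2 = 0 := by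
      rw [hS2]
      exact Finset.sum_eq_zero fun p hp => Set.indicator_of_notMem (fun h => hx (hF p hp h)) _
    simpa using this
  have h1 : ∫⁻ x, S x = ∫⁻ x in J.pts, S x := by
    rw [← lintegral_indicator (measurableSet_pts J)]
    refine lintegral_congr fun x => ?_
    by_cases hx : x ∈ J.pts
    · rw [Set.indicator_of_mem hx]
    · rw [Set.indicator_of_notMem hx, hsupp x hx]
  have hm : ∀ p : HaarIdx D, AEMeasurable (p.1.1.pts.indicator
      (fun y => ‖CFC.sqrt (W.fn y)⁻¹ * haarMul D U.fn A p‖ₑ ^ 2 / volume p.1.1.pts))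
      volume := fun p =>
    (((aemeasurable_enorm_sqrt_inv_mul W _).pow_const 2).div_const _).indicator
      (measurableSet_pts _)
  -- The square function vanishes off J, so Cauchy–Schwarz costs only |J|, and its square is
  -- integrated term by term.
  calc h1Norm D W.fn U.fn (haarPoly D F A) ^ 2 = (∫⁻ x in J.pts, S x) ^ 2 := by
        rw [← h1]; rfl
    _ ≤ volume J.pts * ∫⁻ x in J.pts, S x ^ 2 := by
        have := sq_lintegral_le (volume.restrict J.pts) (aemeasurable_sqFun D W A').restrict
        rwa [Measure.restrict_apply_univ] at this
    _ ≤ volume J.pts * ∫⁻ x, S x ^ 2 := by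
        gcongr; exact Measure.restrict_le_self
    _ = _ := by
        simp only [hS2]
        rw [lintegral_finsetSum' _ fun p _ => hm p]
        congr 1
        refine Finset.sum_congr rfl fun p _ => ?_
        rw [lintegral_indicator (measurableSet_pts _)]
        simp only [div_eq_mul_inv]
        rw [lintegral_mul_const' _ _ (ENNReal.inv_ne_top.2 (volume_pts_ne_zero _)), mul_comm]

lemma A2Weight.lintegral_sq_enorm_sqrt_inv_mul_le (W : A2Weight d n) (I : Cube d) (X : Mat n) :
    (volume I.pts)⁻¹ * ∫⁻ x in I.pts, ‖CFC.sqrt (W.fn x)⁻¹ * X‖ₑ ^ 2 ≤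
      ENNReal.ofReal (trForm (avg I fun x => (W.fn x)⁻¹) X) := by
  rw [mul_comm, ← div_eq_mul_inv]
  refine ENNReal.div_le_of_le_mul' ?_
  rw [← lintegral_trForm I (W.integrableOn_inv I) W.inv_posSemidef]
  exact lintegral_mono_ae ((ae_restrict_of_ae W.inv_posSemidef).mono
    fun x hx => enorm_sq_sqrt_mul_le hx X)

-- For a single Haar function the square function is in L² of its cube because m_I W⁻¹ is finite;
-- finite sums follow since H¹ is a subspace.
variable (D W U) in
lemma haarPoly_mem_h1 [NeZero d] (F : Finset (HaarIdx D)) (A : HaarIdx D → Mat n) :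
    haarPoly D F A ∈ h1Submodule D W U := by
  classical
  have h1 : ∀ p, haarPoly D {p} A ∈ h1Submodule D W U := fun p => by
    refine ⟨(integrable_haarPoly D _ A).locallyIntegrable, ?_⟩
    have h := sq_h1Norm_haarPoly_le (W := W) (U := U) p.1.1 {p}
      (fun q hq => by rw [Finset.mem_singleton.1 hq]) A
    rw [Finset.sum_singleton] at h
    have h2 := h.trans (mul_le_mul_right (W.lintegral_sq_enorm_sqrt_inv_mul_le p.1.1 _) _)
    have h3 : h1Norm D W.fn U.fn (haarPoly D {p} A) ^ 2 < ∞ :=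
      h2.trans_lt (ENNReal.mul_lt_top (volume_pts_ne_top _).lt_top ENNReal.ofReal_lt_top)
    by_contra hc
    rw [not_lt, top_le_iff] at hc
    rw [hc] at h3
    simp at h3
  have h2 : haarPoly D F A = ∑ p ∈ F, haarPoly D {p} A := by
    funext x; simp [haarPoly]
  rw [h2]
  exact Submodule.sum_mem _ fun p _ => h1 p

namespace H1

lemma fn_injective : Function.Injective (fn : H1 D W U → Pt d → Mat n) := Subtype.val_injective

lemma fn_add (Φ Ψ : H1 D W U) : (Φ + Ψ).fn = Φ.fn + Ψ.fn := rfl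

lemma fn_sub (Φ Ψ : H1 D W U) : (Φ - Ψ).fn = Φ.fn - Ψ.fn := rfl

lemma fn_smul (c : ℂ) (Φ : H1 D W U) : (c • Φ).fn = c • Φ.fn := rfl

lemma locallyIntegrable (Φ : H1 D W U) : LocallyIntegrable Φ.fn volume := Φ.2.1

lemma h1Norm_lt_top (Φ : H1 D W U) : h1Norm D W.fn U.fn Φ.fn < ∞ := Φ.2.2

lemma norm_eq (Φ : H1 D W U) : ‖Φ‖ = (h1Norm D W.fn U.fn Φ.fn).toReal := rfl

/-- Finite Haar sums as elements of `H¹`, linearly in the coefficients. -/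
def poly [NeZero d] (F : Finset (HaarIdx D)) : (HaarIdx D → Mat n) →ₗ[ℂ] H1 D W U where
  toFun A := (⟨haarPoly D F A, haarPoly_mem_h1 D W U F A⟩ : h1Submodule D W U)
  map_add' A B := fn_injective (by
    funext x
    change haarPoly D F (A + B) x = haarPoly D F A x + haarPoly D F B x
    simp [haarPoly, Finset.sum_add_distrib])
  map_smul' c A := fn_injective (by
    funext x
    change haarPoly D F (c • A) x = c • haarPoly D F A x
    simp only [haarPoly, Finset.smul_sum]
    exact Finset.sum_congr rfl fun p _ => smul_comm (haar p.1.1 p.2.1 x) c (A p))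

lemma fn_poly [NeZero d] (F : Finset (HaarIdx D)) (A : HaarIdx D → Mat n) :
    (poly F A : H1 D W U).fn = haarPoly D F A := rfl

lemma poly_insert [NeZero d] [DecidableEq (HaarIdx D)] {F : Finset (HaarIdx D)} {p : HaarIdx D}
    (hp : p ∉ F) (A : HaarIdx D → Mat n) :
    (poly (insert p F) A : H1 D W U) = poly {p} A + poly F A := fn_injective (by
  funext x
  change haarPoly D (insert p F) A x = haarPoly D {p} A x + haarPoly D F A x
  simp [haarPoly, Finset.sum_insert hp])

lemma poly_singleton_congr [NeZero d] (p : HaarIdx D) {A B : HaarIdx D → Mat n}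
    (h : A p = B p) : (poly {p} A : H1 D W U) = poly {p} B := fn_injective (by
  funext x
  change haarPoly D {p} A x = haarPoly D {p} B x
  simp [haarPoly, h])

lemma poly_empty [NeZero d] (A : HaarIdx D → Mat n) : (poly ∅ A : H1 D W U) = 0 :=
  fn_injective (by funext x; change haarPoly D ∅ A x = 0; simp [haarPoly])

/-- Every element of `H¹` is the limit of the partial sums of its Haar series. -/
lemma tendsto_poly_haarCoeff [NeZero d] (Φ : H1 D W U) :
    Filter.Tendsto (fun F : Finset (HaarIdx D) => (poly F (haarCoeff D Φ.fn) : H1 D W U))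
      Filter.atTop (nhds Φ) := by
  classical
  rw [tendsto_iff_norm_sub_tendsto_zero]
  simp only [norm_eq]
  rw [← ENNReal.toReal_zero]
  refine (ENNReal.tendsto_toReal ENNReal.zero_ne_top).comp ?_
  set C := haarCoeff D Φ.fn
  set T : (HaarIdx D → Mat n) → Pt d → ℝ≥0∞ :=
    fun A => sqFun D (fun y => (W.fn y)⁻¹) (haarMul D U.fn A)
  -- The difference has coefficients only outside F, so its square function is the ℓ² tail of that
  -- of Φ: it tends to zero wherever the latter is finite and is dominated by it.
  have hcoef : ∀ F : Finset (HaarIdx D), haarCoeff D ((poly F C - Φ : H1 D W U).fn) =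
      fun p => if p ∈ F then 0 else -C p := by
    intro F
    have h0 : (poly F C - Φ : H1 D W U).fn = haarPoly D F C + (-1 : ℂ) • Φ.fn := by
      rw [fn_sub, fn_poly, neg_one_smul, sub_eq_add_neg]
    rw [h0, haarCoeff_add D (integrable_haarPoly D F C).locallyIntegrable
      (Φ.locallyIntegrable.smul _), haarCoeff_smul]
    funext p
    rw [Pi.add_apply, haarCoeff_haarPoly]
    split_ifs <;> simp [C]
  set a : HaarIdx D → Pt d → ℝ≥0∞ := fun p x => p.1.1.pts.indicator
    (fun y => ‖CFC.sqrt (W.fn y)⁻¹ * haarMul D U.fn C p‖ₑ ^ 2 / volume p.1.1.pts) x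
  have hT : ∀ F x, T (haarCoeff D ((poly F C - Φ : H1 D W U).fn)) x =
      (∑' p : {p // p ∉ F}, a p x) ^ (1 / 2 : ℝ) := by
    intro F x
    simp only [T, sqFun]
    congr 1
    refine Eq.trans ?_ (tsum_subtype {p | p ∉ F} fun p => a p x).symm
    refine tsum_congr fun p => ?_
    simp only [Set.indicator_apply, Set.mem_ofPred_eq, hcoef, haarMul, a]
    split_ifs <;> simp_all
  have hTC : ∀ x, T C x = (∑' p, a p x) ^ (1 / 2 : ℝ) := fun x => rfl
  have hfin : ∀ᵐ x, T C x < ∞ := ae_lt_top' (aemeasurable_sqFun D W _) Φ.h1Norm_lt_top.ne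
  change Filter.Tendsto (fun F : Finset (HaarIdx D) =>
    ∫⁻ x, T (haarCoeff D ((poly F C - Φ : H1 D W U).fn)) x) Filter.atTop (nhds 0)
  rw [← lintegral_zero (μ := (volume : Measure (Pt d)))]
  refine tendsto_lintegral_filter_of_dominated_convergence' (T C)
    (Filter.Eventually.of_forall fun F => aemeasurable_sqFun D W _)
    (Filter.Eventually.of_forall fun F => Filter.Eventually.of_forall fun x => ?_)
    Φ.h1Norm_lt_top.ne ?_
  · rw [hT, hTC]
    refine ENNReal.rpow_le_rpow ?_ (by norm_num)
    exact ENNReal.tsum_comp_le_tsum_of_injective Subtype.val_injective fun p => a p x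
  · filter_upwards [hfin] with x hx
    simp only [hT]
    have h1 : ∑' p, a p x ≠ ∞ := by
      intro h
      rw [hTC, h, ENNReal.top_rpow_of_pos (by norm_num)] at hx
      exact lt_irrefl _ hx
    have h2 := (ENNReal.tendsto_tsum_compl_atTop_zero h1).ennrpow_const (1 / 2 : ℝ)
    simpa using h2

end H1

/-- Any linear functional on matrices is of the form `A ↦ tr (A Z*)`. -/
lemma exists_trace_mul_conjTranspose (f : Mat n →ₗ[ℂ] ℂ) :
    ∃ Z : Mat n, ∀ A, f A = (A * Zᴴ).trace := by
  refine ⟨Matrix.of fun i j => star (f (Matrix.single i j 1)), fun A => ?_⟩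
  conv_lhs => rw [Matrix.matrix_eq_sum_single A]
  simp only [map_sum, Matrix.trace, Matrix.diag, Matrix.mul_apply, Matrix.conjTranspose_apply,
    Matrix.of_apply, star_star]
  refine Finset.sum_congr rfl fun i _ => Finset.sum_congr rfl fun j _ => ?_
  rw [show Matrix.single i j (A i j) = A i j • Matrix.single i j (1 : ℂ) by simp, map_smul,
    smul_eq_mul]

lemma eq_of_trace_mul_conjTranspose {Z Z' : Mat n}
    (h : ∀ A : Mat n, (A * Zᴴ).trace = (A * Z'ᴴ).trace) : Z = Z' := by
  have h1 := h (Z - Z')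
  have h2 := trace_conjTranspose_mul_self (Z - Z')ᴴ
  rw [Matrix.conjTranspose_conjTranspose, Matrix.conjTranspose_sub, Matrix.mul_sub,
    Matrix.trace_sub, h1, sub_self, ← Matrix.conjTranspose_sub, hs_conjTranspose] at h2
  have h3 : hs (Z - Z') = 0 := by exact_mod_cast h2.symm
  have h4 := sq_norm_le_hs (Z - Z')
  rw [h3] at h4
  exact sub_eq_zero.1 (norm_eq_zero.1 (pow_eq_zero_iff two_ne_zero |>.1 (le_antisymm h4
    (sq_nonneg _))))

/-- The Haar coefficients attached to a bounded functional on `H¹`. -/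
lemma exists_coeff_of_functional [NeZero d] (l : StrongDual ℂ (H1 D W U)) :
    ∃ Z : HaarIdx D → Mat n, ∀ (F : Finset (HaarIdx D)) (A : HaarIdx D → Mat n),
      l (H1.poly F A) = ∑ p ∈ F, (A p * (Z p)ᴴ).trace := by
  classical
  have h : ∀ p : HaarIdx D, ∃ Z : Mat n, ∀ A : Mat n,
      l (H1.poly {p} fun _ => A) = (A * Zᴴ).trace := fun p =>
    exists_trace_mul_conjTranspose ((l.toLinearMap.comp (H1.poly {p})).comp
      (LinearMap.pi fun _ => LinearMap.id))
  choose Z hZ using h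
  refine ⟨Z, fun F A => ?_⟩
  induction F using Finset.induction_on with
  | empty => rw [H1.poly_empty]; simp
  | insert p F hp ih =>
    rw [H1.poly_insert hp, map_add, ih, Finset.sum_insert hp, ← hZ,
      H1.poly_singleton_congr p (B := fun _ => A p) rfl]

lemma hasSum_of_coeff [NeZero d] (l : StrongDual ℂ (H1 D W U)) {Z : HaarIdx D → Mat n}
    (hZ : ∀ (F : Finset (HaarIdx D)) (A : HaarIdx D → Mat n),
      l (H1.poly F A) = ∑ p ∈ F, (A p * (Z p)ᴴ).trace) (Φ : H1 D W U) :
    HasSum (fun p => (haarCoeff D Φ.fn p * (Z p)ᴴ).trace) (l Φ) := by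
  have := (l.continuous.tendsto Φ).comp (H1.tendsto_poly_haarCoeff Φ)
  simp only [Function.comp_def, hZ] at this
  exact this

/-- The coefficients of a bounded functional satisfy the Carleson condition. -/
lemma carleson_of_functional [NeZero d] (l : StrongDual ℂ (H1 D W U)) {Z : HaarIdx D → Mat n}
    (hZ : ∀ (F : Finset (HaarIdx D)) (A : HaarIdx D → Mat n),
      l (H1.poly F A) = ∑ p ∈ F, (A p * (Z p)ᴴ).trace) (J : Cube d) :
    ∑' p : {p : HaarIdx D // p.1.1.pts ⊆ J.pts}, ‖redCoeff D W.fn U.fn Z p.1‖ₑ ^ 2 ≤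
      ENNReal.ofReal (n * (a2Char W.fn).toReal * ‖l‖ ^ 2) * volume J.pts := by
  classical
  rw [ENNReal.tsum_eq_iSup_sum]
  refine iSup_le fun F' => ?_
  set F : Finset (HaarIdx D) := F'.map (Function.Embedding.subtype _)
  have hF : ∀ p ∈ F, p.1.1.pts ⊆ J.pts := fun p hp => by
    obtain ⟨q, -, rfl⟩ := Finset.mem_map.1 hp
    exact q.2
  have hsum : ∑ p ∈ F', ‖redCoeff D W.fn U.fn Z p.1‖ₑ ^ 2 =
      ∑ p ∈ F, ‖redCoeff D W.fn U.fn Z p‖ₑ ^ 2 :=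
    (Finset.sum_map F' (Function.Embedding.subtype _)
      fun p => ‖redCoeff D W.fn U.fn Z p‖ₑ ^ 2).symm
  rw [hsum]
  set X := redCoeff D W.fn U.fn Z
  set a := (a2Char W.fn).toReal
  -- The test function is chosen so that l returns Σ hs (X_p), while multiplication by (m_I U)^{1/2}
  -- leaves only (m_I W)^{1/2} X_p, whose W⁻¹ energy costs n a.
  set A : HaarIdx D → Mat n := fun p =>
    CFC.sqrt (avg p.1.1 W.fn) * X p * (CFC.sqrt (avg p.1.1 U.fn))⁻¹
  set s := ∑ p ∈ F, hs (X p)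
  have hs0 : 0 ≤ s := Finset.sum_nonneg fun p _ => hs_nonneg _
  have hl : l (H1.poly F A) = (s : ℂ) := by
    rw [hZ]
    push_cast [s]
    refine Finset.sum_congr rfl fun p _ => ?_
    rw [← hs_conjTranspose, ← trace_conjTranspose_mul_self, Matrix.conjTranspose_conjTranspose]
    have : (X p)ᴴ = (CFC.sqrt (avg p.1.1 U.fn))⁻¹ * (Z p)ᴴ * CFC.sqrt (avg p.1.1 W.fn) := by
      simp only [X, redCoeff, Matrix.conjTranspose_mul, Matrix.conjTranspose_nonsing_inv,
        sqrt_isHermitian, Matrix.mul_assoc]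
    rw [this]
    simp only [A]
    rw [Matrix.mul_assoc, Matrix.mul_assoc, Matrix.trace_mul_comm]
    simp only [Matrix.mul_assoc]
  have hmul : ∀ p, haarMul D U.fn A p = CFC.sqrt (avg p.1.1 W.fn) * X p := fun p => by
    simp only [haarMul, A]
    rw [Matrix.mul_assoc, sqrt_inv_mul (U.avg_posDef _), Matrix.mul_one]
  have hnorm : ‖(H1.poly F A : H1 D W U)‖ ^ 2 ≤ volume.real J.pts * (n * a * s) := by
    have h1 := sq_h1Norm_haarPoly_le (W := W) (U := U) J F hF A
    have h2 : ∑ p ∈ F, (volume p.1.1.pts)⁻¹ *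
        ∫⁻ x in p.1.1.pts, ‖CFC.sqrt (W.fn x)⁻¹ * haarMul D U.fn A p‖ₑ ^ 2 ≤
        ENNReal.ofReal (n * a * s) := by
      rw [Finset.mul_sum, ENNReal.ofReal_sum_of_nonneg fun p _ =>
        mul_nonneg (by positivity) (hs_nonneg _)]
      refine Finset.sum_le_sum fun p _ => ?_
      refine (W.lintegral_sq_enorm_sqrt_inv_mul_le p.1.1 _).trans (ENNReal.ofReal_le_ofReal ?_)
      rw [hmul]
      refine (trForm_le (W.avg_inv_posDef p.1.1).posSemidef _ _).trans ?_
      exact mul_le_mul (trForm_avg_inv_sqrt_le_toReal W p.1.1) (sq_norm_le_hs _) (sq_nonneg _)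
        (by positivity)
    have h3 := h1.trans (mul_le_mul_right h2 _)
    rw [← ofReal_volumeReal_pts, ← ENNReal.ofReal_mul (volumeReal_pts_pos J).le] at h3
    have h4 := ENNReal.toReal_mono ENNReal.ofReal_ne_top h3
    rwa [ENNReal.toReal_pow, ENNReal.toReal_ofReal
      (mul_nonneg (volumeReal_pts_pos J).le (by positivity))] at h4
  have hls : s ≤ ‖l‖ * ‖(H1.poly F A : H1 D W U)‖ := by
    have := l.le_opNorm (H1.poly F A)
    rwa [hl, Complex.norm_real, Real.norm_of_nonneg hs0] at this
  -- Squaring s ≤ ‖l‖ ‖Φ‖ and inserting ‖Φ‖² ≤ |J| n a s allows one factor s to be cancelled.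
  have hfinal : s ≤ n * a * ‖l‖ ^ 2 * volume.real J.pts := by
    rcases hs0.eq_or_lt with h0 | h0
    · rw [← h0]
      have := (volumeReal_pts_pos J).le
      have : 0 ≤ a := ENNReal.toReal_nonneg
      positivity
    · have h1 : s ^ 2 ≤ ‖l‖ ^ 2 * (volume.real J.pts * (n * a * s)) := by
        calc s ^ 2 ≤ (‖l‖ * ‖(H1.poly F A : H1 D W U)‖) ^ 2 := by gcongr
          _ = ‖l‖ ^ 2 * ‖(H1.poly F A : H1 D W U)‖ ^ 2 := by ring
          _ ≤ _ := by gcongr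
      refine le_of_mul_le_mul_right ?_ h0
      calc s * s = s ^ 2 := by ring
        _ ≤ _ := h1
        _ = _ := by ring
  rw [← ofReal_volumeReal_pts, ← ENNReal.ofReal_mul
    (mul_nonneg (mul_nonneg (Nat.cast_nonneg n) ENNReal.toReal_nonneg) (sq_nonneg _))]
  refine le_trans ?_ (ENNReal.ofReal_le_ofReal hfinal)
  rw [ENNReal.ofReal_sum_of_nonneg fun p _ => hs_nonneg _]
  refine Finset.sum_le_sum fun p _ => ?_
  rw [enorm_sq]
  exact ENNReal.ofReal_le_ofReal (sq_norm_le_hs _)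

end HaarSums

/-! ### Truncated Haar sums and a weighted John–Nirenberg inequality -/

section JohnNirenberg

variable {d n : ℕ} [NeZero d] {D : DyadicGrid d}

/-- The value of `∑_ε g_I^ε h_I^ε` on the subcube of `I` with label `b`. -/
def blockVal (g : HaarIdx D → Mat n) (I : D.cubes) (b : Fin d → Bool) : Mat n :=
  haarScale I.1 • ∑ e : Sig d, sgn e.1 b • g (I, e)

/-- The sum of `g_K^ε h_K^ε` over the cubes `K ⊆ I` of the grid with
`|K|^{1/d} > 2^{-N} |I|^{1/d}`. -/
def haarSum (g : HaarIdx D → Mat n) : ℕ → D.cubes → Pt d → Mat n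
  | 0, _ => 0
  | N + 1, I => fun x => ∑ b, (I.1.child b).pts.indicator
      (fun y => blockVal g I b + haarSum g N (DyadicGrid.child I b) y) x

omit [NeZero d] in
lemma Cube.sum_indicator_child (I : Cube d) {M : Type*} [AddCommMonoid M]
    (f : (Fin d → Bool) → Pt d → M) {b : Fin d → Bool} {x : Pt d} (hx : x ∈ (I.child b).pts) :
    ∑ b, (I.child b).pts.indicator (f b) x = f b x := by
  rw [Finset.sum_eq_single b, Set.indicator_of_mem hx]
  · intro b' _ hb
    refine Set.indicator_of_notMem (fun hx' => hb ?_) _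
    rw [Cube.mem_child_iff] at hx hx'
    exact hx'.2.symm.trans hx.2
  · simp

lemma haarSum_succ_of_mem (g : HaarIdx D → Mat n) (N : ℕ) (I : D.cubes) {b : Fin d → Bool}
    {x : Pt d} (hx : x ∈ (I.1.child b).pts) :
    haarSum g (N + 1) I x = blockVal g I b + haarSum g N (DyadicGrid.child I b) x :=
  I.1.sum_indicator_child _ hx

lemma haarSum_integrable (g : HaarIdx D → Mat n) (N : ℕ) (I : D.cubes) :
    IntegrableOn (haarSum g N I) I.1.pts := by
  induction N generalizing I with
  | zero => exact integrableOn_zero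
  | succ N ih =>
    refine integrable_finsetSum _ fun b _ => ?_
    rw [integrable_indicator_iff (measurableSet_pts _), IntegrableOn,
      Measure.restrict_restrict (measurableSet_pts _),
      Set.inter_eq_left.2 (I.1.child_subset b)]
    exact (integrableOn_const (volume_pts_ne_top _)).add (ih (DyadicGrid.child I b))

lemma haarSum_aestronglyMeasurable (g : HaarIdx D → Mat n) (N : ℕ) (I : D.cubes) :
    AEStronglyMeasurable (haarSum g N I) (volume.restrict I.1.pts) := (haarSum_integrable g N I).1

omit [NeZero d] in
/-- Parseval's identity for the values of a block. -/
lemma sum_hs_add_blockVal (g : HaarIdx D → Mat n) (I : D.cubes) (c : Mat n) :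
    ∑ b, volume.real (I.1.child b).pts * hs (c + blockVal g I b) =
      volume.real I.1.pts * hs c + ∑ e : Sig d, hs (g (I, e)) := by
  have hscal : ∀ z : (Fin d → Fin 2) → ℂ,
      ∑ b, ‖∑ e, sgn e b • z e‖ ^ 2 = 2 ^ d * ∑ e, ‖z e‖ ^ 2 := by
    have key : ∀ {E : Type} [NormedAddCommGroup E] [InnerProductSpace ℝ E]
        (z : (Fin d → Fin 2) → E),
        ∑ b, ‖∑ e, sgn e b • z e‖ ^ 2 = 2 ^ d * ∑ e, ‖z e‖ ^ 2 := by
      intro E _ _ z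
      have h1 : ∀ b, ‖∑ e, sgn e b • z e‖ ^ 2 =
          ∑ e, ∑ e', sgn e b * sgn e' b * inner ℝ (z e) (z e') := by
        intro b
        rw [← real_inner_self_eq_norm_sq, sum_inner]
        refine Finset.sum_congr rfl fun e _ => ?_
        rw [inner_sum]
        refine Finset.sum_congr rfl fun e' _ => ?_
        rw [real_inner_smul_left, real_inner_smul_right, mul_assoc]
      simp only [h1]
      rw [Finset.sum_comm, Finset.mul_sum]
      refine Finset.sum_congr rfl fun e _ => ?_
      rw [Finset.sum_comm]
      simp only [← Finset.sum_mul, sum_sgn_mul_sgn']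
      simp
    exact fun z => key z
  have hmat : ∀ z : (Fin d → Fin 2) → Mat n,
      ∑ b, hs (∑ e, sgn e b • z e) = 2 ^ d * ∑ e, hs (z e) := by
    intro z
    unfold hs
    rw [Finset.sum_comm, Finset.sum_comm (γ := Fin d → Fin 2), Finset.mul_sum]
    refine Finset.sum_congr rfl fun i _ => ?_
    rw [Finset.sum_comm, Finset.sum_comm (γ := Fin d → Fin 2), Finset.mul_sum]
    refine Finset.sum_congr rfl fun j _ => ?_
    rw [← hscal]
    simp [Matrix.sum_apply]
  classical
  -- The constant c takes the slot of the excluded signature (1, …, 1), so the full orthogonality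
  -- relation applies.
  have h := hmat fun e => if he : e ≠ fun _ => 1 then haarScale I.1 • g (I, ⟨e, he⟩) else c
  simp only [sum_univ_eq_sum_sig_add] at h
  have e1 : ∀ e : Sig d, (if he : e.1 ≠ fun _ => 1 then haarScale I.1 • g (I, ⟨e.1, he⟩) else c) =
      haarScale I.1 • g (I, e) := fun e => dif_pos e.2
  simp only [e1, ne_eq, not_true_eq_false, dite_false, sgn_one, one_smul, hs_real_smul] at h
  have hv : ∀ b, volume.real (I.1.child b).pts = volume.real I.1.pts / 2 ^ d := fun b => by
    rw [← I.1.volumeReal_child b]; field_simp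
  have hb : ∀ b, c + blockVal g I b = ∑ e : Sig d, sgn e.1 b • haarScale I.1 • g (I, e) + c := by
    intro b
    rw [blockVal, Finset.smul_sum, add_comm]
    congr 1
    exact Finset.sum_congr rfl fun e _ => smul_comm _ _ _
  simp only [hv, hb]
  rw [← Finset.mul_sum, h, ← Finset.mul_sum, haarScale_sq]
  have := (volumeReal_pts_pos I.1).ne'
  field_simp
  ring

omit [NeZero d] in
lemma sum_ofReal_hs_add_blockVal (g : HaarIdx D → Mat n) (I : D.cubes) (c : Mat n) :
    ∑ b, volume (I.1.child b).pts * ENNReal.ofReal (hs (c + blockVal g I b)) =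
      volume I.1.pts * ENNReal.ofReal (hs c) + ∑ e : Sig d, ENNReal.ofReal (hs (g (I, e))) := by
  have h := congrArg ENNReal.ofReal (sum_hs_add_blockVal g I c)
  rw [ENNReal.ofReal_sum_of_nonneg fun b _ => mul_nonneg (volumeReal_pts_pos _).le (hs_nonneg _),
    ENNReal.ofReal_add (mul_nonneg (volumeReal_pts_pos _).le (hs_nonneg _))
      (Finset.sum_nonneg fun e _ => hs_nonneg _),
    ENNReal.ofReal_sum_of_nonneg fun e _ => hs_nonneg _,
    ENNReal.ofReal_mul (volumeReal_pts_pos _).le, ofReal_volumeReal_pts] at h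
  rw [← h]
  refine Finset.sum_congr rfl fun b _ => ?_
  rw [ENNReal.ofReal_mul (volumeReal_pts_pos _).le, ofReal_volumeReal_pts]

/-- Hölder's inequality for three finite families. -/
lemma sum_rpow_mul_rpow_mul_rpow_le {ι : Type*} [Fintype ι] (x y z : ι → ℝ≥0∞) {η δ : ℝ}
    (hη : 0 ≤ η) (hδ : 0 ≤ δ) (h : 2 * η + δ = 1) :
    ∑ i, x i ^ η * y i ^ η * z i ^ δ ≤ (∑ i, x i) ^ η * (∑ i, y i) ^ η * (∑ i, z i) ^ δ := by
  let _ : MeasurableSpace ι := ⊤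
  have := ENNReal.lintegral_prod_norm_pow_le (μ := (Measure.count : Measure ι))
    (Finset.univ : Finset (Fin 3)) (f := ![x, y, z])
    (fun i _ => (measurable_from_top).aemeasurable) (p := ![η, η, δ])
    (by simp [Fin.sum_univ_three]; linarith) (by intro i _; fin_cases i <;> simpa)
  simpa [Fin.prod_univ_three, lintegral_count, tsum_fintype] using this

/-- The product of the averages of two weights. -/
def avgProd (w u : Pt d → ℝ≥0∞) (I : Cube d) : ℝ≥0∞ :=
  (∫⁻ x in I.pts, w x) / volume I.pts * ((∫⁻ x in I.pts, u x) / volume I.pts)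

/-- The right-hand side of the John–Nirenberg inequality. -/
def jnBound (w u : Pt d → ℝ≥0∞) (A : D.cubes → ℝ≥0∞) (η δ : ℝ) (I : D.cubes) : ℝ≥0∞ :=
  avgProd w u I.1 ^ δ *
    ((∫⁻ x in I.1.pts, w x) ^ η * (∫⁻ x in I.1.pts, u x) ^ η * A I ^ δ)

/-- One generation of the stopping-time argument: below `J`, the sum is split into a part `F`
that is controlled in `L²` and a part that lives on the stopping cubes, whose union is `E`. -/
lemma exists_stopping {g : HaarIdx D → Mat n} {w u : Pt d → ℝ≥0∞} {a A : D.cubes → ℝ≥0∞}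
    {κ K : ℝ≥0∞} {η δ : ℝ} (hη : 0 ≤ η) (hδ : 0 ≤ δ) (hηδ : 2 * η + δ = 1)
    (hg : ∀ I : D.cubes, ∑ e : Sig d, ENNReal.ofReal (hs (g (I, e))) ≤
      κ * avgProd w u I.1 * a I)
    (hA : ∀ I : D.cubes, a I + ∑ b, A (DyadicGrid.child I b) ≤ A I)
    (J : D.cubes) (hwJ : ∫⁻ x in J.1.pts, w x ≠ 0) (hwJ' : ∫⁻ x in J.1.pts, w x ≠ ∞)
    (huJ : ∫⁻ x in J.1.pts, u x ≠ 0) (huJ' : ∫⁻ x in J.1.pts, u x ≠ ∞) (m : ℕ)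
    (hP : ∀ k < m, ∀ I : D.cubes,
      ∫⁻ x in I.1.pts, ‖haarSum g k I x‖ₑ ^ (1 + δ) ≤ K * jnBound w u A η δ I)
    (I : D.cubes)
    (hI : volume J.1.pts / (4 * ∫⁻ x in J.1.pts, w x) * (∫⁻ x in I.1.pts, w x) +
      volume J.1.pts / (4 * ∫⁻ x in J.1.pts, u x) * (∫⁻ x in I.1.pts, u x) ≤ volume I.1.pts) :
    ∃ (E : Set (Pt d)) (F : Pt d → Mat n), MeasurableSet E ∧ E ⊆ I.1.pts ∧
      AEStronglyMeasurable F volume ∧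
      volume E ≤ volume J.1.pts / (4 * ∫⁻ x in J.1.pts, w x) * (∫⁻ x in E, w x) +
        volume J.1.pts / (4 * ∫⁻ x in J.1.pts, u x) * (∫⁻ x in E, u x) ∧
      (∀ c : Mat n, ∫⁻ x in I.1.pts, ENNReal.ofReal (hs (c + F x)) ≤
        volume I.1.pts * ENNReal.ofReal (hs c) + 16 * κ * avgProd w u J.1 * A I) ∧
      ∫⁻ x in I.1.pts, ‖haarSum g m I x - F x‖ₑ ^ (1 + δ) ≤
        K * (4 ^ (d + 2) * avgProd w u J.1) ^ δ *
          ((∫⁻ x in E, w x) ^ η * (∫⁻ x in E, u x) ^ η * A I ^ δ) := by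
  classical
  set kw := volume J.1.pts / (4 * ∫⁻ x in J.1.pts, w x)
  set ku := volume J.1.pts / (4 * ∫⁻ x in J.1.pts, u x)
  induction m generalizing I with
  | zero =>
    refine ⟨∅, fun _ => 0, MeasurableSet.empty, Set.empty_subset _, aestronglyMeasurable_const,
      by simp, fun c => ?_, ?_⟩
    · simp only [add_zero, setLIntegral_const]
      rw [mul_comm]; exact le_self_add
    · have : (0 : ℝ) < 1 + δ := by linarith
      simp [haarSum, this]
  | succ m ih =>
    have hP' : ∀ k < m, ∀ I : D.cubes,
        ∫⁻ x in I.1.pts, ‖haarSum g k I x‖ₑ ^ (1 + δ) ≤ K * jnBound w u A η δ I :=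
      fun k hk => hP k (hk.trans (Nat.lt_succ_self m))
    have hI0 := volume_pts_ne_zero I.1
    have hI1 := volume_pts_ne_top I.1
    have hJ0 := volume_pts_ne_zero J.1
    have hJ1 := volume_pts_ne_top J.1
    -- On a cube that has not been stopped each weight has at most 4 times its average on J, so the
    -- product of averages grows by at most 16. Passing to a child costs 2^d per weight, whence
    -- 4^(d+2) on stopping cubes.
    have hratio : ∀ {v : Pt d → ℝ≥0∞}, ∫⁻ x in J.1.pts, v x ≠ 0 → ∫⁻ x in J.1.pts, v x ≠ ∞ →
        volume J.1.pts / (4 * ∫⁻ x in J.1.pts, v x) * (∫⁻ x in I.1.pts, v x) ≤ volume I.1.pts →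
        (∫⁻ x in I.1.pts, v x) / volume I.1.pts ≤
          4 * ((∫⁻ x in J.1.pts, v x) / volume J.1.pts) := by
      intro v hv hv' h
      refine ENNReal.div_le_of_le_mul ?_
      have h4 : (4 * ∫⁻ x in J.1.pts, v x) ≠ 0 := mul_ne_zero (by norm_num) hv
      have h4' : (4 * ∫⁻ x in J.1.pts, v x) ≠ ∞ := ENNReal.mul_ne_top (by norm_num) hv'
      have h5 := mul_le_mul_right h (4 * (∫⁻ x in J.1.pts, v x) / volume J.1.pts)
      calc ∫⁻ x in I.1.pts, v x
          = (4 * (∫⁻ x in J.1.pts, v x) / volume J.1.pts) *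
            (volume J.1.pts / (4 * ∫⁻ x in J.1.pts, v x) * (∫⁻ x in I.1.pts, v x)) := by
            rw [div_eq_mul_inv, div_eq_mul_inv]
            calc ∫⁻ x in I.1.pts, v x
                = ((4 * ∫⁻ x in J.1.pts, v x) * (4 * ∫⁻ x in J.1.pts, v x)⁻¹) *
                  ((volume J.1.pts)⁻¹ * volume J.1.pts) * (∫⁻ x in I.1.pts, v x) := by
                  rw [ENNReal.mul_inv_cancel h4 h4', ENNReal.inv_mul_cancel hJ0 hJ1]; simp
              _ = _ := by ring
        _ ≤ _ := h5
        _ = _ := by rw [mul_div_assoc]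
    have hwI := hratio hwJ hwJ' (le_self_add.trans hI)
    have huI := hratio huJ huJ' (le_add_self.trans hI)
    have hchild : ∀ (v : Pt d → ℝ≥0∞) (b : Fin d → Bool),
        (∫⁻ x in (I.1.child b).pts, v x) / volume (I.1.child b).pts ≤
          2 ^ d * ((∫⁻ x in I.1.pts, v x) / volume I.1.pts) := by
      intro v b
      rw [← I.1.volume_child b, div_eq_mul_inv, div_eq_mul_inv, ENNReal.mul_inv (by simp)
        (by simp)]
      calc (∫⁻ x in (I.1.child b).pts, v x) * (volume (I.1.child b).pts)⁻¹
          ≤ (∫⁻ x in I.1.pts, v x) * (volume (I.1.child b).pts)⁻¹ := by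
            gcongr
            exact I.1.child_subset b
        _ = (2 ^ d * (2 ^ d)⁻¹) *
            ((∫⁻ x in I.1.pts, v x) * (volume (I.1.child b).pts)⁻¹) := by
            rw [ENNReal.mul_inv_cancel (by simp) (by simp), one_mul]
        _ = _ := by ring
    have htC : ∀ b, avgProd w u (I.1.child b) ≤ 4 ^ (d + 2) * avgProd w u J.1 := by
      intro b
      calc avgProd w u (I.1.child b)
          ≤ (2 ^ d * (4 * ((∫⁻ x in J.1.pts, w x) / volume J.1.pts))) *
            (2 ^ d * (4 * ((∫⁻ x in J.1.pts, u x) / volume J.1.pts))) := by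
            unfold avgProd
            gcongr
            · exact (hchild w b).trans (by gcongr)
            · exact (hchild u b).trans (by gcongr)
        _ = _ := by
            unfold avgProd
            rw [pow_add, show (4 : ℝ≥0∞) ^ d = 2 ^ d * 2 ^ d by rw [← mul_pow]; norm_num]
            ring
    have htI : avgProd w u I.1 ≤ 16 * avgProd w u J.1 := by
      calc avgProd w u I.1
          ≤ (4 * ((∫⁻ x in J.1.pts, w x) / volume J.1.pts)) *
            (4 * ((∫⁻ x in J.1.pts, u x) / volume J.1.pts)) := by
            unfold avgProd
            gcongr
        _ = _ := by unfold avgProd; ring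
    have hex : ∀ b : Fin d → Bool, ∃ (E : Set (Pt d)) (F : Pt d → Mat n), MeasurableSet E ∧
        E ⊆ (I.1.child b).pts ∧ AEStronglyMeasurable F volume ∧
        volume E ≤ kw * (∫⁻ x in E, w x) + ku * (∫⁻ x in E, u x) ∧
        (∀ c : Mat n, ∫⁻ x in (I.1.child b).pts, ENNReal.ofReal (hs (c + F x)) ≤
          volume (I.1.child b).pts * ENNReal.ofReal (hs c) +
            16 * κ * avgProd w u J.1 * A (DyadicGrid.child I b)) ∧
        ∫⁻ x in (I.1.child b).pts, ‖haarSum g m (DyadicGrid.child I b) x - F x‖ₑ ^ (1 + δ) ≤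
          K * (4 ^ (d + 2) * avgProd w u J.1) ^ δ *
            ((∫⁻ x in E, w x) ^ η * (∫⁻ x in E, u x) ^ η * A (DyadicGrid.child I b) ^ δ) := by
      intro b
      -- A child below the threshold is treated recursively. Otherwise it is a stopping cube: it
      -- joins E entirely, F vanishes there, and the remaining sum is bounded by `hP`.
      by_cases hb : kw * (∫⁻ x in (I.1.child b).pts, w x) +
          ku * (∫⁻ x in (I.1.child b).pts, u x) ≤ volume (I.1.child b).pts
      · exact ih hP' (DyadicGrid.child I b) hb
      · refine ⟨(I.1.child b).pts, fun _ => 0, measurableSet_pts _, subset_rfl,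
          aestronglyMeasurable_const, (not_le.1 hb).le, fun c => ?_, ?_⟩
        · simp only [add_zero, setLIntegral_const]
          rw [mul_comm]; exact le_self_add
        · simp only [sub_zero]
          refine (hP m (Nat.lt_succ_self m) (DyadicGrid.child I b)).trans ?_
          unfold jnBound
          rw [mul_assoc K]
          gcongr
          · exact htC b
          · exact subset_rfl
          · exact subset_rfl
    choose E F hE hEC hF hEvol hFhs hFp using hex
    have hEd : Pairwise (Function.onFun Disjoint E) := fun b b' hbb =>
      (I.1.disjoint_child hbb).mono (hEC b) (hEC b')
    have hEsum : ∀ v : Pt d → ℝ≥0∞, ∫⁻ x in ⋃ b, E b, v x = ∑ b, ∫⁻ x in E b, v x := fun v => by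
      rw [lintegral_iUnion hE hEd, tsum_fintype]
    refine ⟨⋃ b, E b, fun x => ∑ b, (I.1.child b).pts.indicator
      (fun y => blockVal g I b + F b y) x, MeasurableSet.iUnion hE,
      Set.iUnion_subset fun b => (hEC b).trans (I.1.child_subset b), ?_, ?_, fun c => ?_, ?_⟩
    · refine Finset.aestronglyMeasurable_fun_sum _ fun b _ => ?_
      exact (aestronglyMeasurable_const.add (hF b)).indicator (measurableSet_pts _)
    · rw [measure_iUnion hEd hE, tsum_fintype, hEsum, hEsum, Finset.mul_sum, Finset.mul_sum,
        ← Finset.sum_add_distrib]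
      exact Finset.sum_le_sum fun b _ => hEvol b
    -- The arbitrary constant c makes the induction run: on each child the block value is absorbed
    -- into c, and orthogonality recombines the children into hs c plus the energy of the block at
    -- I.
    · rw [← I.1.sum_lintegral_child]
      calc ∑ b, ∫⁻ x in (I.1.child b).pts, ENNReal.ofReal (hs (c + ∑ b,
            (I.1.child b).pts.indicator (fun y => blockVal g I b + F b y) x))
          = ∑ b, ∫⁻ x in (I.1.child b).pts, ENNReal.ofReal (hs ((c + blockVal g I b) + F b x)) := by
            refine Finset.sum_congr rfl fun b _ => ?_
            refine setLIntegral_congr_fun (measurableSet_pts _) fun x hx => ?_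
            rw [I.1.sum_indicator_child _ hx, add_assoc]
        _ ≤ ∑ b, (volume (I.1.child b).pts * ENNReal.ofReal (hs (c + blockVal g I b)) +
            16 * κ * avgProd w u J.1 * A (DyadicGrid.child I b)) :=
            Finset.sum_le_sum fun b _ => hFhs b _
        _ = volume I.1.pts * ENNReal.ofReal (hs c) + (∑ e : Sig d, ENNReal.ofReal (hs (g (I, e))) +
            16 * κ * avgProd w u J.1 * ∑ b, A (DyadicGrid.child I b)) := by
            rw [Finset.sum_add_distrib, sum_ofReal_hs_add_blockVal, Finset.mul_sum, add_assoc]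
        _ ≤ volume I.1.pts * ENNReal.ofReal (hs c) + (16 * κ * avgProd w u J.1 * a I +
            16 * κ * avgProd w u J.1 * ∑ b, A (DyadicGrid.child I b)) := by
            gcongr
            refine (hg I).trans ?_
            calc κ * avgProd w u I.1 * a I ≤ κ * (16 * avgProd w u J.1) * a I := by gcongr
              _ = _ := by ring
        _ ≤ _ := by
            rw [← mul_add]
            gcongr
            exact hA I
    · rw [← I.1.sum_lintegral_child]
      calc ∑ b, ∫⁻ x in (I.1.child b).pts, ‖haarSum g (m + 1) I x - ∑ b,
            (I.1.child b).pts.indicator (fun y => blockVal g I b + F b y) x‖ₑ ^ (1 + δ)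
          = ∑ b, ∫⁻ x in (I.1.child b).pts,
            ‖haarSum g m (DyadicGrid.child I b) x - F b x‖ₑ ^ (1 + δ) := by
            refine Finset.sum_congr rfl fun b _ => ?_
            refine setLIntegral_congr_fun (measurableSet_pts _) fun x hx => ?_
            rw [I.1.sum_indicator_child _ hx, haarSum_succ_of_mem g m I hx, add_sub_add_left_eq_sub]
        _ ≤ ∑ b, K * (4 ^ (d + 2) * avgProd w u J.1) ^ δ *
            ((∫⁻ x in E b, w x) ^ η * (∫⁻ x in E b, u x) ^ η *
              A (DyadicGrid.child I b) ^ δ) := Finset.sum_le_sum fun b _ => hFp b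
        _ ≤ _ := by
            rw [← Finset.mul_sum, hEsum, hEsum]
            gcongr
            -- As 2η + δ = 1, Hölder's inequality sums the products over the children without loss.
            refine (sum_rpow_mul_rpow_mul_rpow_le _ _ _ hη hδ hηδ).trans ?_
            gcongr
            exact le_add_self.trans (hA I)

end JohnNirenberg

/-! ### The scalar-weighted John–Nirenberg inequality -/

section JohnNirenbergConclusion

variable {d n : ℕ} [NeZero d] {D : DyadicGrid d}

/-- The exponent gain in the John–Nirenberg inequality for weights with `A_∞` constant `θ`. -/
lemma exists_exponent (d : ℕ) {θ : ℝ} (h0 : 0 < θ) (h1 : θ < 1) :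
    ∃ δ η : ℝ, 0 < δ ∧ 0 < η ∧ 2 * η + δ = 1 ∧
      (4 ^ (d + 2) : ℝ≥0∞) ^ δ * (ENNReal.ofReal θ ^ η * ENNReal.ofReal θ ^ η) < 1 := by
  -- With η = (1 − δ)/2, the contraction factor tends to θ < 1 as δ decreases to 0.
  have hcont : Filter.Tendsto (fun δ : ℝ => ((4 : ℝ) ^ (d + 2)) ^ δ * θ ^ (1 - δ))
      (nhdsWithin 0 (Set.Ioi 0)) (nhds (((4 : ℝ) ^ (d + 2)) ^ (0 : ℝ) * θ ^ (1 - 0 : ℝ))) := by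
    refine Filter.Tendsto.mono_left ?_ nhdsWithin_le_nhds
    have : Continuous fun δ : ℝ => ((4 : ℝ) ^ (d + 2)) ^ δ * θ ^ (1 - δ) :=
      (Real.continuous_const_rpow (by positivity)).mul
        ((Real.continuous_const_rpow h0.ne').comp (by fun_prop))
    exact this.tendsto 0
  simp only [Real.rpow_zero, sub_zero, Real.rpow_one, one_mul] at hcont
  obtain ⟨δ, hδ, hδ0, hδ1⟩ := ((hcont.eventually_lt_const h1).and
    (Ioo_mem_nhdsGT (zero_lt_one' ℝ))).exists
  refine ⟨δ, (1 - δ) / 2, hδ0, by linarith, by ring, ?_⟩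
  rw [← ENNReal.rpow_add_of_nonneg _ _ (by linarith) (by linarith), add_halves,
    ENNReal.ofReal_rpow_of_pos h0,
    show (4 ^ (d + 2) : ℝ≥0∞) = ENNReal.ofReal (4 ^ (d + 2)) by
      rw [ENNReal.ofReal_pow (by norm_num)]; norm_num,
    ENNReal.ofReal_rpow_of_pos (by positivity), ← ENNReal.ofReal_mul (by positivity)]
  exact ENNReal.ofReal_lt_one.2 hδ

/-- A fixed point of an affine contraction, in the form used to close the induction. -/
lemma exists_const_of_contraction {c ρ : ℝ≥0∞} (hc : c ≠ ∞) (hρ : ρ < 1) {p : ℝ} (hp : 0 < p) :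
    ∃ K : ℝ≥0∞, K ≠ ∞ ∧ c ^ (1 / p) + (ρ * K) ^ (1 / p) ≤ K ^ (1 / p) := by
  have hρ' : ρ ^ (1 / p) < 1 := ENNReal.rpow_lt_one hρ (by positivity)
  have h0 : 1 - ρ ^ (1 / p) ≠ 0 := (tsub_pos_of_lt hρ').ne'
  have h1 : 1 - ρ ^ (1 / p) ≠ ∞ := ENNReal.sub_ne_top ENNReal.one_ne_top
  set k := c ^ (1 / p) / (1 - ρ ^ (1 / p)) with hk
  have hkt : k ≠ ∞ := ENNReal.div_ne_top (ENNReal.rpow_ne_top_of_nonneg (by positivity) hc) h0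
  refine ⟨k ^ p, ENNReal.rpow_ne_top_of_nonneg hp.le hkt, ?_⟩
  rw [ENNReal.mul_rpow_of_nonneg _ _ (by positivity), ← ENNReal.rpow_mul,
    mul_one_div_cancel hp.ne', ENNReal.rpow_one]
  have : c ^ (1 / p) = (1 - ρ ^ (1 / p)) * k := (ENNReal.mul_div_cancel h0 h1).symm
  rw [this, ← add_mul, tsub_add_cancel_of_le hρ'.le, one_mul]

-- Since 1 + δ = 2(η + δ), this is Hölder's inequality passing from L² to L^{1+δ} on a set of finite
-- measure.
omit [NeZero d] in
lemma lintegral_rpow_enorm_le_of_hs {F : Pt d → Mat n} {I : Cube d}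
    (hF : AEStronglyMeasurable F (volume.restrict I.pts)) {η δ : ℝ} (hη : 0 ≤ η) (hδ : 0 ≤ δ)
    (h : 2 * η + δ = 1) :
    ∫⁻ x in I.pts, ‖F x‖ₑ ^ (1 + δ) ≤
      (∫⁻ x in I.pts, ENNReal.ofReal (hs (F x))) ^ (η + δ) * volume I.pts ^ η := by
  have hm : AEMeasurable (fun x => ENNReal.ofReal (hs (F x))) (volume.restrict I.pts) :=
    (continuous_hs.comp_aestronglyMeasurable hF).aemeasurable.ennreal_ofReal
  have := ENNReal.lintegral_mul_norm_pow_le (μ := volume.restrict I.pts) hm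
    (aemeasurable_const (b := 1)) (p := η + δ) (q := η) (by linarith) hη (by linarith)
  simp only [ENNReal.one_rpow, mul_one, lintegral_const, Measure.restrict_apply_univ,
    one_mul] at this
  refine le_trans (lintegral_mono fun x => ?_) this
  rw [show 1 + δ = 2 * (η + δ) by linarith, ENNReal.rpow_mul]
  refine ENNReal.rpow_le_rpow ?_ (by linarith)
  rw [ENNReal.rpow_two, enorm_sq]
  exact ENNReal.ofReal_le_ofReal (sq_norm_le_hs _)

/-- **John–Nirenberg inequality**: the truncated sums of a Haar expansion whose blocks are
controlled by two `A_∞` weights and a Carleson sequence are bounded in `L^{1+δ}`. -/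
theorem lintegral_haarSum_le {g : HaarIdx D → Mat n} {w u : Pt d → ℝ≥0∞} {a A : D.cubes → ℝ≥0∞}
    {κ M K : ℝ≥0∞} {η δ θ : ℝ} (hη : 0 < η) (hδ : 0 < δ) (hηδ : 2 * η + δ = 1)
    (hK : ((16 * κ) ^ (η + δ) * M ^ η) ^ (1 / (1 + δ)) +
      ((4 ^ (d + 2) : ℝ≥0∞) ^ δ * (ENNReal.ofReal θ ^ η * ENNReal.ofReal θ ^ η) * K) ^
        (1 / (1 + δ)) ≤ K ^ (1 / (1 + δ)))
    (hg : ∀ I : D.cubes, ∑ e : Sig d, ENNReal.ofReal (hs (g (I, e))) ≤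
      κ * avgProd w u I.1 * a I)
    (hA : ∀ I : D.cubes, a I + ∑ b, A (DyadicGrid.child I b) ≤ A I)
    (hAM : ∀ I : D.cubes, A I ≤ M * volume I.1.pts)
    (hw0 : ∀ I : D.cubes, ∫⁻ x in I.1.pts, w x ≠ 0) (hw : ∀ I : D.cubes, ∫⁻ x in I.1.pts, w x ≠ ∞)
    (hu0 : ∀ I : D.cubes, ∫⁻ x in I.1.pts, u x ≠ 0) (hu : ∀ I : D.cubes, ∫⁻ x in I.1.pts, u x ≠ ∞)
    (hwθ : ∀ (I : D.cubes) (E : Set (Pt d)), MeasurableSet E → E ⊆ I.1.pts →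
      2 * volume E ≤ volume I.1.pts →
        ∫⁻ x in E, w x ≤ ENNReal.ofReal θ * ∫⁻ x in I.1.pts, w x)
    (huθ : ∀ (I : D.cubes) (E : Set (Pt d)), MeasurableSet E → E ⊆ I.1.pts →
      2 * volume E ≤ volume I.1.pts →
        ∫⁻ x in E, u x ≤ ENNReal.ofReal θ * ∫⁻ x in I.1.pts, u x)
    (N : ℕ) (J : D.cubes) :
    ∫⁻ x in J.1.pts, ‖haarSum g N J x‖ₑ ^ (1 + δ) ≤ K * jnBound w u A η δ J := by
  induction N using Nat.strong_induction_on generalizing J with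
  | _ N ih =>
    have hJ0 := volume_pts_ne_zero J.1
    have hJ1 := volume_pts_ne_top J.1
    have hp : 0 < 1 + δ := by linarith
    have hquarter : ∀ {v : Pt d → ℝ≥0∞}, ∫⁻ x in J.1.pts, v x ≠ 0 → ∫⁻ x in J.1.pts, v x ≠ ∞ →
        volume J.1.pts / (4 * ∫⁻ x in J.1.pts, v x) * (∫⁻ x in J.1.pts, v x) =
          volume J.1.pts / 4 := by
      intro v hv hv'
      rw [div_eq_mul_inv, ENNReal.mul_inv (by simp) (by simp), mul_assoc, mul_assoc,
        ENNReal.inv_mul_cancel hv hv', mul_one, div_eq_mul_inv]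
    have hhalf : 2 * (volume J.1.pts / 4 + volume J.1.pts / 4) = volume J.1.pts := by
      rw [← two_mul, ← mul_assoc, show (2 : ℝ≥0∞) * 2 = 4 by norm_num]
      exact ENNReal.mul_div_cancel (by norm_num) (by norm_num)
    obtain ⟨E, F, hE, hEJ, hF, hEvol, hFhs, hFp⟩ := exists_stopping (g := g) (w := w) (u := u)
      (a := a) (A := A) (κ := κ) (K := K) hη.le hδ.le hηδ hg hA J (hw0 J) (hw J) (hu0 J) (hu J) N
      (fun k hk I => ih k hk I) J (by
        rw [hquarter (hw0 J) (hw J), hquarter (hu0 J) (hu J)]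
        calc _ ≤ 2 * (volume J.1.pts / 4 + volume J.1.pts / 4) := by
              rw [two_mul]; exact le_self_add
          _ = _ := hhalf)
    -- The constants 1/4 in the stopping rule make each weight contribute at most |J|/4 to |E|.
    -- Hence the A_∞ property applies to E.
    have hE2 : 2 * volume E ≤ volume J.1.pts := by
      refine le_trans ?_ hhalf.le
      gcongr
      refine hEvol.trans (add_le_add ?_ ?_)
      · rw [← hquarter (hw0 J) (hw J)]
        gcongr
      · rw [← hquarter (hu0 J) (hu J)]
        gcongr
    set B := jnBound w u A η δ J with hB
    set ρ := (4 ^ (d + 2) : ℝ≥0∞) ^ δ * (ENNReal.ofReal θ ^ η * ENNReal.ofReal θ ^ η)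
    have h1 : ∫⁻ x in J.1.pts, ‖haarSum g N J x - F x‖ₑ ^ (1 + δ) ≤ ρ * K * B := by
      refine hFp.trans ?_
      calc K * (4 ^ (d + 2) * avgProd w u J.1) ^ δ *
            ((∫⁻ x in E, w x) ^ η * (∫⁻ x in E, u x) ^ η * A J ^ δ)
          ≤ K * (4 ^ (d + 2) * avgProd w u J.1) ^ δ *
            ((ENNReal.ofReal θ * ∫⁻ x in J.1.pts, w x) ^ η *
              (ENNReal.ofReal θ * ∫⁻ x in J.1.pts, u x) ^ η * A J ^ δ) := by
            gcongr
            · exact hwθ J E hE hEJ hE2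
            · exact huθ J E hE hEJ hE2
        _ = ρ * K * B := by
            rw [hB, jnBound, ENNReal.mul_rpow_of_nonneg _ _ hδ.le,
              ENNReal.mul_rpow_of_nonneg _ _ hη.le, ENNReal.mul_rpow_of_nonneg _ _ hη.le]
            ring
    have h2 : ∫⁻ x in J.1.pts, ‖F x‖ₑ ^ (1 + δ) ≤ (16 * κ) ^ (η + δ) * M ^ η * B := by
      refine (lintegral_rpow_enorm_le_of_hs hF.restrict hη.le hδ.le hηδ).trans ?_
      have h3 := hFhs 0
      rw [hs_zero, ENNReal.ofReal_zero, mul_zero, zero_add] at h3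
      simp only [zero_add] at h3
      set ww := ∫⁻ x in J.1.pts, w x
      set uu := ∫⁻ x in J.1.pts, u x
      calc (∫⁻ x in J.1.pts, ENNReal.ofReal (hs (F x))) ^ (η + δ) * volume J.1.pts ^ η
          ≤ (16 * κ * avgProd w u J.1 * A J) ^ (η + δ) * volume J.1.pts ^ η := by gcongr
        _ = (16 * κ) ^ (η + δ) * (avgProd w u J.1 ^ δ * A J ^ δ *
            (avgProd w u J.1 * A J * volume J.1.pts) ^ η) := by
            rw [mul_assoc (16 * κ), ENNReal.mul_rpow_of_nonneg _ _ (by positivity),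
              ENNReal.rpow_add_of_nonneg η δ hη.le hδ.le (x := avgProd w u J.1 * A J),
              ENNReal.mul_rpow_of_nonneg _ (volume _) hη.le,
              ENNReal.mul_rpow_of_nonneg _ _ hδ.le]
            ring
        -- The Carleson bound A ≤ M |J| is spent on the η-power only. The factor A^δ survives, which
        -- is what makes the tails of the series small.
        _ ≤ (16 * κ) ^ (η + δ) * (avgProd w u J.1 ^ δ * A J ^ δ * (ww * uu * M) ^ η) := by
            gcongr _ * (_ * ?_ ^ η)
            calc avgProd w u J.1 * A J * volume J.1.pts
                ≤ avgProd w u J.1 * (M * volume J.1.pts) * volume J.1.pts := by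
                  gcongr; exact hAM J
              _ = ww * uu * M * ((volume J.1.pts)⁻¹ * volume J.1.pts) *
                  ((volume J.1.pts)⁻¹ * volume J.1.pts) := by
                  rw [avgProd, div_eq_mul_inv, div_eq_mul_inv]; ring
              _ = ww * uu * M := by
                  rw [ENNReal.inv_mul_cancel hJ0 hJ1, mul_one, mul_one]
        _ = _ := by
            rw [hB, jnBound, ENNReal.mul_rpow_of_nonneg _ _ hη.le,
              ENNReal.mul_rpow_of_nonneg _ _ hη.le]
            ring
    have hm := haarSum_aestronglyMeasurable g N J
    -- The sum splits into F, bounded without reference to K, and a remainder bounded by ρ K with ρ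
    -- < 1; `hK` says that K absorbs both.
    have hmink := ENNReal.lintegral_Lp_add_le (μ := volume.restrict J.1.pts) (p := 1 + δ)
      (f := fun x => ‖F x‖ₑ) (g := fun x => ‖haarSum g N J x - F x‖ₑ) hF.restrict.enorm
      (hm.sub hF.restrict).enorm (by linarith)
    have h4 : (∫⁻ x in J.1.pts, ‖haarSum g N J x‖ₑ ^ (1 + δ)) ^ (1 / (1 + δ)) ≤
        (K * B) ^ (1 / (1 + δ)) := by
      calc (∫⁻ x in J.1.pts, ‖haarSum g N J x‖ₑ ^ (1 + δ)) ^ (1 / (1 + δ))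
          ≤ (∫⁻ x in J.1.pts, ((fun x => ‖F x‖ₑ) + fun x => ‖haarSum g N J x - F x‖ₑ) x ^
              (1 + δ)) ^ (1 / (1 + δ)) := by
            gcongr with x
            calc ‖haarSum g N J x‖ₑ = ‖F x + (haarSum g N J x - F x)‖ₑ := by
                  rw [add_sub_cancel]
              _ ≤ _ := enorm_add_le _ _
        _ ≤ _ := hmink
        _ ≤ ((16 * κ) ^ (η + δ) * M ^ η * B) ^ (1 / (1 + δ)) +
            (ρ * K * B) ^ (1 / (1 + δ)) := by gcongr
        _ = (((16 * κ) ^ (η + δ) * M ^ η) ^ (1 / (1 + δ)) + (ρ * K) ^ (1 / (1 + δ))) *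
            B ^ (1 / (1 + δ)) := by
            rw [ENNReal.mul_rpow_of_nonneg _ B (by positivity),
              ENNReal.mul_rpow_of_nonneg _ B (by positivity), add_mul]
        _ ≤ K ^ (1 / (1 + δ)) * B ^ (1 / (1 + δ)) := by gcongr
        _ = _ := by rw [ENNReal.mul_rpow_of_nonneg _ B (by positivity)]
    exact (ENNReal.rpow_le_rpow_iff (by positivity)).1 h4

end JohnNirenbergConclusion

/-! ### Carleson sums -/

section CarlesonSums

variable {d : ℕ} [NeZero d] {D : DyadicGrid d}

/-- The sum of a sequence over the Haar indices below a cube. -/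
def carlSum (z : HaarIdx D → ℝ≥0∞) (J : Cube d) : ℝ≥0∞ :=
  ∑' p : {p : HaarIdx D // p.1.1.pts ⊆ J.pts}, z p.1

omit [NeZero d] in
open Classical in
lemma carlSum_eq_ite (z : HaarIdx D → ℝ≥0∞) (J : Cube d) :
    carlSum z J = ∑' p : HaarIdx D, if p.1.1.pts ⊆ J.pts then z p else 0 := by
  unfold carlSum
  have := tsum_subtype {p : HaarIdx D | p.1.1.pts ⊆ J.pts} z
  refine Eq.trans this (tsum_congr fun p => ?_)
  simp [Set.indicator_apply]

lemma carlSum_eq (z : HaarIdx D → ℝ≥0∞) (J : D.cubes) :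
    carlSum z J.1 = ∑ e : Sig d, z (J, e) + ∑ b, carlSum z (DyadicGrid.child J b).1 := by
  classical
  have hsplit : ∀ p : HaarIdx D, (if p.1.1.pts ⊆ J.1.pts then z p else 0) =
      (if p.1 = J then z p else 0) +
        ∑ b, if p.1.1.pts ⊆ (J.1.child b).pts then z p else 0 := by
    intro p
    by_cases hp : p.1 = J
    · have h1 : ∀ b, ¬ p.1.1.pts ⊆ (J.1.child b).pts := fun b => by
        rw [hp]; exact DyadicGrid.not_subset_child _ b
      rw [if_pos hp, if_pos (by rw [hp])]
      simp [h1]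
    · rw [if_neg hp, zero_add]
      by_cases hs : p.1.1.pts ⊆ J.1.pts
      · obtain h | ⟨b, hb⟩ := DyadicGrid.eq_or_subset_child J.2 p.1.2 hs
        · exact absurd (Subtype.ext h) hp
        · rw [if_pos hs, Finset.sum_eq_single b, if_pos hb]
          · intro b' _ hne
            refine if_neg fun hb' => hne ?_
            by_contra hbb
            exact Set.disjoint_left.1 (J.1.disjoint_child hbb) (hb' p.1.1.corner_mem)
              (hb p.1.1.corner_mem)
          · simp
      · rw [if_neg hs, Finset.sum_eq_zero]
        exact fun b _ => if_neg fun hb => hs (hb.trans (J.1.child_subset b))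
  rw [carlSum_eq_ite]
  simp only [hsplit]
  rw [ENNReal.tsum_add, Summable.tsum_finsetSum fun _ _ => ENNReal.summable]
  congr 1
  · rw [ENNReal.tsum_prod', tsum_eq_single J]
    · simp [tsum_fintype]
    · intro I hI
      simp [hI]
  · refine Finset.sum_congr rfl fun b _ => ?_
    rw [carlSum_eq_ite]
    rfl

/-- The sum of a sequence over the Haar indices of the first `N` generations below a cube. -/
def carlTrunc (z : HaarIdx D → ℝ≥0∞) : ℕ → D.cubes → ℝ≥0∞
  | 0, _ => 0
  | N + 1, J => ∑ e : Sig d, z (J, e) + ∑ b, carlTrunc z N (DyadicGrid.child J b)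

lemma carlTrunc_mono {z z' : HaarIdx D → ℝ≥0∞} (h : ∀ p, z p ≤ z' p) (N : ℕ) (J : D.cubes) :
    carlTrunc z N J ≤ carlTrunc z' N J := by
  induction N generalizing J with
  | zero => exact le_rfl
  | succ N ih =>
    exact add_le_add (Finset.sum_le_sum fun e _ => h _) (Finset.sum_le_sum fun b _ => ih _)

lemma child_side (J : D.cubes) (b : Fin d → Bool) :
    (DyadicGrid.child J b).1.side = J.1.side / 2 := rfl

lemma carlTrunc_eq_carlSum {z : HaarIdx D → ℝ≥0∞} {s : ℝ} (hz : ∀ p, p.1.1.side ≤ s → z p = 0)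
    (N : ℕ) (J : D.cubes) (hJ : J.1.side ≤ 2 ^ N * s) : carlTrunc z N J = carlSum z J.1 := by
  induction N generalizing J with
  | zero =>
    symm
    refine ENNReal.tsum_eq_zero.2 fun p => hz _ ?_
    exact (Cube.side_le_of_subset p.2).trans (by simpa using hJ)
  | succ N ih =>
    rw [carlSum_eq, carlTrunc]
    congr 1
    refine Finset.sum_congr rfl fun b _ => ih _ ?_
    rw [child_side]
    rw [pow_succ] at hJ
    linarith

omit [NeZero d] in
lemma exists_side_gt (F : Finset (HaarIdx D)) : ∃ s : ℝ, 0 < s ∧ ∀ p ∈ F, s < p.1.1.side := by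
  classical
  induction F using Finset.induction_on with
  | empty => exact ⟨1, one_pos, by simp⟩
  | insert p F _ ih =>
    obtain ⟨s, hs, h⟩ := ih
    refine ⟨min s (p.1.1.side / 2), lt_min hs (half_pos p.1.1.side_pos), fun q hq => ?_⟩
    obtain rfl | hq := Finset.mem_insert.1 hq
    · exact (min_le_right _ _).trans_lt (half_lt_self q.1.1.side_pos)
    · exact (min_le_left _ _).trans_lt (h q hq)

lemma exists_le_two_pow_mul {s : ℝ} (hs : 0 < s) (r : ℝ) : ∃ N : ℕ, r ≤ 2 ^ N * s := by
  obtain ⟨N, hN⟩ := pow_unbounded_of_one_lt (r / s) (one_lt_two : (1 : ℝ) < 2)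
  exact ⟨N, ((div_le_iff₀ hs).1 hN.le)⟩

/-- Finitely many cubes have sides bounded below, so each finite partial sum is seen by some finite
number of generations. -/
lemma carlSum_le_of_carlTrunc_le {z : HaarIdx D → ℝ≥0∞} {J : D.cubes} {c : ℝ≥0∞}
    (h : ∀ N, carlTrunc z N J ≤ c) : carlSum z J.1 ≤ c := by
  classical
  rw [carlSum_eq_ite]
  rw [ENNReal.tsum_eq_iSup_sum]
  refine iSup_le fun F => ?_
  obtain ⟨s, hs, hF⟩ := exists_side_gt F
  obtain ⟨N, hN⟩ := exists_le_two_pow_mul hs J.1.side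
  set z' : HaarIdx D → ℝ≥0∞ := fun p => if p ∈ F then z p else 0
  have hz' : ∀ p, p.1.1.side ≤ s → z' p = 0 := fun p hp =>
    if_neg fun hpF => (hF p hpF).not_ge hp
  calc ∑ p ∈ F, (if p.1.1.pts ⊆ J.1.pts then z p else 0)
      = ∑ p ∈ F, (if p.1.1.pts ⊆ J.1.pts then z' p else 0) :=
        Finset.sum_congr rfl fun p hp => by simp [z', hp]
    _ ≤ carlSum z' J.1 := by rw [carlSum_eq_ite]; exact ENNReal.sum_le_tsum F
    _ = carlTrunc z' N J := (carlTrunc_eq_carlSum hz' N J hN).symm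
    _ ≤ carlTrunc z N J := carlTrunc_mono (fun p => by simp only [z']; split_ifs <;> simp) N J
    _ ≤ c := h N

open Classical in
/-- The Haar coefficients of the cubes of side at most `s`. -/
def cut {M : Type*} [Zero M] (g : HaarIdx D → M) (s : ℝ) (p : HaarIdx D) : M :=
  if p.1.1.side ≤ s then g p else 0

-- A finite set of indices carries all but ε of the sum, and the cut eventually removes every cube
-- in it.
omit [NeZero d] in
lemma tendsto_carlSum_cut {z : HaarIdx D → ℝ≥0∞} {J : Cube d} (h : carlSum z J ≠ ∞) (s : ℝ) :
    Filter.Tendsto (fun N : ℕ => carlSum (cut z (s / 2 ^ N)) J) Filter.atTop (nhds 0) := by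
  classical
  rw [ENNReal.tendsto_nhds_zero]
  intro ε hε
  set z' : HaarIdx D → ℝ≥0∞ := fun p => if p.1.1.pts ⊆ J.pts then z p else 0
  have hz' : ∑' p, z' p ≠ ∞ := by rwa [← carlSum_eq_ite]
  obtain ⟨F, hF⟩ := ((ENNReal.tendsto_nhds_zero.1
    (ENNReal.tendsto_tsum_compl_atTop_zero hz')) ε hε).exists
  obtain ⟨r, hr, hFr⟩ := exists_side_gt F
  obtain ⟨N, hN⟩ := exists_le_two_pow_mul hr s
  filter_upwards [Filter.eventually_ge_atTop N] with m hm
  refine le_trans ?_ hF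
  have hsr : s / 2 ^ m ≤ r := by
    rw [div_le_iff₀ (by positivity)]
    refine hN.trans ?_
    rw [mul_comm]
    gcongr
    norm_num
  rw [carlSum_eq_ite, show (∑' b : {x // x ∉ F}, z' b) = ∑' p, {x | x ∉ F}.indicator z' p from
    tsum_subtype {x | x ∉ F} z']
  refine ENNReal.tsum_le_tsum fun p => ?_
  by_cases hp : p ∈ F
  · have : cut z (s / 2 ^ m) p = 0 := if_neg fun h => ((hFr p hp).trans_le (h.trans hsr)).false
    simp [this]
  · rw [Set.indicator_of_mem (by exact hp)]
    simp only [z', cut]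
    split_ifs <;> simp

end CarlesonSums

/-! ### Tails and two-sided multiples of truncated Haar sums -/

section Cut

variable {d n : ℕ} [NeZero d] {D : DyadicGrid d}

lemma haarSum_cut_of_side_le (g : HaarIdx D → Mat n) {s : ℝ} (N : ℕ) (I : D.cubes)
    (hI : I.1.side ≤ s) : haarSum (cut g s) N I = haarSum g N I := by
  induction N generalizing I with
  | zero => rfl
  | succ N ih =>
    have hb : ∀ b, blockVal (cut g s) I b = blockVal g I b := fun b => by
      simp [blockVal, cut, hI]
    funext x
    simp only [haarSum, hb]
    refine Finset.sum_congr rfl fun b _ => ?_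
    rw [ih]
    rw [child_side]
    linarith [I.1.side_pos]

/-- The difference of two truncations is again a truncated sum, of the coefficients cut to small
cubes. Bounds for truncations thus become Cauchy estimates. -/
lemma haarSum_cut (g : HaarIdx D → Mat n) (M N : ℕ) (I : D.cubes) {x : Pt d} (hx : x ∈ I.1.pts) :
    haarSum (cut g (I.1.side / 2 ^ M)) (M + N) I x = haarSum g (M + N) I x - haarSum g M I x := by
  induction M generalizing I with
  | zero =>
    rw [haarSum_cut_of_side_le _ _ _ (by simp)]
    simp [haarSum]
  | succ M ih =>
    rw [← I.1.iUnion_child] at hx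
    obtain ⟨b, hb⟩ := Set.mem_iUnion.1 hx
    have h0 : blockVal (cut g (I.1.side / 2 ^ (M + 1))) I b = 0 := by
      have : ¬ I.1.side ≤ I.1.side / 2 ^ (M + 1) := by
        rw [not_le, div_lt_iff₀ (by positivity)]
        exact lt_mul_of_one_lt_right I.1.side_pos
          (one_lt_pow₀ (one_lt_two : (1 : ℝ) < 2) (Nat.succ_ne_zero M))
      simp [blockVal, cut, this]
    have hs : I.1.side / 2 ^ (M + 1) = (DyadicGrid.child I b).1.side / 2 ^ M := by
      rw [child_side, pow_succ]; field_simp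
    rw [show M + 1 + N = (M + N) + 1 by ring, haarSum_succ_of_mem _ _ _ hb,
      haarSum_succ_of_mem _ _ _ hb, haarSum_succ_of_mem _ _ _ hb, h0, hs, zero_add,
      ih (DyadicGrid.child I b) hb, add_sub_add_left_eq_sub]

omit [NeZero d] in
lemma blockVal_mul (g : HaarIdx D → Mat n) (X Y : Mat n) (I : D.cubes) (b : Fin d → Bool) :
    blockVal (fun p => X * g p * Y) I b = X * blockVal g I b * Y := by
  simp only [blockVal, Matrix.mul_smul, Matrix.smul_mul, Finset.mul_sum, Finset.sum_mul]

lemma haarSum_mul (g : HaarIdx D → Mat n) (X Y : Mat n) (N : ℕ) (I : D.cubes) {x : Pt d}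
    (hx : x ∈ I.1.pts) :
    haarSum (fun p => X * g p * Y) N I x = X * haarSum g N I x * Y := by
  induction N generalizing I with
  | zero => simp [haarSum]
  | succ N ih =>
    rw [← I.1.iUnion_child] at hx
    obtain ⟨b, hb⟩ := Set.mem_iUnion.1 hx
    rw [haarSum_succ_of_mem _ _ _ hb, haarSum_succ_of_mem _ _ _ hb, blockVal_mul, ih _ hb,
      mul_add, add_mul]

end Cut

/-! ### From matrix weights to scalar weights in the John–Nirenberg inequality -/

section MatrixJohnNirenberg

variable {d n : ℕ} {D : DyadicGrid d}

/-- One constant θ = 1 − 1/(4K), with K the larger of the two characteristics, serves all scalar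
weights derived from W and U in `setLIntegral_le_of_a2`. -/
lemma exists_theta [NeZero n] (W U : A2Weight d n) : ∃ (K : ℝ≥0∞) (θ : ℝ), 0 < θ ∧ θ < 1 ∧ K ≠ 0 ∧
    K ≠ ∞ ∧ a2Char W.fn ≤ K ∧ a2Char U.fn ≤ K ∧ 1 - (4 * K)⁻¹ = ENNReal.ofReal θ := by
  set K := max (a2Char W.fn) (a2Char U.fn) with hK
  have h1 : 1 ≤ K := (one_le_a2Char W).trans (le_max_left _ _)
  have hKt : K ≠ ∞ := (max_lt W.a2Char_lt_top U.a2Char_lt_top).ne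
  have h4 : (4 * K)⁻¹ < 1 := by
    rw [ENNReal.inv_lt_one]
    calc (1 : ℝ≥0∞) < 4 * 1 := by norm_num
      _ ≤ 4 * K := by gcongr
  have h4' : (4 * K)⁻¹ ≠ 0 := ENNReal.inv_ne_zero.2 (ENNReal.mul_ne_top (by norm_num) hKt)
  have ht : 1 - (4 * K)⁻¹ ≠ ∞ := ENNReal.sub_ne_top ENNReal.one_ne_top
  refine ⟨K, (1 - (4 * K)⁻¹).toReal, ENNReal.toReal_pos (tsub_pos_of_lt h4).ne' ht, ?_,
    (zero_lt_one.trans_le h1).ne', hKt, le_max_left _ _, le_max_right _ _,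
    (ENNReal.ofReal_toReal ht).symm⟩
  rw [← ENNReal.toReal_one]
  exact (ENNReal.toReal_lt_toReal ht ENNReal.one_ne_top).2
    (ENNReal.sub_lt_self ENNReal.one_ne_top one_ne_zero h4')

lemma trForm_pos {V X : Mat n} (hV : V.PosDef) (hX : X ≠ 0) : 0 < trForm V X := by
  have h := trForm_eq_hs hV.posSemidef X
  refine lt_of_le_of_ne (trForm_nonneg hV.posSemidef X) fun h0 => hX ?_
  have h1 := sq_norm_sqrt_mul_le hV.posSemidef X
  rw [← h0] at h1
  have h2 : CFC.sqrt V * X = 0 := norm_eq_zero.1 (pow_eq_zero_iff two_ne_zero |>.1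
    (le_antisymm h1 (sq_nonneg _)))
  calc X = (CFC.sqrt V)⁻¹ * (CFC.sqrt V * X) := by
        rw [← Matrix.mul_assoc, sqrt_inv_mul hV, Matrix.one_mul]
    _ = 0 := by rw [h2, Matrix.mul_zero]

/-- Factor X Z Y through √V⁻¹ √V and √V'⁻¹ √V'. With V and V' the averages of W and U, the middle
factor is the reduced coefficient and the outer ones are values of trace forms. -/
lemma hs_mul_mul_le {V V' : Mat n} (hV : V.PosDef) (hV' : V'.PosDef) (X Y Z : Mat n) :
    hs (X * Z * Y) ≤ n * (trForm V⁻¹ Xᴴ * trForm V' Y *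
      ‖CFC.sqrt V * Z * (CFC.sqrt V')⁻¹‖ ^ 2) := by
  have h1 : X * Z * Y = (X * (CFC.sqrt V)⁻¹) * (CFC.sqrt V * Z * (CFC.sqrt V')⁻¹) *
      (CFC.sqrt V' * Y) := by
    calc X * Z * Y = X * ((CFC.sqrt V)⁻¹ * CFC.sqrt V) * Z *
          ((CFC.sqrt V')⁻¹ * CFC.sqrt V') * Y := by
          rw [sqrt_inv_mul hV, sqrt_inv_mul hV']; simp
      _ = _ := by simp only [Matrix.mul_assoc]
  have h2 : ‖X * (CFC.sqrt V)⁻¹‖ ^ 2 ≤ trForm V⁻¹ Xᴴ := by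
    rw [trForm_inv_eq_hs hV, ← Matrix.l2_opNorm_conjTranspose, Matrix.conjTranspose_mul,
      Matrix.conjTranspose_nonsing_inv, sqrt_isHermitian]
    exact sq_norm_le_hs _
  have h3 := sq_norm_sqrt_mul_le hV'.posSemidef Y
  refine (hs_le _).trans (mul_le_mul_of_nonneg_left ?_ (Nat.cast_nonneg n))
  rw [h1]
  calc ‖(X * (CFC.sqrt V)⁻¹) * (CFC.sqrt V * Z * (CFC.sqrt V')⁻¹) * (CFC.sqrt V' * Y)‖ ^ 2
      ≤ (‖X * (CFC.sqrt V)⁻¹‖ * ‖CFC.sqrt V * Z * (CFC.sqrt V')⁻¹‖ *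
          ‖CFC.sqrt V' * Y‖) ^ 2 := by
        gcongr
        exact (norm_mul_le _ _).trans (by gcongr; exact norm_mul_le _ _)
    _ = ‖X * (CFC.sqrt V)⁻¹‖ ^ 2 * ‖CFC.sqrt V' * Y‖ ^ 2 *
          ‖CFC.sqrt V * Z * (CFC.sqrt V')⁻¹‖ ^ 2 := by ring
    _ ≤ _ := by
        gcongr
        exact trForm_nonneg hV.inv.posSemidef _

/-- The scalar weight `tr (X W⁻¹ X*)`. -/
def leftWeight (W : A2Weight d n) (X : Mat n) (x : Pt d) : ℝ≥0∞ :=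
  ENNReal.ofReal (trForm (W.fn x)⁻¹ Xᴴ)

/-- The scalar weight `tr (Y* U Y)`. -/
def rightWeight (U : A2Weight d n) (Y : Mat n) (x : Pt d) : ℝ≥0∞ :=
  ENNReal.ofReal (trForm (U.fn x) Y)

lemma lintegral_leftWeight (W : A2Weight d n) (X : Mat n) (I : Cube d) :
    ∫⁻ x in I.pts, leftWeight W X x =
      volume I.pts * ENNReal.ofReal (trForm (avg I fun x => (W.fn x)⁻¹) Xᴴ) :=
  lintegral_trForm I (W.integrableOn_inv I) W.inv_posSemidef _

lemma lintegral_rightWeight (U : A2Weight d n) (Y : Mat n) (I : Cube d) :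
    ∫⁻ x in I.pts, rightWeight U Y x =
      volume I.pts * ENNReal.ofReal (trForm (avg I U.fn) Y) :=
  lintegral_trForm I (U.integrableOn I) U.posSemidef _

lemma div_volume_pts_mul (I : Cube d) (a : ℝ≥0∞) : volume I.pts * a / volume I.pts = a := by
  rw [mul_comm, ENNReal.mul_div_cancel_right (volume_pts_ne_zero I) (volume_pts_ne_top I)]

/-- **Matrix weighted John–Nirenberg inequality** for Haar expansions whose coefficients satisfy
the Carleson condition. The exponent depends only on the weights. -/
theorem exists_lintegral_haarSum_le [NeZero d] [NeZero n] (D : DyadicGrid d) (W U : A2Weight d n) :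
    ∃ η δ : ℝ, 0 < η ∧ 0 < δ ∧ 2 * η + δ = 1 ∧ ∀ M : ℝ≥0∞, M ≠ ∞ → ∃ K : ℝ≥0∞, K ≠ ∞ ∧
      ∀ Z : HaarIdx D → Mat n,
        (∀ J : D.cubes, carlSum (fun p => ‖redCoeff D W.fn U.fn Z p‖ₑ ^ 2) J.1 ≤
          M * volume J.1.pts) →
        ∀ X Y : Mat n, X ≠ 0 → Y ≠ 0 → ∀ (N : ℕ) (J : D.cubes),
          ∫⁻ x in J.1.pts, ‖haarSum (fun p => X * Z p * Y) N J x‖ₑ ^ (1 + δ) ≤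
            K * jnBound (leftWeight W X) (rightWeight U Y)
              (fun I : D.cubes => carlSum (fun p => ‖redCoeff D W.fn U.fn Z p‖ₑ ^ 2) I.1) η δ J := by
  obtain ⟨K₀, θ, hθ0, hθ1, hK0, hKt, hWK, hUK, hθ⟩ := exists_theta W U
  obtain ⟨δ, η, hδ, hη, hηδ, hρ⟩ := exists_exponent d hθ0 hθ1
  refine ⟨η, δ, hη, hδ, hηδ, fun M hM => ?_⟩
  obtain ⟨K, hK, hcontr⟩ := exists_const_of_contraction
    (c := (16 * (n : ℝ≥0∞)) ^ (η + δ) * M ^ η) (ENNReal.mul_ne_top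
      (ENNReal.rpow_ne_top_of_nonneg (by linarith)
        (ENNReal.mul_ne_top (by norm_num) (ENNReal.natCast_ne_top n)))
      (ENNReal.rpow_ne_top_of_nonneg hη.le hM)) hρ (p := 1 + δ) (by linarith)
  refine ⟨K, hK, fun Z hZ X Y hX hY N J => ?_⟩
  have hX' : Xᴴ ≠ 0 := fun h => hX (by rw [← X.conjTranspose_conjTranspose, h]; simp)
  refine lintegral_haarSum_le (κ := n) (M := M) (θ := θ)
    (a := fun I => ∑ e : Sig d, ‖redCoeff D W.fn U.fn Z (I, e)‖ₑ ^ 2)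
    hη hδ hηδ hcontr ?_ ?_ hZ ?_ ?_ ?_ ?_ ?_ ?_ N J
  · intro I
    rw [avgProd, lintegral_leftWeight, lintegral_rightWeight, div_volume_pts_mul,
      div_volume_pts_mul, Finset.mul_sum]
    refine Finset.sum_le_sum fun e _ => ?_
    have h := hs_mul_mul_le (W.avg_posDef I.1) (U.avg_posDef I.1) X Y (Z (I, e))
    rw [enorm_sq, ← ENNReal.ofReal_natCast, ← ENNReal.ofReal_mul
      (trForm_nonneg (W.avg_inv_posDef I.1).posSemidef _), ← ENNReal.ofReal_mul (Nat.cast_nonneg (α := ℝ) n),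
      ← ENNReal.ofReal_mul (mul_nonneg (Nat.cast_nonneg (α := ℝ) n) (mul_nonneg
        (trForm_nonneg (W.avg_inv_posDef I.1).posSemidef _)
        (trForm_nonneg (U.avg_posDef I.1).posSemidef _)))]
    refine ENNReal.ofReal_le_ofReal (h.trans ?_)
    rw [mul_assoc (n : ℝ)]
    refine mul_le_mul_of_nonneg_left ?_ (Nat.cast_nonneg n)
    refine mul_le_mul_of_nonneg_right ?_ (sq_nonneg _)
    -- Jensen's inequality replaces (m_I W)⁻¹ by m_I W⁻¹, whose trace form is the average of the
    -- scalar weight tr(X W⁻¹ X*).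
    exact mul_le_mul_of_nonneg_right (W.trForm_inv_avg_le I.1 _)
      (trForm_nonneg (U.avg_posDef I.1).posSemidef _)
  · intro I
    exact (carlSum_eq _ I).ge
  · intro I
    rw [lintegral_leftWeight]
    exact mul_ne_zero (volume_pts_ne_zero _)
      (ENNReal.ofReal_pos.2 (trForm_pos (W.avg_inv_posDef I.1) hX')).ne'
  · intro I
    rw [lintegral_leftWeight]
    exact ENNReal.mul_ne_top (volume_pts_ne_top _) ENNReal.ofReal_ne_top
  · intro I
    rw [lintegral_rightWeight]
    exact mul_ne_zero (volume_pts_ne_zero _)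
      (ENNReal.ofReal_pos.2 (trForm_pos (U.avg_posDef I.1) hY)).ne'
  · intro I
    rw [lintegral_rightWeight]
    exact ENNReal.mul_ne_top (volume_pts_ne_top _) ENNReal.ofReal_ne_top
  · intro I E hE hEI hvol
    rw [← hθ]
    refine setLIntegral_le_of_a2 (aemeasurable_trForm W.aestronglyMeasurable_inv _) ?_
      (Filter.Eventually.of_forall fun x => ENNReal.ofReal_ne_top) hK0 hKt
      ((W_inv_scalar_a2 W I.1 _).trans (by gcongr)) hE hEI hvol
    filter_upwards [W.inv_posDef] with x hx
    exact (ENNReal.ofReal_pos.2 (trForm_pos hx hX')).ne'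
  · intro I E hE hEI hvol
    rw [← hθ]
    refine setLIntegral_le_of_a2 (aemeasurable_trForm U.aestronglyMeasurable _) ?_
      (Filter.Eventually.of_forall fun x => ENNReal.ofReal_ne_top) hK0 hKt
      ((W_scalar_a2 U I.1 _).trans (by gcongr)) hE hEI hvol
    filter_upwards [U.posDef] with x hx
    exact (ENNReal.ofReal_pos.2 (trForm_pos hx hY)).ne'

end MatrixJohnNirenberg

/-! ### Limits of truncated Haar sums -/

section LpLimits

lemma exists_tendsto_eLpNorm {α E : Type*} [MeasurableSpace α] {μ : Measure α}
    [NormedAddCommGroup E] [CompleteSpace E] {p : ℝ≥0∞} (hp : 1 ≤ p) {f : ℕ → α → E}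
    (hf : ∀ N, MemLp (f N) p μ) {ε : ℕ → ℝ≥0∞} (hε : Filter.Tendsto ε Filter.atTop (nhds 0))
    (h : ∀ M N, eLpNorm (f (M + N) - f M) p μ ≤ ε M) :
    ∃ g, MemLp g p μ ∧
      Filter.Tendsto (fun N => eLpNorm (f N - g) p μ) Filter.atTop (nhds 0) := by
  have : Fact (1 ≤ p) := ⟨hp⟩
  have hc : CauchySeq fun N => (hf N).toLp (f N) := by
    rw [EMetric.cauchySeq_iff']
    intro e he
    obtain ⟨M, hM⟩ := (hε.eventually (gt_mem_nhds he)).exists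
    refine ⟨M, fun N hN => ?_⟩
    obtain ⟨k, rfl⟩ := Nat.exists_eq_add_of_le hN
    rw [Lp.edist_toLp_toLp]
    exact (h M k).trans_lt hM
  obtain ⟨g, hg⟩ := cauchySeq_tendsto_of_complete hc
  refine ⟨g, Lp.memLp g, ?_⟩
  rw [← Lp.tendsto_Lp_iff_tendsto_eLpNorm'' f hf g (Lp.memLp g), Lp.toLp_coeFn]
  exact hg

lemma ae_eq_of_tendsto_eLpNorm {α E : Type*} [MeasurableSpace α] {μ : Measure α}
    [NormedAddCommGroup E] {p : ℝ≥0∞} (hp : 1 ≤ p) {f : ℕ → α → E}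
    (hf : ∀ N, MemLp (f N) p μ) {g g' : α → E} (hg : MemLp g p μ) (hg' : MemLp g' p μ)
    (h : Filter.Tendsto (fun N => eLpNorm (f N - g) p μ) Filter.atTop (nhds 0))
    (h' : Filter.Tendsto (fun N => eLpNorm (f N - g') p μ) Filter.atTop (nhds 0)) :
    g =ᵐ[μ] g' := by
  have : Fact (1 ≤ p) := ⟨hp⟩
  rw [← MemLp.toLp_eq_toLp_iff hg hg']
  rw [← Lp.tendsto_Lp_iff_tendsto_eLpNorm'' f hf g hg] at h
  rw [← Lp.tendsto_Lp_iff_tendsto_eLpNorm'' f hf g' hg'] at h'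
  exact tendsto_nhds_unique h h'

lemma eLpNorm_ofReal {α E : Type*} [MeasurableSpace α] {μ : Measure α} [NormedAddCommGroup E]
    {p : ℝ} (hp : 0 < p) (f : α → E) :
    eLpNorm f (ENNReal.ofReal p) μ = (∫⁻ x, ‖f x‖ₑ ^ p ∂μ) ^ (1 / p) := by
  rw [eLpNorm_eq_lintegral_rpow_enorm_toReal (ENNReal.ofReal_pos.2 hp).ne' ENNReal.ofReal_ne_top,
    ENNReal.toReal_ofReal hp.le]

end LpLimits

/-! ### Local L^p sums of a Haar series -/

section HaarLimit

variable {d n : ℕ} [NeZero d] {D : DyadicGrid d}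

instance (J : Cube d) : IsFiniteMeasure (volume.restrict J.pts) :=
  ⟨by rw [Measure.restrict_apply_univ]; exact (volume_pts_ne_top J).lt_top⟩

/-- `f J` is the `L^p` limit on `J` of the truncations of the Haar series below `J`. -/
structure IsHaarLimit (g : HaarIdx D → Mat n) (p : ℝ≥0∞) (f : D.cubes → Pt d → Mat n) : Prop where
  memLp_haarSum : ∀ N (J : D.cubes), MemLp (haarSum g N J) p (volume.restrict J.1.pts)
  memLp : ∀ J : D.cubes, MemLp (f J) p (volume.restrict J.1.pts)
  tendsto : ∀ J : D.cubes, Filter.Tendsto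
    (fun N => eLpNorm (haarSum g N J - f J) p (volume.restrict J.1.pts)) Filter.atTop (nhds 0)

/-- By `haarSum_cut`, bounds for cut coefficients that tend to zero make the truncations Cauchy in
L^p. -/
lemma exists_isHaarLimit {g : HaarIdx D → Mat n} {p : ℝ} (hp : 1 ≤ p)
    (hfin : ∀ N (J : D.cubes), ∫⁻ x in J.1.pts, ‖haarSum g N J x‖ₑ ^ p ≠ ∞)
    {ε : ℕ → D.cubes → ℝ≥0∞} (hε : ∀ J, Filter.Tendsto (fun M => ε M J) Filter.atTop (nhds 0))
    (h : ∀ M N (J : D.cubes),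
      ∫⁻ x in J.1.pts, ‖haarSum (cut g (J.1.side / 2 ^ M)) N J x‖ₑ ^ p ≤ ε M J) :
    ∃ f, IsHaarLimit g (ENNReal.ofReal p) f := by
  have hp0 : 0 < p := by linarith
  have hmem : ∀ N (J : D.cubes),
      MemLp (haarSum g N J) (ENNReal.ofReal p) (volume.restrict J.1.pts) := fun N J => by
    refine ⟨haarSum_aestronglyMeasurable g N J, ?_⟩
    rw [eLpNorm_ofReal hp0]
    exact ENNReal.rpow_lt_top_of_nonneg (by positivity) (hfin N J)
  have hex : ∀ J : D.cubes, ∃ f, MemLp f (ENNReal.ofReal p) (volume.restrict J.1.pts) ∧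
      Filter.Tendsto (fun N => eLpNorm (haarSum g N J - f) (ENNReal.ofReal p)
        (volume.restrict J.1.pts)) Filter.atTop (nhds 0) := fun J => by
    refine exists_tendsto_eLpNorm (ENNReal.one_le_ofReal.2 hp) (fun N => hmem N J)
      (ε := fun M => ε M J ^ (1 / p)) ?_ fun M N => ?_
    · have := ((ENNReal.continuous_rpow_const (y := 1 / p)).tendsto 0).comp (hε J)
      rwa [ENNReal.zero_rpow_of_pos (by positivity)] at this
    · rw [eLpNorm_ofReal hp0]
      gcongr
      refine le_trans (le_of_eq ?_) (h M (M + N) J)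
      refine setLIntegral_congr_fun (measurableSet_pts _) fun x hx => ?_
      simp only [Pi.sub_apply]
      rw [haarSum_cut g M N J hx]
  choose f hf hf' using hex
  exact ⟨f, hmem, hf, hf'⟩

namespace IsHaarLimit

variable {g : HaarIdx D → Mat n} {p : ℝ≥0∞} {f : D.cubes → Pt d → Mat n}

lemma integrableOn (h : IsHaarLimit g p f) (hp : 1 ≤ p) (J : D.cubes) :
    IntegrableOn (f J) J.1.pts := (h.memLp J).integrable hp

/-- The recursion defining `haarSum` passes to the limit: both sides are L^p limits of the same
truncations on the child. -/
lemma ae_eq_child (h : IsHaarLimit g p f) (hp : 1 ≤ p) (J : D.cubes) (b : Fin d → Bool) :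
    ∀ᵐ x ∂volume.restrict (DyadicGrid.child J b).1.pts,
      f J x = blockVal g J b + f (DyadicGrid.child J b) x := by
  set C := DyadicGrid.child J b with hCdef
  have hCJ : C.1.pts ⊆ J.1.pts := J.1.child_subset b
  have hle : volume.restrict C.1.pts ≤ volume.restrict J.1.pts :=
    Measure.restrict_mono hCJ le_rfl
  have hsum : ∀ N, ∀ x ∈ C.1.pts, haarSum g (N + 1) J x = blockVal g J b + haarSum g N C x :=
    fun N x hx => haarSum_succ_of_mem g N J hx
  clear_value C
  have hmem : MemLp (fun x => blockVal g J b + f C x) p (volume.restrict C.1.pts) :=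
    (memLp_const (blockVal g J b)).add (h.memLp C)
  refine ae_eq_of_tendsto_eLpNorm hp (f := fun N => haarSum g (N + 1) J)
    (fun N => (h.memLp_haarSum (N + 1) J).mono_measure hle) ((h.memLp J).mono_measure hle) hmem
    ?_ ?_
  · exact tendsto_of_tendsto_of_tendsto_of_le_of_le tendsto_const_nhds
      ((Filter.tendsto_add_atTop_iff_nat 1).2 (h.tendsto J)) (fun _ => zero_le)
      fun N => eLpNorm_mono_measure _ hle
  · refine (h.tendsto C).congr fun N => eLpNorm_congr_ae ?_
    filter_upwards [ae_restrict_mem (measurableSet_pts _)] with x hx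
    simp only [Pi.sub_apply]
    rw [hsum N x hx, add_sub_add_left_eq_sub]

lemma integral_haarSum (g : HaarIdx D → Mat n) (N : ℕ) (J : D.cubes) :
    ∫ x in J.1.pts, haarSum g N J x = 0 := by
  induction N generalizing J with
  | zero => simp [haarSum]
  | succ N ih =>
    rw [← J.1.sum_integral_child (haarSum_integrable g (N + 1) J)]
    have h1 : ∀ b, ∫ x in (J.1.child b).pts, haarSum g (N + 1) J x =
        (volume.real J.1.pts / 2 ^ d) • blockVal g J b := fun b => by
      have h2 : Integrable (haarSum g N (DyadicGrid.child J b))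
          (volume.restrict (J.1.child b).pts) := haarSum_integrable g N (DyadicGrid.child J b)
      have h3 : ∫ x in (J.1.child b).pts, haarSum g N (DyadicGrid.child J b) x = 0 :=
        ih (DyadicGrid.child J b)
      rw [setIntegral_congr_fun (measurableSet_pts _)
        (fun x hx => haarSum_succ_of_mem g N J hx)]
      refine (integral_add (integrable_const (blockVal g J b)) h2).trans ?_
      rw [h3, setIntegral_const, add_zero, ← J.1.volumeReal_child b]
      congr 1
      field_simp
    simp only [h1, ← Finset.smul_sum, blockVal]
    rw [Finset.sum_comm]
    simp only [← Finset.sum_smul, sum_sgn]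
    simp

lemma integral_eq_zero (h : IsHaarLimit g p f) (hp : 1 ≤ p) (J : D.cubes) :
    ∫ x in J.1.pts, f J x = 0 := by
  have ht : Filter.Tendsto (fun N => ∫ x in J.1.pts, haarSum g N J x) Filter.atTop
      (nhds (∫ x in J.1.pts, f J x)) := by
    refine tendsto_integral_of_L1' (f J) (h.integrableOn hp J).1
      (Filter.Eventually.of_forall fun N => haarSum_integrable g N J) ?_
    have h1 : ∀ N, eLpNorm (haarSum g N J - f J) 1 (volume.restrict J.1.pts) ≤
        eLpNorm (haarSum g N J - f J) p (volume.restrict J.1.pts) *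
          volume.restrict J.1.pts Set.univ ^ (1 / (1 : ℝ≥0∞).toReal - 1 / p.toReal) := fun N =>
      eLpNorm_le_eLpNorm_mul_rpow_measure_univ hp
        ((h.memLp_haarSum N J).sub (h.memLp J)).1
    refine tendsto_of_tendsto_of_tendsto_of_le_of_le tendsto_const_nhds ?_
      (fun _ => zero_le) h1
    have h2 := ENNReal.Tendsto.mul_const (h.tendsto J)
      (b := volume.restrict J.1.pts Set.univ ^ (1 / (1 : ℝ≥0∞).toReal - 1 / p.toReal))
      (Or.inr (ENNReal.rpow_ne_top_of_ne_zero (by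
        rw [Measure.restrict_apply_univ]; exact volume_pts_ne_zero _) (by
        rw [Measure.restrict_apply_univ]; exact volume_pts_ne_top _)))
    rwa [zero_mul] at h2
  simp only [integral_haarSum] at ht
  exact (tendsto_nhds_unique ht tendsto_const_nhds)

/-- The multiplied truncations differ from the multiplied limit by at most ‖X‖ ‖Y‖ times an L^p
distance tending to zero, so a bound uniform in N passes to the limit. X and Y may thus be chosen
separately for each cube. -/
lemma eLpNorm_mul_le (h : IsHaarLimit g p f) (hp : 1 ≤ p) (J : D.cubes) (X Y : Mat n) {c : ℝ≥0∞}
    (hc : ∀ N, eLpNorm (haarSum (fun q => X * g q * Y) N J) p (volume.restrict J.1.pts) ≤ c) :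
    eLpNorm (fun x => X * f J x * Y) p (volume.restrict J.1.pts) ≤ c := by
  have hmul : ∀ {F : Pt d → Mat n}, AEStronglyMeasurable F (volume.restrict J.1.pts) →
      AEStronglyMeasurable (fun x => X * F x * Y) (volume.restrict J.1.pts) := fun hF =>
    (Continuous.comp_aestronglyMeasurable (g := fun Z : Mat n => X * Z * Y) (by fun_prop) hF)
  have h1 : ∀ N, eLpNorm (fun x => X * f J x * Y) p (volume.restrict J.1.pts) ≤
      c + ENNReal.ofReal (‖X‖ * ‖Y‖) *
        eLpNorm (haarSum g N J - f J) p (volume.restrict J.1.pts) := by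
    intro N
    have hs := (h.memLp_haarSum N J).1
    calc eLpNorm (fun x => X * f J x * Y) p (volume.restrict J.1.pts)
        = eLpNorm ((fun x => X * haarSum g N J x * Y) -
            fun x => X * (haarSum g N J - f J) x * Y) p (volume.restrict J.1.pts) := by
          congr 1
          funext x
          simp only [Pi.sub_apply]
          noncomm_ring
      _ ≤ eLpNorm (fun x => X * haarSum g N J x * Y) p (volume.restrict J.1.pts) +
          eLpNorm (fun x => X * (haarSum g N J - f J) x * Y) p (volume.restrict J.1.pts) :=
          eLpNorm_sub_le (hmul hs) (hmul (hs.sub (h.memLp J).1)) hp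
      _ ≤ _ := by
          refine add_le_add ?_ ?_
          · refine le_trans (le_of_eq (eLpNorm_congr_ae ?_)) (hc N)
            filter_upwards [ae_restrict_mem (measurableSet_pts _)] with x hx
            exact (haarSum_mul g X Y N J hx).symm
          · refine eLpNorm_le_mul_eLpNorm_of_ae_le_mul (Filter.Eventually.of_forall fun x => ?_) p
            calc ‖X * (haarSum g N J - f J) x * Y‖
                ≤ ‖X‖ * ‖(haarSum g N J - f J) x‖ * ‖Y‖ :=
                  (norm_mul_le _ _).trans (by gcongr; exact norm_mul_le _ _)
              _ = _ := by ring
  have h2 : Filter.Tendsto (fun N => c + ENNReal.ofReal (‖X‖ * ‖Y‖) *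
      eLpNorm (haarSum g N J - f J) p (volume.restrict J.1.pts)) Filter.atTop (nhds c) := by
    have := (ENNReal.Tendsto.const_mul (a := ENNReal.ofReal (‖X‖ * ‖Y‖)) (h.tendsto J)
      (Or.inr ENNReal.ofReal_ne_top)).const_add c
    simpa using this
  exact ge_of_tendsto' h2 h1

end IsHaarLimit

end HaarLimit

/-! ### Convergence of Haar series with Carleson coefficients -/

section Carleson

variable {d n : ℕ} [NeZero d] [NeZero n] {D : DyadicGrid d}

omit [NeZero d] [NeZero n] in
lemma redCoeff_cut (W U : Pt d → Mat n) (Z : HaarIdx D → Mat n) (s : ℝ) (p : HaarIdx D) :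
    ‖redCoeff D W U (cut Z s) p‖ₑ ^ 2 = cut (fun p => ‖redCoeff D W U Z p‖ₑ ^ 2) s p := by
  unfold redCoeff cut
  split_ifs <;> simp

omit [NeZero d] in
lemma carlSum_cut_le (z : HaarIdx D → ℝ≥0∞) (s : ℝ) (J : Cube d) :
    carlSum (cut z s) J ≤ carlSum z J :=
  ENNReal.tsum_le_tsum fun p => by unfold cut; split_ifs <;> simp

/-- Carleson coefficients sum, below each cube, to functions in a common `L^{1+δ}`, with the
John–Nirenberg bound. -/
theorem exists_haarLimit_of_carleson (D : DyadicGrid d) (W U : A2Weight d n)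
    (Z : HaarIdx D → Mat n) {M : ℝ≥0∞} (hM : M ≠ ∞)
    (hZ : ∀ J : D.cubes, carlSum (fun p => ‖redCoeff D W.fn U.fn Z p‖ₑ ^ 2) J.1 ≤
      M * volume J.1.pts) :
    ∃ η δ : ℝ, 0 < η ∧ 0 < δ ∧ 2 * η + δ = 1 ∧ ∃ K : ℝ≥0∞, K ≠ ∞ ∧ ∃ f : D.cubes → Pt d → Mat n,
      IsHaarLimit Z (ENNReal.ofReal (1 + δ)) f ∧
      ∀ X Y : Mat n, X ≠ 0 → Y ≠ 0 → ∀ J : D.cubes,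
        ∫⁻ x in J.1.pts, ‖X * f J x * Y‖ₑ ^ (1 + δ) ≤
          K * jnBound (leftWeight W X) (rightWeight U Y)
            (fun I : D.cubes => carlSum (fun p => ‖redCoeff D W.fn U.fn Z p‖ₑ ^ 2) I.1) η δ J := by
  obtain ⟨η, δ, hη, hδ, hηδ, h⟩ := exists_lintegral_haarSum_le D W U
  obtain ⟨K, hK, h⟩ := h M hM
  refine ⟨η, δ, hη, hδ, hηδ, K, hK, ?_⟩
  have hp0 : 0 < 1 + δ := by linarith
  have hp1 : 1 ≤ ENNReal.ofReal (1 + δ) := ENNReal.one_le_ofReal.2 (by linarith)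
  set A : D.cubes → ℝ≥0∞ := fun I => carlSum (fun p => ‖redCoeff D W.fn U.fn Z p‖ₑ ^ 2) I.1
    with hA
  have hAt : ∀ J, A J ≠ ∞ := fun J =>
    ne_top_of_le_ne_top (ENNReal.mul_ne_top hM (volume_pts_ne_top _)) (hZ J)
  set w := leftWeight W (1 : Mat n)
  set u := rightWeight U (1 : Mat n)
  have hwt : ∀ J : Cube d, ∫⁻ x in J.pts, w x ≠ ∞ := fun J => by
    rw [lintegral_leftWeight]
    exact ENNReal.mul_ne_top (volume_pts_ne_top _) ENNReal.ofReal_ne_top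
  have hut : ∀ J : Cube d, ∫⁻ x in J.pts, u x ≠ ∞ := fun J => by
    rw [lintegral_rightWeight]
    exact ENNReal.mul_ne_top (volume_pts_ne_top _) ENNReal.ofReal_ne_top
  -- The John–Nirenberg bound for X = Y = 1 without its Carleson factor. It does not depend on the
  -- coefficients, so the bound for cut coefficients is c times the δ-th power of a Carleson tail,
  -- which tends to zero.
  set c : D.cubes → ℝ≥0∞ := fun J => K * (avgProd w u J.1 ^ δ *
    ((∫⁻ x in J.1.pts, w x) ^ η * (∫⁻ x in J.1.pts, u x) ^ η)) with hc
  have hct : ∀ J, c J ≠ ∞ := fun J => by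
    refine ENNReal.mul_ne_top hK (ENNReal.mul_ne_top
      (ENNReal.rpow_ne_top_of_nonneg hδ.le (ENNReal.mul_ne_top
        (ENNReal.div_ne_top (hwt _) (volume_pts_ne_zero _))
        (ENNReal.div_ne_top (hut _) (volume_pts_ne_zero _))))
      (ENNReal.mul_ne_top (ENNReal.rpow_ne_top_of_nonneg hη.le (hwt _))
        (ENNReal.rpow_ne_top_of_nonneg hη.le (hut _))))
  have key : ∀ Z' : HaarIdx D → Mat n,
      (∀ J : D.cubes, carlSum (fun p => ‖redCoeff D W.fn U.fn Z' p‖ₑ ^ 2) J.1 ≤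
        M * volume J.1.pts) → ∀ N (J : D.cubes),
      ∫⁻ x in J.1.pts, ‖haarSum Z' N J x‖ₑ ^ (1 + δ) ≤
        c J * carlSum (fun p => ‖redCoeff D W.fn U.fn Z' p‖ₑ ^ 2) J.1 ^ δ := by
    intro Z' hZ' N J
    have := h Z' hZ' 1 1 one_ne_zero one_ne_zero N J
    simp only [Matrix.one_mul, Matrix.mul_one, jnBound] at this
    refine this.trans (le_of_eq ?_)
    rw [hc]
    ring
  obtain ⟨f, hf⟩ := exists_isHaarLimit (g := Z) (p := 1 + δ) (by linarith)
    (ε := fun m J => c J * carlSum (cut (fun p => ‖redCoeff D W.fn U.fn Z p‖ₑ ^ 2)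
      (J.1.side / 2 ^ m)) J.1 ^ δ)
    (fun N J => ne_top_of_le_ne_top (ENNReal.mul_ne_top (hct J)
      (ENNReal.rpow_ne_top_of_nonneg hδ.le (hAt J))) (key Z hZ N J))
    (fun J => by
      have h1 := ((ENNReal.continuous_rpow_const (y := δ)).tendsto 0).comp
        (tendsto_carlSum_cut (hAt J) J.1.side)
      rw [ENNReal.zero_rpow_of_pos hδ] at h1
      have := ENNReal.Tendsto.const_mul (a := c J) h1 (Or.inr (hct J))
      rwa [mul_zero] at this)
    (fun m N J => by
      refine (key (cut Z (J.1.side / 2 ^ m)) (fun I => ?_) N J).trans (le_of_eq ?_)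
      · simp only [redCoeff_cut]
        exact (carlSum_cut_le _ _ _).trans (hZ I)
      · simp only [redCoeff_cut])
  refine ⟨f, hf, fun X Y hX hY J => ?_⟩
  have h1 := hf.eLpNorm_mul_le hp1 J X Y (c := (K * jnBound (leftWeight W X) (rightWeight U Y)
    A η δ J) ^ (1 / (1 + δ))) (fun N => by
      rw [eLpNorm_ofReal hp0]
      gcongr
      exact h Z hZ X Y hX hY N J)
  rw [eLpNorm_ofReal hp0] at h1
  exact (ENNReal.rpow_le_rpow_iff (by positivity)).1 h1

end Carleson

/-! ### A function with prescribed Haar coefficients -/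

section Gluing

variable {d n : ℕ} [NeZero d] {D : DyadicGrid d}

lemma DyadicGrid.child_injective {J J' : D.cubes} {b b' : Fin d → Bool}
    (h : DyadicGrid.child J b = DyadicGrid.child J' b') : J = J' ∧ b = b' := by
  have hmem : (DyadicGrid.child J b).1.corner ∈ (J.1.child b).pts :=
    (DyadicGrid.child J b).1.corner_mem
  have hmem' : (DyadicGrid.child J b).1.corner ∈ (J'.1.child b').pts := by
    rw [h]; exact (DyadicGrid.child J' b').1.corner_mem
  have hside : J.1.side = J'.1.side := by
    have h1 := congrArg (fun I : D.cubes => I.1.side) h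
    simp only [child_side] at h1
    linarith
  obtain rfl : J = J' := Subtype.ext (DyadicGrid.eq_of_side_eq J.2 J'.2 hside
    (J.1.child_subset b hmem) (J'.1.child_subset b' hmem'))
  refine ⟨rfl, ?_⟩
  rw [Cube.mem_child_iff] at hmem hmem'
  exact hmem.2.symm.trans hmem'.2

/-- The constants that make the local sums of a Haar series compatible. -/
lemma exists_compatible_const (g : HaarIdx D → Mat n) :
    ∃ u : D.cubes → Mat n, ∀ (J : D.cubes) (b : Fin d → Bool),
      u (DyadicGrid.child J b) = u J + blockVal g J b := by
  have hpar : ∀ I : D.cubes, ∃ (J : D.cubes) (b : Fin d → Bool), I = DyadicGrid.child J b := by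
    intro I
    obtain ⟨J, hJ, b, h⟩ := DyadicGrid.exists_parent I.2
    exact ⟨⟨J, hJ⟩, b, Subtype.ext h⟩
  choose par lab hpar using hpar
  choose lev hlev using fun I : D.cubes => D.side_eq I.1 I.2
  have hpc : ∀ J b, par (DyadicGrid.child J b) = J := fun J b =>
    (DyadicGrid.child_injective (hpar (DyadicGrid.child J b))).1.symm
  have hlc : ∀ J b, lab (DyadicGrid.child J b) = b := fun J b =>
    (DyadicGrid.child_injective (hpar (DyadicGrid.child J b))).2.symm
  have hvc : ∀ J b, lev (DyadicGrid.child J b) = lev J - 1 := by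
    intro J b
    have h1 : (2 : ℝ) ^ lev (DyadicGrid.child J b) = 2 ^ (lev J - 1) := by
      rw [← hlev, child_side, hlev, zpow_sub_one₀ two_ne_zero, div_eq_mul_inv]
    exact zpow_right_injective₀ two_pos (by norm_num) h1
  -- The constants should be sums of block values over all ancestors, which need not converge. A
  -- linear left inverse of the embedding of constants into germs at infinity acts as a generalized
  -- limit; its existence is pure linear algebra.
  let ι : Mat n →ₗ[ℂ] Filter.Germ (Filter.atTop : Filter ℕ) (Mat n) :=
    { toFun := fun c => (c : Filter.Germ (Filter.atTop : Filter ℕ) (Mat n))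
      map_add' := fun _ _ => rfl
      map_smul' := fun _ _ => rfl }
  obtain ⟨L, hL⟩ := ι.exists_leftInverse_of_injective
    (LinearMap.ker_eq_bot.2 fun a b h => Filter.Germ.const_inj.1 h)
  have hL' : ∀ c : Mat n, L (c : Filter.Germ (Filter.atTop : Filter ℕ) (Mat n)) = c := fun c =>
    LinearMap.congr_fun hL c
  let H : D.cubes → Mat n := fun C => blockVal g (par C) (lab C)
  let seq : D.cubes → ℕ → Mat n := fun I k => ∑ j ∈ Finset.range (k - lev I).toNat, H (par^[j] I)
  refine ⟨fun I => L (seq I : Filter.Germ (Filter.atTop : Filter ℕ) (Mat n)), fun J b => ?_⟩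
  have hseq : (seq (DyadicGrid.child J b) : Filter.Germ (Filter.atTop : Filter ℕ) (Mat n)) =
      (seq J : Filter.Germ (Filter.atTop : Filter ℕ) (Mat n)) +
        ((blockVal g J b : Mat n) : Filter.Germ (Filter.atTop : Filter ℕ) (Mat n)) := by
    refine Filter.Germ.coe_eq.2 ?_
    -- From the level of J onwards the sum for a child has exactly one term more than that for J,
    -- its own block value; smaller k, where `toNat` truncates, do not affect the germ.
    filter_upwards [Filter.eventually_ge_atTop (lev J).toNat] with k hk
    have h1 : ((k : ℤ) - lev (DyadicGrid.child J b)).toNat = ((k : ℤ) - lev J).toNat + 1 := by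
      rw [hvc]; omega
    simp only [seq, h1, Finset.sum_range_succ', Function.iterate_succ_apply, hpc,
      Function.iterate_zero, id, H, hlc]
  beta_reduce
  rw [hseq, map_add, hL']

omit [NeZero d] in
/-- A neighbourhood of each point is covered by finitely many unit cubes of the grid. -/
lemma locallyIntegrable_of_unit_cubes {E : Type*} [NormedAddCommGroup E] {B : Pt d → E}
    (h : ∀ I ∈ D.cubes, IntegrableOn B I.pts) : LocallyIntegrable B volume := by
  intro x
  choose Q hQ _ using fun y : Pt d => D.partition 0 y
  -- A half-open unit cube meeting the ball of radius 1/2 about x contains one of the 2^d points x ±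
  -- 1/2, so the cubes through these points cover the ball.
  let v : (Fin d → Bool) → Pt d := fun b i => if b i then x i + 1 / 2 else x i - 1 / 2
  refine ⟨⋃ b, (Q (v b)).pts, ?_, ?_⟩
  · refine Filter.mem_of_superset (Metric.ball_mem_nhds x (by norm_num : (0 : ℝ) < 1 / 2)) ?_
    intro y hy
    have hyx : ∀ i, |y i - x i| < 1 / 2 := fun i => by
      rw [← Real.dist_eq]; exact (dist_le_pi_dist y x i).trans_lt hy
    obtain ⟨hyD, hys, hyQ⟩ := hQ y
    rw [zpow_zero] at hys
    have hv : ∃ b, v b ∈ (Q y).pts := by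
      refine ⟨fun i => decide (x i - 1 / 2 < (Q y).corner i), fun i => ?_⟩
      have h1 := abs_lt.1 (hyx i)
      have h2 := hyQ i
      rw [hys] at h2 ⊢
      simp only [v, decide_eq_true_eq]
      split_ifs with hc
      · exact ⟨by linarith [h2.1], by linarith [h2.1]⟩
      · exact ⟨not_lt.1 hc, by linarith [h2.2]⟩
    obtain ⟨b, hb⟩ := hv
    refine Set.mem_iUnion.2 ⟨b, ?_⟩
    have h3 := hQ (v b)
    rw [DyadicGrid.eq_of_side_eq h3.1 hyD (by rw [h3.2.1, hys, zpow_zero]) h3.2.2 hb]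
    exact hyQ
  · exact integrableOn_finite_iUnion.2 fun b => h _ (hQ (v b)).1

namespace IsHaarLimit

variable {g : HaarIdx D → Mat n} {p : ℝ≥0∞} {f : D.cubes → Pt d → Mat n}

/-- The local sums of a Haar series differ by constants from one global function. -/
theorem exists_eq_add_const (h : IsHaarLimit g p f) (hp : 1 ≤ p) :
    ∃ (B : Pt d → Mat n) (u : D.cubes → Mat n), LocallyIntegrable B volume ∧
      ∀ I : D.cubes, ∀ᵐ x ∂volume.restrict I.1.pts, B x = f I x + u I := by
  obtain ⟨u, hu⟩ := exists_compatible_const g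
  choose Q hQ hQ' using fun y : Pt d => D.partition 0 y
  -- B is prescribed on the unit cubes. The identity is carried to smaller and larger cubes by
  -- `ae_eq_child` and the compatibility of the constants.
  let B : Pt d → Mat n := fun x => f ⟨Q x, (hQ x).1⟩ x + u ⟨Q x, (hQ x).1⟩
  have hunit : ∀ I : D.cubes, I.1.side = 1 →
      ∀ᵐ x ∂volume.restrict I.1.pts, B x = f I x + u I := by
    intro I hI
    filter_upwards [ae_restrict_mem (measurableSet_pts _)] with x hx
    have : (⟨Q x, (hQ x).1⟩ : D.cubes) = I :=
      Subtype.ext (hQ' x I.1 ⟨I.2, by rw [hI, zpow_zero], hx⟩).symm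
    simp only [B, this]
  have hdown : ∀ (m : ℕ) (I : D.cubes), 2 ^ m * I.1.side = 1 →
      ∀ᵐ x ∂volume.restrict I.1.pts, B x = f I x + u I := by
    intro m
    induction m with
    | zero => intro I hI; exact hunit I (by simpa using hI)
    | succ m ih =>
      intro I hI
      obtain ⟨J, hJ, b, hIJ⟩ := DyadicGrid.exists_parent I.2
      obtain rfl : I = DyadicGrid.child ⟨J, hJ⟩ b := Subtype.ext hIJ
      rw [child_side] at hI
      have h1 := ih ⟨J, hJ⟩ (by rw [← hI, pow_succ]; ring)
      have h2 := h.ae_eq_child hp ⟨J, hJ⟩ b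
      filter_upwards [h2, ae_mono (Measure.restrict_mono
        (show (DyadicGrid.child ⟨J, hJ⟩ b).1.pts ⊆ J.pts from J.child_subset b) le_rfl) h1]
        with x hx hx'
      rw [hx', hx, hu]
      abel
  have hup : ∀ (m : ℕ) (I : D.cubes), I.1.side = 2 ^ m →
      ∀ᵐ x ∂volume.restrict I.1.pts, B x = f I x + u I := by
    intro m
    induction m with
    | zero => intro I hI; exact hunit I (by simpa using hI)
    | succ m ih =>
      intro I hI
      rw [← I.1.iUnion_child, ae_restrict_iUnion_iff]
      intro b
      have h1 := ih (DyadicGrid.child I b) (by rw [child_side, hI, pow_succ]; ring)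
      filter_upwards [h.ae_eq_child hp I b, h1] with x hx hx'
      rw [hx', hx, hu]
      abel
  have hall : ∀ I : D.cubes, ∀ᵐ x ∂volume.restrict I.1.pts, B x = f I x + u I := by
    intro I
    obtain ⟨k, hk⟩ := D.side_eq I.1 I.2
    obtain ⟨m, rfl | rfl⟩ := k.eq_nat_or_neg
    · exact hup m I (by rw [hk, zpow_natCast])
    · exact hdown m I (by rw [hk, zpow_neg, zpow_natCast]; exact mul_inv_cancel₀ (by positivity))
  refine ⟨B, u, locallyIntegrable_of_unit_cubes (D := D) fun I hI => ?_, hall⟩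
  exact ((h.integrableOn hp ⟨I, hI⟩).add (integrable_const (u ⟨I, hI⟩))).congr
    (Filter.EventuallyEq.symm (hall ⟨I, hI⟩))

variable {B : Pt d → Mat n} {u : D.cubes → Mat n}

/-- On each child the limit f has mean zero, so the integral of B sees only the block value and a
constant common to all children; orthogonality of signs then extracts the coefficient. -/
lemma haarCoeff_eq_of_ae (h : IsHaarLimit g p f) (hp : 1 ≤ p)
    (hB : ∀ I : D.cubes, ∀ᵐ x ∂volume.restrict I.1.pts, B x = f I x + u I) (q : HaarIdx D) :
    haarCoeff D B q = g q := by
  classical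
  obtain ⟨I, e⟩ := q
  have hfI := h.integrableOn hp I
  have hBI : IntegrableOn B I.1.pts := (hfI.add (integrable_const (u I))).congr
    (Filter.EventuallyEq.symm (hB I))
  have h1 : ∀ b, ∫ x in (I.1.child b).pts, B x =
      (volume.real I.1.pts / 2 ^ d) • (blockVal g I b + u I) := by
    intro b
    have hfC : Integrable (f (DyadicGrid.child I b)) (volume.restrict (I.1.child b).pts) :=
      h.integrableOn hp (DyadicGrid.child I b)
    have h2 : ∀ᵐ x ∂volume.restrict (I.1.child b).pts,
        B x = (blockVal g I b + u I) + f (DyadicGrid.child I b) x := by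
      filter_upwards [h.ae_eq_child hp I b,
        ae_mono (Measure.restrict_mono (I.1.child_subset b) le_rfl) (hB I)] with x hx hx'
      rw [hx', hx]
      abel
    have h3 : ∫ x in (I.1.child b).pts, f (DyadicGrid.child I b) x = 0 :=
      h.integral_eq_zero hp (DyadicGrid.child I b)
    rw [integral_congr_ae h2]
    refine (integral_add (integrable_const _) hfC).trans ?_
    rw [h3, add_zero, setIntegral_const, ← I.1.volumeReal_child b]
    congr 1
    field_simp
  rw [haarCoeff_eq B (I, e) hBI]
  have h4 : ∑ b, sgn e.1 b • blockVal g I b = (haarScale I.1 * 2 ^ d) • g (I, e) := by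
    simp only [blockVal, Finset.smul_sum]
    rw [Finset.sum_comm]
    have h5 : ∀ e' : Sig d, ∑ b, sgn e.1 b • haarScale I.1 • sgn e'.1 b • g (I, e') =
        if e = e' then (haarScale I.1 * 2 ^ d) • g (I, e') else 0 := by
      intro e'
      have : ∀ b, sgn e.1 b • haarScale I.1 • sgn e'.1 b • g (I, e') =
          (haarScale I.1 * (sgn e.1 b * sgn e'.1 b)) • g (I, e') := fun b => by
        rw [smul_smul, smul_smul]; congr 1; ring
      simp only [this, ← Finset.sum_smul, ← Finset.mul_sum, sum_sgn_mul_sgn']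
      by_cases hee : e = e'
      · subst hee; simp
      · have : e.1 ≠ e'.1 := fun h => hee (Subtype.ext h)
        simp [this, hee]
    simp only [h5]
    simp
  simp only [h1]
  have h6 : ∑ b, sgn e.1 b • (volume.real I.1.pts / 2 ^ d) • (blockVal g I b + u I) =
      (volume.real I.1.pts / 2 ^ d) • (haarScale I.1 * 2 ^ d) • g (I, e) := by
    rw [← h4]
    simp only [smul_comm _ (volume.real I.1.pts / 2 ^ d), ← Finset.smul_sum, smul_add,
      Finset.sum_add_distrib, ← Finset.sum_smul, sum_sgn, zero_smul, smul_zero, add_zero]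
  rw [h6, smul_smul, smul_smul]
  have h7 := haarScale_sq I.1
  have h8 := (volumeReal_pts_pos I.1).ne'
  have h9 : haarScale I.1 * (volume.real I.1.pts / 2 ^ d) * (haarScale I.1 * 2 ^ d) = 1 := by
    calc _ = haarScale I.1 ^ 2 * volume.real I.1.pts := by field_simp
      _ = 1 := by rw [h7, inv_mul_cancel₀ h8]
  rw [h9, one_smul]

lemma avg_eq_of_ae (h : IsHaarLimit g p f) (hp : 1 ≤ p)
    (hB : ∀ I : D.cubes, ∀ᵐ x ∂volume.restrict I.1.pts, B x = f I x + u I) (I : D.cubes) :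
    avg I.1 B = u I := by
  rw [avg_eq, integral_congr_ae (hB I)]
  have : ∫ x in I.1.pts, (f I x + u I) = volume.real I.1.pts • u I := by
    refine (integral_add (h.integrableOn hp I) (integrable_const (u I))).trans ?_
    rw [h.integral_eq_zero hp, zero_add, setIntegral_const]
  rw [this, smul_smul, inv_mul_cancel₀ (volumeReal_pts_pos I.1).ne', one_smul]

end IsHaarLimit

end Gluing

/-! ### Carleson coefficients come from BMO² functions -/

section MemBMO

variable {d n : ℕ} [NeZero d] [NeZero n] {D : DyadicGrid d}

-- BMO² is normalized by m_I(W^{1/2}), the Carleson condition by (m_I W)^{1/2}. Factoring the former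
-- through the latter bounds the average of the left scalar weight uniformly in I.
omit [NeZero d] [NeZero n] in
lemma trForm_avg_inv_avg_sqrt_le (W : A2Weight d n) (I : Cube d) :
    trForm (avg I fun x => (W.fn x)⁻¹) (avg I fun x => CFC.sqrt (W.fn x)) ≤
      n * (a2Char W.fn).toReal * n := by
  set V := avg I fun x => CFC.sqrt (W.fn x)
  set R := CFC.sqrt (avg I W.fn)
  have hR := W.avg_posDef I
  have h1 : V = R * (R⁻¹ * V) := by
    rw [← Matrix.mul_assoc, sqrt_mul_inv hR, Matrix.one_mul]
  have h2 : ‖R⁻¹ * V‖ ^ 2 ≤ n := by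
    have h3 : ‖R⁻¹ * V‖ = ‖V * R⁻¹‖ := by
      rw [← Matrix.l2_opNorm_conjTranspose, Matrix.conjTranspose_mul,
        Matrix.conjTranspose_nonsing_inv, sqrt_isHermitian,
        (W.avg_sqrt_posDef I).isHermitian.eq]
    rw [h3]
    exact W.sq_norm_avg_sqrt_mul_inv_le I
  have hp := (W.avg_inv_posDef I).posSemidef
  rw [h1]
  calc _ ≤ trForm (avg I fun x => (W.fn x)⁻¹) R * ‖R⁻¹ * V‖ ^ 2 := trForm_le hp _ _
    _ ≤ _ := by
      gcongr
      exact trForm_avg_inv_sqrt_le_toReal W I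

/-- **Surjectivity of the Haar expansion**: coefficients satisfying the Carleson condition are
those of a function in `BMO²`. -/
theorem exists_memBMO_of_carleson (D : DyadicGrid d) (W U : A2Weight d n)
    (Z : HaarIdx D → Mat n) {M : ℝ≥0∞} (hM : M ≠ ∞)
    (hZ : ∀ J : D.cubes, carlSum (fun p => ‖redCoeff D W.fn U.fn Z p‖ₑ ^ 2) J.1 ≤
      M * volume J.1.pts) :
    ∃ B : Pt d → Mat n, MemBMO D W.fn U.fn B ∧ haarCoeff D B = Z := by
  obtain ⟨η, δ, hη, hδ, hηδ, K, hK, f, hf, hbd⟩ := exists_haarLimit_of_carleson D W U Z hM hZ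
  have hp1 : 1 ≤ ENNReal.ofReal (1 + δ) := ENNReal.one_le_ofReal.2 (by linarith)
  obtain ⟨B, u, hB, hBu⟩ := hf.exists_eq_add_const hp1
  obtain ⟨C, hC, hCU⟩ := U.exists_norm_sqrt_avg_mul_inv_le
  refine ⟨B, ⟨hB, δ, hδ, ?_⟩, funext (hf.haarCoeff_eq_of_ae hp1 hBu)⟩
  -- These bound, uniformly in I, the averages of the two scalar weights for X = m_I(W^{1/2}) and Y
  -- = (m_I U^{1/2})⁻¹.
  set c₁ : ℝ≥0∞ := ENNReal.ofReal (n * (a2Char W.fn).toReal * n)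
  set c₂ : ℝ≥0∞ := ENNReal.ofReal (n * C ^ 2)
  have hfin : K * ((c₁ * c₂) ^ δ * (c₁ ^ η * c₂ ^ η * M ^ δ)) < ∞ := by
    refine (ENNReal.mul_ne_top hK (ENNReal.mul_ne_top ?_ (ENNReal.mul_ne_top
      (ENNReal.mul_ne_top ?_ ?_) ?_))).lt_top
    · exact ENNReal.rpow_ne_top_of_nonneg hδ.le
        (ENNReal.mul_ne_top ENNReal.ofReal_ne_top ENNReal.ofReal_ne_top)
    · exact ENNReal.rpow_ne_top_of_nonneg hη.le ENNReal.ofReal_ne_top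
    · exact ENNReal.rpow_ne_top_of_nonneg hη.le ENNReal.ofReal_ne_top
    · exact ENNReal.rpow_ne_top_of_nonneg hδ.le hM
  refine lt_of_le_of_lt (iSup₂_le fun I hI => ?_) hfin
  set V := avg I fun y => CFC.sqrt (W.fn y) with hVdef
  set Y := (avg I fun y => CFC.sqrt (U.fn y))⁻¹ with hYdef
  have hV : V.PosDef := W.avg_sqrt_posDef I
  have hY : Y.PosDef := (U.avg_sqrt_posDef I).inv
  have hV0 : V ≠ 0 := fun h => by
    have := hV.isUnit; rw [h] at this; exact not_isUnit_zero this
  have hY0 : Y ≠ 0 := fun h => by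
    have := hY.isUnit; rw [h] at this; exact not_isUnit_zero this
  have hv0 := volume_pts_ne_zero I
  have hvt := volume_pts_ne_top I
  have h1 : ∫⁻ x in I.pts, ‖V * (B x - avg I B) * Y‖ₑ ^ (1 + δ) =
      ∫⁻ x in I.pts, ‖V * f ⟨I, hI⟩ x * Y‖ₑ ^ (1 + δ) := by
    refine lintegral_congr_ae ?_
    filter_upwards [hBu ⟨I, hI⟩] with x hx
    rw [hx, show avg I B = u ⟨I, hI⟩ from hf.avg_eq_of_ae hp1 hBu ⟨I, hI⟩, add_sub_cancel_right]
  have hw : ∫⁻ x in I.pts, leftWeight W V x ≤ volume I.pts * c₁ := by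
    rw [lintegral_leftWeight, hV.isHermitian.eq]
    gcongr
    exact ENNReal.ofReal_le_ofReal (trForm_avg_inv_avg_sqrt_le W I)
  have hu : ∫⁻ x in I.pts, rightWeight U Y x ≤ volume I.pts * c₂ := by
    rw [lintegral_rightWeight]
    gcongr
    rw [trForm_eq_hs (U.avg_posDef I).posSemidef]
    refine ENNReal.ofReal_le_ofReal ((hs_le _).trans ?_)
    gcongr
    exact hCU I
  have ht : avgProd (leftWeight W V) (rightWeight U Y) I ≤ c₁ * c₂ := by
    unfold avgProd
    refine mul_le_mul' ?_ ?_
    · exact ENNReal.div_le_of_le_mul (by rwa [mul_comm])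
    · exact ENNReal.div_le_of_le_mul (by rwa [mul_comm])
  rw [h1]
  calc (volume I.pts)⁻¹ * ∫⁻ x in I.pts, ‖V * f ⟨I, hI⟩ x * Y‖ₑ ^ (1 + δ)
      ≤ (volume I.pts)⁻¹ * (K * ((c₁ * c₂) ^ δ * ((volume I.pts * c₁) ^ η *
        (volume I.pts * c₂) ^ η * (M * volume I.pts) ^ δ))) := by
        gcongr
        refine (hbd V Y hV0 hY0 ⟨I, hI⟩).trans ?_
        unfold jnBound
        gcongr
        exact hZ ⟨I, hI⟩
    _ = (volume I.pts)⁻¹ * (volume I.pts ^ η * volume I.pts ^ η * volume I.pts ^ δ) *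
        (K * ((c₁ * c₂) ^ δ * (c₁ ^ η * c₂ ^ η * M ^ δ))) := by
        rw [ENNReal.mul_rpow_of_nonneg (volume I.pts) c₁ hη.le,
          ENNReal.mul_rpow_of_nonneg (volume I.pts) c₂ hη.le,
          ENNReal.mul_rpow_of_nonneg M _ hδ.le]
        ring
    _ = _ := by
        -- The powers of |I| multiply to |I|^{2η+δ} = |I|, which cancels the normalization.
        rw [← ENNReal.rpow_add_of_nonneg _ _ hη.le hη.le,
          ← ENNReal.rpow_add_of_nonneg _ _ (by linarith) hδ.le, ← two_mul, hηδ, ENNReal.rpow_one,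
          ENNReal.inv_mul_cancel hv0 hvt, one_mul]
    _ ≤ _ := le_rfl

end MemBMO

/-! ### Functions in `BMO²` satisfy the Carleson condition -/

section CarlesonOfBMO

variable {d n : ℕ} [NeZero d] {D : DyadicGrid d}

/-- The stopping-time step: if the energy `e` dominates the sequence `z` down to the cubes where
`v` exceeds the volume, the truncated Carleson sums are controlled by `e` and `v`. -/
lemma carlTrunc_add_le_of_stopping {z : HaarIdx D → ℝ≥0∞} {v e : D.cubes → ℝ≥0∞} {G K : ℝ≥0∞}
    {N : ℕ} (hv : ∀ I, ∑ b, v (DyadicGrid.child I b) ≤ v I)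
    (hz : ∀ I, v I ≤ volume I.1.pts →
      ∑ s : Sig d, z (I, s) + e I ≤ ∑ b, e (DyadicGrid.child I b))
    (he : ∀ I, v I ≤ volume I.1.pts → e I ≤ G * volume I.1.pts)
    (he' : ∀ I, v I ≤ volume I.1.pts → ∀ b,
      e (DyadicGrid.child I b) ≤ G * volume (DyadicGrid.child I b).1.pts)
    (hS : ∀ k < N, ∀ I, carlTrunc z k I ≤ K * volume I.1.pts) {m : ℕ} (hm : m ≤ N) (I : D.cubes)
    (hI : v I ≤ volume I.1.pts) :
    carlTrunc z m I + e I ≤ G * volume I.1.pts + K * v I := by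
  induction m generalizing I with
  | zero =>
    rw [carlTrunc, zero_add]
    exact (he I hI).trans le_self_add
  | succ m ih =>
    have hC : ∀ b, carlTrunc z m (DyadicGrid.child I b) + e (DyadicGrid.child I b) ≤
        G * volume (I.1.child b).pts + K * v (DyadicGrid.child I b) := by
      intro b
      -- On a stopped child the volume is smaller than v, so the inductive bound K |I_b| is paid for
      -- by K v; its energy is still controlled because its parent was not stopped.
      by_cases hb : v (DyadicGrid.child I b) ≤ volume (I.1.child b).pts
      · exact ih (by omega) _ hb
      · rw [add_comm]
        refine add_le_add (he' I hI b) ((hS m (by omega) _).trans ?_)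
        gcongr
        exact (not_le.1 hb).le
    calc carlTrunc z (m + 1) I + e I
        = (∑ s : Sig d, z (I, s) + e I) + ∑ b, carlTrunc z m (DyadicGrid.child I b) := by
          rw [carlTrunc]; ring
      _ ≤ ∑ b, e (DyadicGrid.child I b) + ∑ b, carlTrunc z m (DyadicGrid.child I b) := by
          gcongr; exact hz I hI
      _ = ∑ b, (carlTrunc z m (DyadicGrid.child I b) + e (DyadicGrid.child I b)) := by
          rw [Finset.sum_add_distrib, add_comm]
      _ ≤ ∑ b, (G * volume (I.1.child b).pts + K * v (DyadicGrid.child I b)) :=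
          Finset.sum_le_sum fun b _ => hC b
      _ = G * volume I.1.pts + K * ∑ b, v (DyadicGrid.child I b) := by
          rw [Finset.sum_add_distrib, ← Finset.mul_sum, ← Finset.mul_sum, I.1.sum_volume_child]
      _ ≤ _ := by gcongr; exact hv I

omit [NeZero d] in
lemma haarCoeff_mul_sub {B : Pt d → Mat n} (hB : LocallyIntegrable B volume) (X Y c : Mat n)
    (p : HaarIdx D) :
    haarCoeff D (fun x => X * (B x - c) * Y) p = X * haarCoeff D B p * Y := by
  have h1 : ∀ x, haar p.1.1 p.2.1 x • (X * (B x - c) * Y) =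
      X * (haar p.1.1 p.2.1 x • B x) * Y - haar p.1.1 p.2.1 x • (X * c * Y) := fun x => by
    rw [mul_sub, sub_mul, smul_sub, Matrix.mul_smul, Matrix.smul_mul]
  have hint := integrable_haar_smul p.1.1 p.2.1 hB
  let L : Mat n →L[ℝ] Mat n :=
    { toFun := fun Z => X * Z * Y
      map_add' := fun _ _ => by rw [mul_add, add_mul]
      map_smul' := fun r Z => by simp
      cont := by fun_prop }
  unfold haarCoeff
  simp only [h1]
  refine (integral_sub (L.integrable_comp hint)
    ((integrable_haar p.1.1 p.2.1).smul_const (X * c * Y))).trans ?_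
  rw [integral_smul_const, integral_haar_const p.1.1 p.2, zero_smul, sub_zero]
  exact L.integral_comp_comm hint

/-- Changes the normalization from the small cube (V and V') to a fixed top cube (P and P'), at the
price of two trace forms which the stopping rule keeps bounded. -/
lemma sq_norm_mul_mul_le {V V' P P' : Mat n} (hV : V.PosDef) (hV' : V'.PosDef) (hP : P.PosDef)
    (hP' : P'.PosDef) (Z : Mat n) :
    ‖CFC.sqrt V * Z * (CFC.sqrt V')⁻¹‖ ^ 2 ≤
      trForm V (CFC.sqrt P)⁻¹ * trForm V'⁻¹ (CFC.sqrt P') *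
        hs (CFC.sqrt P * Z * (CFC.sqrt P')⁻¹) := by
  have h1 : CFC.sqrt V * Z * (CFC.sqrt V')⁻¹ = (CFC.sqrt V * (CFC.sqrt P)⁻¹) *
      (CFC.sqrt P * Z * (CFC.sqrt P')⁻¹) * (CFC.sqrt P' * (CFC.sqrt V')⁻¹) := by
    calc CFC.sqrt V * Z * (CFC.sqrt V')⁻¹
        = CFC.sqrt V * ((CFC.sqrt P)⁻¹ * CFC.sqrt P) * Z *
          ((CFC.sqrt P')⁻¹ * CFC.sqrt P') * (CFC.sqrt V')⁻¹ := by
          rw [sqrt_inv_mul hP, sqrt_inv_mul hP']; simp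
      _ = _ := by simp only [Matrix.mul_assoc]
  have h2 := sq_norm_sqrt_mul_le hV.posSemidef (CFC.sqrt P)⁻¹
  have h3 : ‖CFC.sqrt P' * (CFC.sqrt V')⁻¹‖ ^ 2 ≤ trForm V'⁻¹ (CFC.sqrt P') := by
    rw [trForm_inv_eq_hs hV', ← Matrix.l2_opNorm_conjTranspose, Matrix.conjTranspose_mul,
      Matrix.conjTranspose_nonsing_inv, sqrt_isHermitian, sqrt_isHermitian]
    exact sq_norm_le_hs _
  rw [h1]
  calc ‖(CFC.sqrt V * (CFC.sqrt P)⁻¹) * (CFC.sqrt P * Z * (CFC.sqrt P')⁻¹) *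
        (CFC.sqrt P' * (CFC.sqrt V')⁻¹)‖ ^ 2
      ≤ (‖CFC.sqrt V * (CFC.sqrt P)⁻¹‖ * ‖CFC.sqrt P * Z * (CFC.sqrt P')⁻¹‖ *
          ‖CFC.sqrt P' * (CFC.sqrt V')⁻¹‖) ^ 2 := by
        gcongr
        exact (norm_mul_le _ _).trans (by gcongr; exact norm_mul_le _ _)
    _ = ‖CFC.sqrt V * (CFC.sqrt P)⁻¹‖ ^ 2 * ‖CFC.sqrt P' * (CFC.sqrt V')⁻¹‖ ^ 2 *
          ‖CFC.sqrt P * Z * (CFC.sqrt P')⁻¹‖ ^ 2 := by ring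
    _ ≤ _ := by
        gcongr
        · exact mul_nonneg (trForm_nonneg hV.posSemidef _) (trForm_nonneg hV'.inv.posSemidef _)
        · exact trForm_nonneg hV.posSemidef _
        · exact sq_norm_le_hs _

omit [NeZero d] in
/-- Functions in `BMO²` have mean oscillation controlled by the reducing matrices
`(m_I W)^{1/2}` and `(m_I U)^{1/2}`. -/
lemma exists_lintegral_oscillation_le {W U : A2Weight d n} {B : Pt d → Mat n}
    (hB : MemBMO D W.fn U.fn B) :
    ∃ K : ℝ, 0 < K ∧ ∀ I : D.cubes, ∫⁻ x in I.1.pts,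
      ‖CFC.sqrt (avg I.1 W.fn) * (B x - avg I.1 B) * (CFC.sqrt (avg I.1 U.fn))⁻¹‖ₑ ≤
        ENNReal.ofReal K * volume I.1.pts := by
  obtain ⟨-, δ, hδ, hfin⟩ := hB
  obtain ⟨C, hC, hCW⟩ := W.exists_norm_sqrt_avg_mul_inv_le
  set S := ⨆ I ∈ D.cubes, (volume I.pts)⁻¹ * ∫⁻ x in I.pts,
      ‖avg I (fun y => CFC.sqrt (W.fn y)) * (B x - avg I B) *
        (avg I (fun y => CFC.sqrt (U.fn y)))⁻¹‖ₑ ^ (1 + δ) with hS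
  refine ⟨C * Real.sqrt n * (1 + S.toReal) + 1, by positivity, fun I => ?_⟩
  have hv0 := volume_pts_ne_zero I.1
  have hvt := volume_pts_ne_top I.1
  have hSI : ∫⁻ x in I.1.pts, ‖avg I.1 (fun y => CFC.sqrt (W.fn y)) * (B x - avg I.1 B) *
        (avg I.1 (fun y => CFC.sqrt (U.fn y)))⁻¹‖ₑ ^ (1 + δ) ≤ S * volume I.1.pts := by
    have h1 : (volume I.1.pts)⁻¹ * ∫⁻ x in I.1.pts,
        ‖avg I.1 (fun y => CFC.sqrt (W.fn y)) * (B x - avg I.1 B) *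
          (avg I.1 (fun y => CFC.sqrt (U.fn y)))⁻¹‖ₑ ^ (1 + δ) ≤ S :=
      le_iSup₂ (f := fun (I : Cube d) (_ : I ∈ D.cubes) => (volume I.pts)⁻¹ * ∫⁻ x in I.pts,
      ‖avg I (fun y => CFC.sqrt (W.fn y)) * (B x - avg I B) *
        (avg I (fun y => CFC.sqrt (U.fn y)))⁻¹‖ₑ ^ (1 + δ)) I.1 I.2
    calc _ = volume I.1.pts * ((volume I.1.pts)⁻¹ * _) := by
          rw [← mul_assoc, ENNReal.mul_inv_cancel hv0 hvt, one_mul]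
      _ ≤ volume I.1.pts * S := by gcongr
      _ = _ := mul_comm _ _
  set V := avg I.1 (fun y => CFC.sqrt (W.fn y)) with hVdef
  set Y := (avg I.1 (fun y => CFC.sqrt (U.fn y))) with hYdef
  have hV : IsUnit V.det := V.isUnit_iff_isUnit_det.1 (W.avg_sqrt_posDef I.1).isUnit
  have hY : IsUnit Y.det := Y.isUnit_iff_isUnit_det.1 (U.avg_sqrt_posDef I.1).isUnit
  have hpt : ∀ x, ‖CFC.sqrt (avg I.1 W.fn) * (B x - avg I.1 B) *
      (CFC.sqrt (avg I.1 U.fn))⁻¹‖ₑ ≤ ENNReal.ofReal (C * Real.sqrt n) *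
        (1 + ‖V * (B x - avg I.1 B) * Y⁻¹‖ₑ ^ (1 + δ)) := by
    intro x
    have h1 : CFC.sqrt (avg I.1 W.fn) * (B x - avg I.1 B) * (CFC.sqrt (avg I.1 U.fn))⁻¹ =
        (CFC.sqrt (avg I.1 W.fn) * V⁻¹) * (V * (B x - avg I.1 B) * Y⁻¹) *
          (Y * (CFC.sqrt (avg I.1 U.fn))⁻¹) := by
      calc CFC.sqrt (avg I.1 W.fn) * (B x - avg I.1 B) * (CFC.sqrt (avg I.1 U.fn))⁻¹
          = CFC.sqrt (avg I.1 W.fn) * (V⁻¹ * V) * (B x - avg I.1 B) * (Y⁻¹ * Y) *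
            (CFC.sqrt (avg I.1 U.fn))⁻¹ := by
            rw [Matrix.nonsing_inv_mul _ hV, Matrix.nonsing_inv_mul _ hY]; simp
        _ = _ := by simp only [Matrix.mul_assoc]
    have h2 : ‖CFC.sqrt (avg I.1 W.fn) * (B x - avg I.1 B) * (CFC.sqrt (avg I.1 U.fn))⁻¹‖ ≤
        (C * Real.sqrt n) * ‖V * (B x - avg I.1 B) * Y⁻¹‖ := by
      rw [h1]
      calc _ ≤ ‖CFC.sqrt (avg I.1 W.fn) * V⁻¹‖ * ‖V * (B x - avg I.1 B) * Y⁻¹‖ *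
            ‖Y * (CFC.sqrt (avg I.1 U.fn))⁻¹‖ :=
            (norm_mul_le _ _).trans (by gcongr; exact norm_mul_le _ _)
        _ ≤ C * ‖V * (B x - avg I.1 B) * Y⁻¹‖ * Real.sqrt n := by
            gcongr
            · exact hCW I.1
            · exact Real.le_sqrt_of_sq_le (U.sq_norm_avg_sqrt_mul_inv_le I.1)
        _ = _ := by ring
    calc _ ≤ ENNReal.ofReal (C * Real.sqrt n) * ‖V * (B x - avg I.1 B) * Y⁻¹‖ₑ := by
          rw [← ofReal_norm, ← ofReal_norm, ← ENNReal.ofReal_mul (by positivity)]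
          exact ENNReal.ofReal_le_ofReal h2
      _ ≤ _ := by
          gcongr
          -- The elementary r ≤ 1 + r^{1+δ} suffices to pass from L^{1+δ} to L¹.
          generalize ‖V * (B x - avg I.1 B) * Y⁻¹‖ₑ = r
          obtain hr | hr := le_total r 1
          · exact hr.trans le_self_add
          · calc r = r ^ (1 : ℝ) := (ENNReal.rpow_one r).symm
              _ ≤ r ^ (1 + δ) := ENNReal.rpow_le_rpow_of_exponent_le hr (by linarith)
              _ ≤ _ := le_add_self
  calc _ ≤ ∫⁻ x in I.1.pts, ENNReal.ofReal (C * Real.sqrt n) *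
        (1 + ‖V * (B x - avg I.1 B) * Y⁻¹‖ₑ ^ (1 + δ)) := lintegral_mono hpt
    _ = ENNReal.ofReal (C * Real.sqrt n) * (volume I.1.pts +
        ∫⁻ x in I.1.pts, ‖V * (B x - avg I.1 B) * Y⁻¹‖ₑ ^ (1 + δ)) := by
        rw [lintegral_const_mul' _ _ ENNReal.ofReal_ne_top, lintegral_add_left measurable_const,
          setLIntegral_const, one_mul]
    _ ≤ ENNReal.ofReal (C * Real.sqrt n) * (volume I.1.pts + S * volume I.1.pts) := by gcongr
    _ = ENNReal.ofReal (C * Real.sqrt n * (1 + S.toReal)) * volume I.1.pts := by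
        rw [ENNReal.ofReal_mul (p := C * Real.sqrt n) (by positivity), ENNReal.ofReal_add zero_le_one
          ENNReal.toReal_nonneg, ENNReal.ofReal_one, ENNReal.ofReal_toReal hfin.ne]
        ring
    _ ≤ _ := by
        gcongr
        linarith

lemma div_le_div_six {x V : ℝ≥0∞} {y : ℝ} (h : x ≤ ENNReal.ofReal y * V) :
    x / ENNReal.ofReal (6 * y) ≤ V / 6 := by
  refine ENNReal.div_le_of_le_mul (h.trans (le_of_eq ?_))
  rw [ENNReal.ofReal_mul (by norm_num), show ENNReal.ofReal 6 = 6 by norm_num, ← mul_assoc,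
    ENNReal.div_mul_cancel (by norm_num) (by norm_num), mul_comm]

lemma le_mul_of_div_ofReal_le {x V : ℝ≥0∞} {y : ℝ} (hy : 0 < y)
    (h : x / ENNReal.ofReal y ≤ V) : x ≤ ENNReal.ofReal y * V := by
  rw [mul_comm]
  exact (ENNReal.div_le_iff (ENNReal.ofReal_pos.2 hy).ne' ENNReal.ofReal_ne_top).1 h

/-- Functions in `BMO²` satisfy the Carleson condition. -/
theorem carleson_of_memBMO [NeZero n] {W U : A2Weight d n} {B : Pt d → Mat n}
    (hB : MemBMO D W.fn U.fn B) :
    ∃ K : ℝ≥0∞, K ≠ ∞ ∧ ∀ J : D.cubes,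
      carlSum (fun p => ‖redCoeff D W.fn U.fn (haarCoeff D B) p‖ₑ ^ 2) J.1 ≤
        K * volume J.1.pts := by
  obtain ⟨K₁, hK₁, hosc⟩ := exists_lintegral_oscillation_le hB
  have hBI : ∀ I : Cube d, IntegrableOn B I.pts := fun I =>
    (hB.1.integrableOn_isCompact isCompact_Icc).mono_set (pts_subset_Icc I)
  have hn : (0 : ℝ) < n := Nat.cast_pos.2 (Nat.pos_of_ne_zero (NeZero.ne n))
  set a := (a2Char U.fn).toReal with ha
  have ha1 : 0 < a := ENNReal.toReal_pos
    (zero_lt_one.trans_le (one_le_a2Char U)).ne' U.a2Char_lt_top.ne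
  -- On J the averages of the two weights and of ‖f‖ are at most n, n a and K₁. The factor 6 makes
  -- the three terms of v add up to at most |J|/2.
  set lw : ℝ := 6 * n
  set lu : ℝ := 6 * (n * a)
  set lg : ℝ := 6 * K₁
  have hlw : 0 < lw := by positivity
  have hlu : 0 < lu := by positivity
  have hlg : 0 < lg := by positivity
  set c : ℝ := lw * lu
  have hc : 0 < c := by positivity
  -- G bounds the energy density on unstopped cubes and on their children, where 2^d allows for the
  -- drop in volume. The final constant 2G closes the induction: G|J| + 2G · |J|/2 = 2G|J|.
  set G : ℝ≥0∞ := ENNReal.ofReal (c * (n * (2 ^ d * lg) ^ 2))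
  set z : HaarIdx D → ℝ≥0∞ := fun p => ‖redCoeff D W.fn U.fn (haarCoeff D B) p‖ₑ ^ 2 with hz
  refine ⟨2 * G, ENNReal.mul_ne_top (by norm_num) ENNReal.ofReal_ne_top, fun J =>
    carlSum_le_of_carlTrunc_le fun N => ?_⟩
  induction N using Nat.strong_induction_on generalizing J with
  | _ N ih =>
    set R := CFC.sqrt (avg J.1 W.fn) with hR
    set Q := (CFC.sqrt (avg J.1 U.fn))⁻¹ with hQ
    set f : Pt d → Mat n := fun x => R * (B x - avg J.1 B) * Q with hf
    have hfI : ∀ I : Cube d, IntegrableOn f I.pts := fun I => by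
      let L : Mat n →L[ℝ] Mat n :=
        { toFun := fun Z => R * Z * Q
          map_add' := fun _ _ => by rw [mul_add, add_mul]
          map_smul' := fun r Z => by simp
          cont := by fun_prop }
      exact L.integrable_comp ((hBI I).sub (integrable_const _))
    -- Here the weights come from W and U⁻¹, measured against their averages on J: they compare the
    -- reducing matrices of a small cube with those of J.
    set w := rightWeight W (CFC.sqrt (avg J.1 W.fn))⁻¹
    set u := leftWeight U (CFC.sqrt (avg J.1 U.fn))
    have hw : ∀ I : Cube d, ∫⁻ x in I.pts, w x = volume I.pts * ENNReal.ofReal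
        (trForm (avg I W.fn) (CFC.sqrt (avg J.1 W.fn))⁻¹) := lintegral_rightWeight W _
    have hu : ∀ I : Cube d, ∫⁻ x in I.pts, u x = volume I.pts * ENNReal.ofReal
        (trForm (avg I fun x => (U.fn x)⁻¹) (CFC.sqrt (avg J.1 U.fn))) := fun I => by
      have := lintegral_leftWeight U (CFC.sqrt (avg J.1 U.fn)) I
      rwa [sqrt_isHermitian] at this
    set v : D.cubes → ℝ≥0∞ := fun I => (∫⁻ x in I.1.pts, w x) / ENNReal.ofReal lw +
      (∫⁻ x in I.1.pts, u x) / ENNReal.ofReal lu + (∫⁻ x in I.1.pts, ‖f x‖ₑ) / ENNReal.ofReal lg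
      with hv
    set e : D.cubes → ℝ≥0∞ := fun I => ENNReal.ofReal
      (c * ((volume.real I.1.pts)⁻¹ * hs (∫ x in I.1.pts, f x))) with he
    have cancel : ∀ {I : D.cubes} {t s : ℝ}, 0 ≤ s → volume I.1.pts * ENNReal.ofReal t ≤
        ENNReal.ofReal s * volume I.1.pts → t ≤ s := fun {I t s} hs h => by
      rw [mul_comm] at h
      exact (ENNReal.ofReal_le_ofReal_iff hs).1
        ((ENNReal.mul_le_mul_iff_left (volume_pts_ne_zero I.1) (volume_pts_ne_top I.1)).1 h)
    have hun : ∀ I : D.cubes, v I ≤ volume I.1.pts →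
        trForm (avg I.1 W.fn) (CFC.sqrt (avg J.1 W.fn))⁻¹ ≤ lw ∧
        trForm (avg I.1 fun x => (U.fn x)⁻¹) (CFC.sqrt (avg J.1 U.fn)) ≤ lu ∧
        ∫⁻ x in I.1.pts, ‖f x‖ₑ ≤ ENNReal.ofReal lg * volume I.1.pts := by
      intro I hI
      refine ⟨cancel (I := I) hlw.le ?_, cancel (I := I) hlu.le ?_, ?_⟩
      · rw [← hw]
        exact le_mul_of_div_ofReal_le hlw ((le_self_add.trans le_self_add).trans hI)
      · rw [← hu]
        exact le_mul_of_div_ofReal_le hlu ((le_add_self.trans le_self_add).trans hI)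
      · exact le_mul_of_div_ofReal_le hlg (le_add_self.trans hI)
    have hee : ∀ (I : D.cubes), ∫⁻ x in I.1.pts, ‖f x‖ₑ ≤
        ENNReal.ofReal (2 ^ d * lg) * volume I.1.pts → e I ≤ G * volume I.1.pts := by
      intro I hI
      have hv0 := volumeReal_pts_pos I.1
      have h1 : ‖∫ x in I.1.pts, f x‖ ≤ 2 ^ d * lg * volume.real I.1.pts := by
        have h2 := (enorm_integral_le_lintegral_enorm f).trans hI
        rw [← ofReal_volumeReal_pts, ← ENNReal.ofReal_mul (by positivity), ← ofReal_norm] at h2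
        exact (ENNReal.ofReal_le_ofReal_iff (by positivity)).1 h2
      rw [he, ← ofReal_volumeReal_pts, ← ENNReal.ofReal_mul (by positivity)]
      refine ENNReal.ofReal_le_ofReal ?_
      rw [mul_assoc c]
      refine mul_le_mul_of_nonneg_left ?_ hc.le
      calc (volume.real I.1.pts)⁻¹ * hs (∫ x in I.1.pts, f x)
          ≤ (volume.real I.1.pts)⁻¹ * (n * (2 ^ d * lg * volume.real I.1.pts) ^ 2) := by
            gcongr
            exact (hs_le _).trans (by gcongr)
        _ = _ := by field_simp
    have hrec := carlTrunc_add_le_of_stopping (z := z) (v := v) (e := e) (G := G) (K := 2 * G)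
      (N := N) (fun I => by
        simp only [hv, div_eq_mul_inv]
        rw [Finset.sum_add_distrib, Finset.sum_add_distrib, ← Finset.sum_mul, ← Finset.sum_mul,
          ← Finset.sum_mul]
        refine le_of_eq ?_
        congr 1
        · congr 1
          · congr 1
            exact I.1.sum_lintegral_child w
          · congr 1
            exact I.1.sum_lintegral_child u
        · congr 1
          exact I.1.sum_lintegral_child fun x => ‖f x‖ₑ)
      (fun I hI => by
        obtain ⟨h1, h2, -⟩ := hun I hI
        have hzI : ∀ s : Sig d, z (I, s) ≤ ENNReal.ofReal (c * hs (haarCoeff D f (I, s))) := by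
          intro s
          rw [hz, hf, haarCoeff_mul_sub hB.1]
          simp only
          rw [enorm_sq]
          refine ENNReal.ofReal_le_ofReal ((sq_norm_mul_mul_le (W.avg_posDef I.1)
            (U.avg_posDef I.1) (W.avg_posDef J.1) (U.avg_posDef J.1) _).trans ?_)
          refine mul_le_mul_of_nonneg_right ?_ (hs_nonneg _)
          exact mul_le_mul h1 ((U.trForm_inv_avg_le I.1 _).trans h2)
            (trForm_nonneg (U.avg_posDef I.1).inv.posSemidef _) hlw.le
        -- On an unstopped cube the reduced coefficients of B are at most c times those of f, and
        -- the energy identity turns the latter into the increase of e from I to its children.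
        have henergy := sum_hs_haarCoeff (D := D) f I (hfI I.1)
        calc ∑ s : Sig d, z (I, s) + e I
            ≤ ∑ s : Sig d, ENNReal.ofReal (c * hs (haarCoeff D f (I, s))) + e I := by
              gcongr with s
              exact hzI s
          _ = ENNReal.ofReal (c * (∑ s : Sig d, hs (haarCoeff D f (I, s)) +
                (volume.real I.1.pts)⁻¹ * hs (∫ x in I.1.pts, f x))) := by
              rw [he, ← ENNReal.ofReal_sum_of_nonneg
                fun s _ => mul_nonneg hc.le (hs_nonneg _), ← ENNReal.ofReal_add
                (Finset.sum_nonneg fun s _ => mul_nonneg hc.le (hs_nonneg _))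
                (mul_nonneg hc.le (mul_nonneg (inv_nonneg.2 (volumeReal_pts_pos _).le)
                  (hs_nonneg _))), mul_add, Finset.mul_sum]
          _ = ∑ b, e (DyadicGrid.child I b) := by
              rw [henergy, Finset.mul_sum, ENNReal.ofReal_sum_of_nonneg
                fun b _ => mul_nonneg hc.le (mul_nonneg
                  (inv_nonneg.2 (volumeReal_pts_pos _).le) (hs_nonneg _))]
              rfl
          _ ≤ _ := le_rfl)
      (fun I hI => hee I ((hun I hI).2.2.trans (by
        gcongr
        exact le_mul_of_one_le_left hlg.le (one_le_pow₀ one_le_two))))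
      (fun I hI b => hee _ (by
        calc ∫⁻ x in (I.1.child b).pts, ‖f x‖ₑ ≤ ∫⁻ x in I.1.pts, ‖f x‖ₑ :=
              lintegral_mono_set (I.1.child_subset b)
          _ ≤ ENNReal.ofReal lg * volume I.1.pts := (hun I hI).2.2
          _ = ENNReal.ofReal (2 ^ d * lg) * volume (I.1.child b).pts := by
              rw [← I.1.volume_child b, ENNReal.ofReal_mul (p := 2 ^ d) (by positivity),
                ENNReal.ofReal_pow (by norm_num), ENNReal.ofReal_ofNat]
              ring))
      ih le_rfl J
    have hvJ : v J ≤ volume J.1.pts / 6 + volume J.1.pts / 6 + volume J.1.pts / 6 := by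
      refine add_le_add (add_le_add (div_le_div_six ?_) (div_le_div_six ?_))
        (div_le_div_six (hosc J))
      · rw [hw, trForm_sqrt_inv (W.avg_posDef J.1), mul_comm]
      · rw [hu, mul_comm]
        gcongr
        exact trForm_avg_inv_sqrt_le_toReal U J.1
    have hsix : 2 * (volume J.1.pts / 6 + volume J.1.pts / 6 + volume J.1.pts / 6) =
        volume J.1.pts := by
      have : 2 * (volume J.1.pts / 6 + volume J.1.pts / 6 + volume J.1.pts / 6) =
          6 * (volume J.1.pts / 6) := by ring
      rw [this]
      exact ENNReal.mul_div_cancel (by norm_num) (by norm_num)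
    have h2v : 2 * v J ≤ volume J.1.pts := by rw [← hsix]; gcongr
    have hvJ' : v J ≤ volume J.1.pts := by
      refine le_trans ?_ h2v
      rw [two_mul]; exact le_self_add
    calc carlTrunc z N J ≤ G * volume J.1.pts + 2 * G * v J := le_self_add.trans (hrec hvJ')
      _ = G * volume J.1.pts + G * (2 * v J) := by ring
      _ ≤ G * volume J.1.pts + G * volume J.1.pts := by gcongr
      _ = _ := by ring

end CarlesonOfBMO

/-! ### Duality -/

section Duality

variable {d n : ℕ} {D : DyadicGrid d} {W U : A2Weight d n}

lemma bmoNorm_le {B : Pt d → Mat n} {c : ℝ≥0∞} (h : ∀ J : D.cubes,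
      carlSum (fun p => ‖redCoeff D W.fn U.fn (haarCoeff D B) p‖ₑ ^ 2) J.1 ≤
        c ^ 2 * volume J.1.pts) : bmoNorm D W.fn U.fn B ≤ c := by
  have h1 : (⨆ J ∈ D.cubes, (volume J.pts)⁻¹ *
      carlSum (fun p => ‖redCoeff D W.fn U.fn (haarCoeff D B) p‖ₑ ^ 2) J) ≤ c ^ 2 := by
    refine iSup₂_le fun J hJ => ?_
    calc _ ≤ (volume J.pts)⁻¹ * (c ^ 2 * volume J.pts) := by gcongr; exact h ⟨J, hJ⟩
      _ = c ^ 2 * ((volume J.pts)⁻¹ * volume J.pts) := by ring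
      _ = c ^ 2 := by
        rw [ENNReal.inv_mul_cancel (volume_pts_ne_zero J) (volume_pts_ne_top J), mul_one]
  calc bmoNorm D W.fn U.fn B ≤ (c ^ 2) ^ (1 / 2 : ℝ) := ENNReal.rpow_le_rpow h1 (by norm_num)
    _ = c := by
      rw [← ENNReal.rpow_natCast, ← ENNReal.rpow_mul]
      norm_num

lemma carlSum_le_bmoNorm (B : Pt d → Mat n) (J : Cube d) (hJ : J ∈ D.cubes) :
    carlSum (fun p => ‖redCoeff D W.fn U.fn (haarCoeff D B) p‖ₑ ^ 2) J ≤
      bmoNorm D W.fn U.fn B ^ 2 * volume J.pts := by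
  have h1 : (volume J.pts)⁻¹ *
      carlSum (fun p => ‖redCoeff D W.fn U.fn (haarCoeff D B) p‖ₑ ^ 2) J ≤
        ⨆ J ∈ D.cubes, (volume J.pts)⁻¹ *
      carlSum (fun p => ‖redCoeff D W.fn U.fn (haarCoeff D B) p‖ₑ ^ 2) J :=
    le_iSup₂ (f := fun (J : Cube d) (_ : J ∈ D.cubes) => (volume J.pts)⁻¹ *
      carlSum (fun p => ‖redCoeff D W.fn U.fn (haarCoeff D B) p‖ₑ ^ 2) J) J hJ
  have h2 : bmoNorm D W.fn U.fn B ^ 2 = ⨆ J ∈ D.cubes, (volume J.pts)⁻¹ *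
      carlSum (fun p => ‖redCoeff D W.fn U.fn (haarCoeff D B) p‖ₑ ^ 2) J := by
    rw [bmoNorm, ← ENNReal.rpow_natCast, ← ENNReal.rpow_mul]
    norm_num
    rfl
  rw [h2]
  calc _ = volume J.pts * ((volume J.pts)⁻¹ * _) := by
        rw [← mul_assoc, ENNReal.mul_inv_cancel (volume_pts_ne_zero J) (volume_pts_ne_top J),
          one_mul]
    _ ≤ volume J.pts * _ := by gcongr
    _ = _ := mul_comm _ _

lemma bmoNorm_lt_top_of_memBMO [NeZero d] [NeZero n] {B : Pt d → Mat n}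
    (hB : MemBMO D W.fn U.fn B) : bmoNorm D W.fn U.fn B < ∞ := by
  obtain ⟨K, hK, h⟩ := carleson_of_memBMO hB
  refine (bmoNorm_le (c := K ^ (1 / 2 : ℝ)) fun J => ?_).trans_lt
    (ENNReal.rpow_lt_top_of_nonneg (by norm_num) hK)
  rw [← ENNReal.rpow_natCast, ← ENNReal.rpow_mul]
  norm_num
  exact h J

/-- The duality inequality for the pairing of `H¹` and `BMO²`. -/
lemma tsum_enorm_trace_le [NeZero d] (B : Pt d → Mat n) (hB : bmoNorm D W.fn U.fn B < ∞)
    (A : HaarIdx D → Mat n)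
    (hA : ∫⁻ x, sqFun D (fun y => (W.fn y)⁻¹) (haarMul D U.fn A) x ≠ ∞) :
    ∑' p, ‖(A p * (haarCoeff D B p)ᴴ).trace‖ₑ ≤ 2 * n * (1 + 2 * n) * bmoNorm D W.fn U.fn B *
      ∫⁻ x, sqFun D (fun y => (W.fn y)⁻¹) (haarMul D U.fn A) x := by
  set β := bmoNorm D W.fn U.fn B with hβ
  set S := ∫⁻ x, sqFun D (fun y => (W.fn y)⁻¹) (haarMul D U.fn A) x
  have hC0 : (2 * n * (1 + 2 * n) : ℝ≥0∞) ≠ ∞ := by finiteness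
  -- The inequality for sequences needs a nonzero constant, so it is applied with β + 1/k and k is
  -- sent to infinity.
  have h1 : ∀ k : ℕ, 0 < k → ∑' p, ‖(A p * (haarCoeff D B p)ᴴ).trace‖ₑ ≤
      2 * n * (1 + 2 * n) * (β + (k : ℝ≥0∞)⁻¹) * S := by
    intro k hk
    rw [ENNReal.tsum_eq_iSup_sum]
    refine iSup_le fun F => sum_enorm_trace_le D W U A (haarCoeff D B) ?_ ?_ (fun J hJ => ?_) F
    · exact (lt_of_lt_of_le (ENNReal.inv_pos.2 (ENNReal.natCast_ne_top k)) le_add_self).ne'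
    · exact ENNReal.add_ne_top.2 ⟨hB.ne, ENNReal.inv_ne_top.2 (by exact_mod_cast hk.ne')⟩
    · refine (carlSum_le_bmoNorm B J hJ).trans ?_
      gcongr
      exact le_self_add
  have h2 : Filter.Tendsto (fun k : ℕ => 2 * n * (1 + 2 * n) * (β + (k : ℝ≥0∞)⁻¹) * S)
      Filter.atTop (nhds (2 * n * (1 + 2 * n) * (β + 0) * S)) :=
    ENNReal.Tendsto.mul_const (ENNReal.Tendsto.const_mul
      (ENNReal.tendsto_inv_nat_nhds_zero.const_add β) (Or.inr hC0)) (Or.inr hA)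
  rw [add_zero] at h2
  refine ge_of_tendsto h2 ?_
  filter_upwards [Filter.eventually_gt_atTop 0] with k hk
  exact h1 k hk


lemma Represents.apply_poly [NeZero d] {B : Pt d → Mat n} {l : StrongDual ℂ (H1 D W U)}
    (h : Represents D W U B l) (F : Finset (HaarIdx D)) (A : HaarIdx D → Mat n) :
    l (H1.poly F A) = ∑ p ∈ F, (A p * (haarCoeff D B p)ᴴ).trace := by
  classical
  have h1 := h (H1.poly F A)
  simp only [H1.fn_poly, haarCoeff_haarPoly] at h1
  refine h1.unique ?_
  have h2 : ∑ p ∈ F, (A p * (haarCoeff D B p)ᴴ).trace =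
      ∑ p ∈ F, ((if p ∈ F then A p else 0) * (haarCoeff D B p)ᴴ).trace :=
    Finset.sum_congr rfl fun p hp => by rw [if_pos hp]
  rw [h2]
  exact hasSum_sum_of_ne_finset_zero fun p hp => by simp [hp]

lemma Represents.haarCoeff_eq [NeZero d] {B B' : Pt d → Mat n} {l : StrongDual ℂ (H1 D W U)}
    (h : Represents D W U B l) (h' : Represents D W U B' l) (p : HaarIdx D) :
    haarCoeff D B p = haarCoeff D B' p := by
  refine eq_of_trace_mul_conjTranspose fun A => ?_
  have h1 := h.apply_poly {p} fun _ => A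
  have h2 := h'.apply_poly {p} fun _ => A
  rw [Finset.sum_singleton] at h1 h2
  exact h1.symm.trans h2

/-- The functional on `H¹` induced by a function in `BMO²`. -/
theorem exists_represents [NeZero d] {B : Pt d → Mat n} (hB : bmoNorm D W.fn U.fn B < ∞) :
    ∃ l : StrongDual ℂ (H1 D W U), Represents D W U B l ∧
      ‖l‖ ≤ 2 * n * (1 + 2 * n) * (bmoNorm D W.fn U.fn B).toReal := by
  have hC0 : (2 * n * (1 + 2 * n) : ℝ≥0∞) ≠ ∞ := by finiteness
  have hbound : ∀ Φ : H1 D W U, ∑' p, ‖(haarCoeff D Φ.fn p * (haarCoeff D B p)ᴴ).trace‖ₑ ≤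
      2 * n * (1 + 2 * n) * bmoNorm D W.fn U.fn B * h1Norm D W.fn U.fn Φ.fn := fun Φ =>
    tsum_enorm_trace_le B hB _ Φ.h1Norm_lt_top.ne
  have hfin : ∀ Φ : H1 D W U,
      2 * n * (1 + 2 * n) * bmoNorm D W.fn U.fn B * h1Norm D W.fn U.fn Φ.fn ≠ ∞ := fun Φ =>
    ENNReal.mul_ne_top (ENNReal.mul_ne_top hC0 hB.ne) Φ.h1Norm_lt_top.ne
  have hsum : ∀ Φ : H1 D W U,
      Summable fun p => (haarCoeff D Φ.fn p * (haarCoeff D B p)ᴴ).trace := fun Φ =>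
    Summable.of_norm (tsum_enorm_ne_top_iff_summable_norm.1
      (ne_top_of_le_ne_top (hfin Φ) (hbound Φ)))
  let l₀ : H1 D W U →ₗ[ℂ] ℂ :=
    { toFun := fun Φ => ∑' p, (haarCoeff D Φ.fn p * (haarCoeff D B p)ᴴ).trace
      map_add' := fun Φ Ψ => by
        rw [← (hsum Φ).tsum_add (hsum Ψ)]
        refine tsum_congr fun p => ?_
        rw [H1.fn_add, haarCoeff_add D Φ.locallyIntegrable Ψ.locallyIntegrable, Pi.add_apply,
          add_mul, Matrix.trace_add]
      map_smul' := fun c Φ => by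
        simp only [RingHom.id_apply, smul_eq_mul]
        rw [← tsum_mul_left]
        refine tsum_congr fun p => ?_
        rw [H1.fn_smul, haarCoeff_smul, Pi.smul_apply, Matrix.smul_mul, Matrix.trace_smul,
          smul_eq_mul] }
  have hl₀ : ∀ Φ, ‖l₀ Φ‖ ≤ 2 * n * (1 + 2 * n) * (bmoNorm D W.fn U.fn B).toReal * ‖Φ‖ := by
    intro Φ
    have h1 : ‖l₀ Φ‖ₑ ≤
        2 * n * (1 + 2 * n) * bmoNorm D W.fn U.fn B * h1Norm D W.fn U.fn Φ.fn :=
      enorm_tsum_le_tsum_enorm.trans (hbound Φ)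
    have h2 := ENNReal.toReal_mono (hfin Φ) h1
    rw [toReal_enorm, ENNReal.toReal_mul, ENNReal.toReal_mul] at h2
    rw [H1.norm_eq]
    convert h2 using 3
    rw [ENNReal.toReal_mul, ENNReal.toReal_add ENNReal.one_ne_top (by finiteness)]
    simp
  refine ⟨l₀.mkContinuous _ hl₀, fun Φ => (hsum Φ).hasSum,
    l₀.mkContinuous_norm_le (by positivity) hl₀⟩

/-- Every functional on `H¹` is induced by a function in `BMO²`. -/
theorem exists_memBMO_represents [NeZero d] [NeZero n] (l : StrongDual ℂ (H1 D W U)) :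
    ∃ B : Pt d → Mat n, MemBMO D W.fn U.fn B ∧ Represents D W U B l ∧
      (bmoNorm D W.fn U.fn B).toReal ≤
        Real.sqrt n * Real.sqrt (a2Char W.fn).toReal * ‖l‖ := by
  obtain ⟨Z, hZ⟩ := exists_coeff_of_functional l
  have hcarl := fun J : D.cubes => carleson_of_functional l hZ J.1
  obtain ⟨B, hB, hBZ⟩ := exists_memBMO_of_carleson D W U Z ENNReal.ofReal_ne_top hcarl
  refine ⟨B, hB, fun Φ => by rw [hBZ]; exact hasSum_of_coeff l hZ Φ, ?_⟩
  have h0 : 0 ≤ Real.sqrt n * Real.sqrt (a2Char W.fn).toReal * ‖l‖ := by positivity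
  refine ENNReal.toReal_le_of_le_ofReal h0 (bmoNorm_le fun J => ?_)
  rw [hBZ, ← ENNReal.ofReal_pow h0, mul_pow, mul_pow, Real.sq_sqrt (Nat.cast_nonneg n),
    Real.sq_sqrt ENNReal.toReal_nonneg]
  exact hcarl J

lemma integrable_trace_haarPoly_mul {B : Pt d → Mat n} (hB : LocallyIntegrable B volume)
    (F : Finset (HaarIdx D)) (A : HaarIdx D → Mat n) :
    Integrable (fun x => (haarPoly D F A x * (B x)ᴴ).trace) volume ∧
      ∫ x, (haarPoly D F A x * (B x)ᴴ).trace =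
        ∑ p ∈ F, (A p * (haarCoeff D B p)ᴴ).trace := by
  let L : Mat n → Mat n →L[ℝ] ℂ := fun X =>
    { toFun := fun Z => (X * Zᴴ).trace
      map_add' := fun _ _ => by
        rw [Matrix.conjTranspose_add, mul_add, Matrix.trace_add]
      map_smul' := fun r Z => by
        simp [Matrix.conjTranspose_smul]
      cont := by fun_prop }
  have h1 : ∀ x, (haarPoly D F A x * (B x)ᴴ).trace =
      ∑ p ∈ F, L (A p) (haar p.1.1 p.2.1 x • B x) := by
    intro x
    rw [haarPoly, Finset.sum_mul, Matrix.trace_sum]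
    refine Finset.sum_congr rfl fun p _ => ?_
    rw [map_smul, Matrix.smul_mul, Matrix.trace_smul]
    rfl
  have h2 : ∀ p ∈ F, Integrable (fun x => L (A p) (haar p.1.1 p.2.1 x • B x)) := fun p _ =>
    (L (A p)).integrable_comp (integrable_haar_smul _ _ hB)
  simp only [h1]
  refine ⟨integrable_finsetSum _ h2, ?_⟩
  rw [integral_finsetSum _ h2]
  exact Finset.sum_congr rfl fun p _ =>
    (L (A p)).integral_comp_comm (integrable_haar_smul _ _ hB)

end Duality

/-! ### The trivial cases d = 0 and n = 0 -/

section Degenerate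

variable {d n : ℕ} {D : DyadicGrid d} {W U : A2Weight d n}

/-- In dimension zero there is no signature other than (1, …, 1), and for n = 0 the only matrix is
0. All coefficients, seminorms and pairings then vanish, so these cases need neither cube geometry
nor [W] ≥ 1. -/
lemma haarIdx_degenerate (h : d = 0 ∨ n = 0) (D : DyadicGrid d) (_p : HaarIdx D) (A : Mat n) :
    A = 0 := by
  obtain rfl | rfl := h
  · exact absurd (Subsingleton.elim _ _) _p.2.2
  · exact Subsingleton.elim _ _

lemma h1Norm_eq_zero_of_degenerate (h : ∀ (_p : HaarIdx D) (A : Mat n), A = 0)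
    (Φ : Pt d → Mat n) : h1Norm D W.fn U.fn Φ = 0 := by
  unfold h1Norm sqFun
  have h1 : ∀ (x : Pt d) (p : HaarIdx D), p.1.1.pts.indicator (fun y =>
      ‖CFC.sqrt (W.fn y)⁻¹ * haarMul D U.fn (haarCoeff D Φ) p‖ₑ ^ 2 / volume p.1.1.pts) x = 0 := by
    intro x p
    simp [h p (haarMul D U.fn (haarCoeff D Φ) p)]
  simp [h1]

lemma bmoNorm_eq_zero_of_degenerate (h : ∀ (_p : HaarIdx D) (A : Mat n), A = 0)
    (B : Pt d → Mat n) : bmoNorm D W.fn U.fn B = 0 := by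
  refine le_antisymm (bmoNorm_le fun J => ?_) zero_le
  refine le_trans (le_of_eq (ENNReal.tsum_eq_zero.2 fun p => ?_)) zero_le
  simp [h p.1 (redCoeff D W.fn U.fn (haarCoeff D B) p.1)]

lemma memBMO_zero : MemBMO D W.fn U.fn 0 := by
  refine ⟨locallyIntegrable_zero, 1, one_pos, ?_⟩
  have h1 : ∀ I : Cube d, avg I (0 : Pt d → Mat n) = 0 := fun I => by simp [avg_eq]
  simp [h1]

lemma represents_of_degenerate (h : ∀ (_p : HaarIdx D) (A : Mat n), A = 0) (B : Pt d → Mat n) :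
    Represents D W U B 0 := by
  intro Φ
  have h1 : (fun p : HaarIdx D => (haarCoeff D Φ.fn p * (haarCoeff D B p)ᴴ).trace) = 0 := by
    funext p
    simp [h p (haarCoeff D Φ.fn p)]
  rw [h1]
  exact hasSum_zero

lemma functional_eq_zero_of_degenerate (h : ∀ (_p : HaarIdx D) (A : Mat n), A = 0)
    (l : StrongDual ℂ (H1 D W U)) : l = 0 := by
  ext Φ
  have h1 := l.le_opNorm Φ
  rw [H1.norm_eq, h1Norm_eq_zero_of_degenerate h, ENNReal.toReal_zero, mul_zero] at h1
  exact norm_le_zero_iff.1 h1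

lemma haarPoly_eq_zero_of_degenerate (h : ∀ (_p : HaarIdx D) (A : Mat n), A = 0)
    (F : Finset (HaarIdx D)) (A : HaarIdx D → Mat n) : haarPoly D F A = 0 := by
  funext x
  exact Finset.sum_eq_zero fun p _ => h p _

end Degenerate

end MatrixHardy

end

/-! ### Assembly of the duality theorem -/

open MatrixHardy MeasureTheory in
theorem theorem1p3 (d n : ℕ) :
    ∃ C : ℝ, 0 < C ∧ ∀ (D : DyadicGrid d) (W U : A2Weight d n),
      -- every `B ∈ BMO²` defines, through the pairing, a bounded linear functional on `H¹`
      (∀ B : Pt d → Mat n, MemBMO D W.fn U.fn B →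
        bmoNorm D W.fn U.fn B < ⊤ ∧
        ∃ l : StrongDual ℂ (H1 D W U), Represents D W U B l ∧
          ‖l‖ ≤ C * Real.sqrt (a2Char W.fn).toReal * (bmoNorm D W.fn U.fn B).toReal) ∧
      -- every bounded linear functional on `H¹` arises so from some `B ∈ BMO²`
      (∀ l : StrongDual ℂ (H1 D W U), ∃ B : Pt d → Mat n,
        MemBMO D W.fn U.fn B ∧ Represents D W U B l ∧
        (bmoNorm D W.fn U.fn B).toReal ≤ C * Real.sqrt (a2Char W.fn).toReal * ‖l‖) ∧
      -- `B` is determined by the functional as an element of `BMO²`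
      (∀ B B' : Pt d → Mat n, MemBMO D W.fn U.fn B → MemBMO D W.fn U.fn B' →
        ∀ l : StrongDual ℂ (H1 D W U), Represents D W U B l → Represents D W U B' l →
          ∀ p, haarCoeff D B p = haarCoeff D B' p) ∧
      -- on finite Haar sums, which belong to `H¹`, the pairing is the `L²` integral
      (∀ (F : Finset (HaarIdx D)) (A : HaarIdx D → Mat n),
        ∃ Φ : H1 D W U, Φ.fn = haarPoly D F A ∧
          ∀ (B : Pt d → Mat n), MemBMO D W.fn U.fn B →
            Integrable (fun x => (haarPoly D F A x * (B x).conjTranspose).trace) volume ∧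
            ∀ l : StrongDual ℂ (H1 D W U), Represents D W U B l →
              l Φ = ∫ x, (haarPoly D F A x * (B x).conjTranspose).trace) := by
  by_cases hdeg : d = 0 ∨ n = 0
  · refine ⟨1, one_pos, fun D W U => ?_⟩
    have h := haarIdx_degenerate hdeg D
    refine ⟨fun B _ => ⟨?_, 0, represents_of_degenerate h B, ?_⟩,
      fun l => ⟨0, memBMO_zero, ?_, ?_⟩, fun B B' _ _ l _ _ p => ?_, fun F A => ⟨0, ?_, fun B _ => ?_⟩⟩
    · rw [bmoNorm_eq_zero_of_degenerate h]
      exact ENNReal.zero_lt_top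
    · rw [norm_zero]
      positivity
    · rw [functional_eq_zero_of_degenerate h l]
      exact represents_of_degenerate h 0
    · rw [bmoNorm_eq_zero_of_degenerate h, ENNReal.toReal_zero]
      positivity
    · rw [h p (haarCoeff D B p), h p (haarCoeff D B' p)]
    · exact (haarPoly_eq_zero_of_degenerate h F A).symm
    · simp [haarPoly_eq_zero_of_degenerate h F A]
  · obtain ⟨hd, hn⟩ := not_or.1 hdeg
    have : NeZero d := ⟨hd⟩
    have : NeZero n := ⟨hn⟩
    refine ⟨2 * n * (1 + 2 * n) + Real.sqrt n + 1, by positivity, fun D W U => ?_⟩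
    refine ⟨fun B hB => ?_, fun l => ?_, fun B B' _ _ l hl hl' p => hl.haarCoeff_eq hl' p,
      fun F A => ⟨H1.poly F A, H1.fn_poly F A, fun B hB => ?_⟩⟩
    · have hfin := bmoNorm_lt_top_of_memBMO hB
      obtain ⟨l, hl, hln⟩ := exists_represents (D := D) (W := W) (U := U) hfin
      refine ⟨hfin, l, hl, hln.trans ?_⟩
      -- The functional is bounded even without the factor [W]^{1/2}; since [W] ≥ 1 the factor can
      -- be inserted freely.
      have h1 : 1 ≤ Real.sqrt (a2Char W.fn).toReal := by
        rw [Real.one_le_sqrt, ← ENNReal.toReal_one]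
        exact ENNReal.toReal_mono W.a2Char_lt_top.ne (one_le_a2Char W)
      refine mul_le_mul_of_nonneg_right ?_ ENNReal.toReal_nonneg
      refine le_trans ?_ (le_mul_of_one_le_right (by positivity) h1)
      linarith [Real.sqrt_nonneg (n : ℝ)]
    · obtain ⟨B, hB, hl, hle⟩ := exists_memBMO_represents l
      refine ⟨B, hB, hl, hle.trans ?_⟩
      have : (0 : ℝ) ≤ 2 * n * (1 + 2 * n) := by positivity
      gcongr
      linarith
    · obtain ⟨hint, heq⟩ := integrable_trace_haarPoly_mul hB.1 F A
      exact ⟨hint, fun l hl => by rw [heq]; exact hl.apply_poly F A⟩
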